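/- Let $\phi=\frac{1+\sqrt5}{2}$, let $f_n$ be the Fibonacci numbers ($f_0=0$, $f_1=1$), and let $\sigma$ be the Fibonacci substitution $a\mapsto ab$, $b\mapsto a$. Let $N:\mathbb N\to\mathbb N$ be strictly increasing with $N(0)=0$ and put $\Delta(n)=N(n)-N(n-1)$ for $n\ge 1$. On the alphabet $\{a,b,e\}$ define words $S_n(x)$ by $S_0(x)=x$ and $S_n(x)=S_{n-1}(\tilde\sigma^{(n)}(x))$ ($S_{n-1}$ being extended to words by concatenation), where, for $x\in\{a,b\}$, $\tilde\sigma^{(n)}(x)=\sigma^{\Delta(n)}(x)$ if $n$ is odd, and $\tilde\sigma^{(n)}(x)$ is $\sigma^{\Delta(n)}(x)$ with its last occurrence of $b$ (if any) replaced by $e$ if $n$ is even; and $\tilde\sigma^{(n)}(e)=a^{f_{\Delta(n)}}b^{f_{\Delta(n)-1}}$ for all $n\ge1$. Let $X_S$ be the set of bi-infinite sequences all of whose finite factors are subwords of some $S_n(x)$; the letter $e$ does not occur in them. Let $\Omega$ be the space of scrambled Fibonacci tilings with equal tile lengths, that is, of all tilings of $\mathbb R$ by labelled unit intervals whose sequence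 of labels belongs to $X_S$, with the usual tiling topology (two tilings are close if they agree in a large ball about the origin up to a small translation) and the translation action $T\mapsto T-t$ of $\mathbb R$. A number $\beta\in\mathbb R$ is a topological eigenvalue if there is a continuous $f:\Omega\to\mathbb C$, $f\ne0$, with $f(T-t)=e^{2\pi i\beta t}f(T)$ for all $T\in\Omega$ and $t\in\mathbb R$. It is an eigenvalue with respect to an invariant probability measure $\mu$ if there is a nonzero $f\in L^2(\Omega,\mu)$ (an eigenfunction) such that, for every $t$, this equation holds for $\mu$-almost all $T$. A set $\Lambda\subset\mathbb R$ is a Meyer set if it is relatively dense and harmonious, i.e. for every homomorphism $\chi:\langle\Lambda\rangle\to S^1$ and $\varepsilon>0$ there is $\beta\in\mathbb R$ with $|\chi(x)-e^{2\pi i\beta x}|<\varepsilon$ for all $x\in\Lambda$. A tiling is a Meyer tiling if it is mutually locally derivable (MLD) with a Meyer set. A Delone set $\Lambda$ is pure point diffractive if it has an autocorrelation measure $\gamma=\lim_{R\to\infty}\frac1{2R}\sum_{x,y\in\Lambda\cap[-R,R]}\delta_{x-y}$ (vague limit) whose Fourier transform is a pure point measure; a tiling is pure point diffractive if every Delone set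 that is MLD with it is pure point diffractive. **Theorem.** Suppose that $\Delta(\kappa)\ge N(\kappa-1)$ for all odd $\kappa$ and that $\sum_{\kappa\text{ odd}}\phi^{-\Delta(\kappa+1)}<\infty$. Then $\Omega$ is non-empty, and the set of topological eigenvalues of $(\Omega,\mathbb R)$ is exactly $\mathbb Z$. Every tiling $T\in\Omega$ is repetitive, is a Meyer tiling and is pure point diffractive. There is exactly one translation-invariant Borel probability measure $\mu$ on $\Omega$; the system $(\Omega,\mathbb R,\mu)$ has pure point dynamical spectrum (the eigenfunctions span a dense subspace of $L^2(\Omega,\mu)$), and some of its eigenvalues are not topological. The eigenvalues of $(\Omega,\mathbb R,\mu)$ form a subgroup of $\mathbb R$ of rank $2$, and the topological eigenvalues form a subgroup of rank $1$ that is a direct summand of it. -/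

import Mathlib

open Set Filter Topology MeasureTheory
open scoped SchwartzMap FourierTransform

noncomputable section

namespace ScrambledFibonacci

/-! ### Labelled point patterns on the line -/

/-- A pattern on the line with labels in `A`: the set of pairs (position, label). A tiling of the
line by labelled intervals is recorded as the set of pairs (left endpoint, label) of its tiles. -/
@[ext]
structure Pattern (A : Type) : Type where
  /-- The pairs (position, label). -/
  pts : Set (ℝ × A)

namespace Pattern

variable {A B : Type}

/-- The translate `T - t`. -/
def translate (T : Pattern A) (t : ℝ) : Pattern A := ⟨{p | (p.1 + t, p.2) ∈ T.pts}⟩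

/-- The patch of `T` in the ball of radius `R` about the origin. -/
def patch (T : Pattern A) (R : ℝ) : Set (ℝ × A) := {p | p ∈ T.pts ∧ |p.1| ≤ R}

/-- `T'` is `ε`-close to `T` if, up to a translation of size at most `ε`, both agree in the ball of
radius `1 / ε` about the origin. -/
def Close (ε : ℝ) (T T' : Pattern A) : Prop :=
  ∃ s : ℝ, |s| ≤ ε ∧ (T'.translate s).patch (1 / ε) = T.patch (1 / ε)

theorem patch_eq_of_le {T T' : Pattern A} {r R : ℝ} (hr : r ≤ R) (h : T.patch R = T'.patch R) :
    T.patch r = T'.patch r := by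
  ext p
  have hp : p ∈ T.patch R ↔ p ∈ T'.patch R := by rw [h]
  simp only [patch, mem_ofPred_eq] at hp ⊢
  constructor
  · rintro ⟨h1, h2⟩
    exact ⟨(hp.1 ⟨h1, h2.trans hr⟩).1, h2⟩
  · rintro ⟨h1, h2⟩
    exact ⟨(hp.2 ⟨h1, h2.trans hr⟩).1, h2⟩

theorem Close.mono {T T' : Pattern A} {δ ε : ℝ} (hδ : 0 < δ) (h : δ ≤ ε) (hc : Close δ T T') :
    Close ε T T' := by
  obtain ⟨s, hs, he⟩ := hc
  exact ⟨s, hs.trans h, patch_eq_of_le (one_div_le_one_div_of_le hδ h) he⟩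

/-- The tiling topology. -/
instance : TopologicalSpace (Pattern A) where
  IsOpen U := ∀ T ∈ U, ∃ ε : ℝ, 0 < ε ∧ ∀ T', Close ε T T' → T' ∈ U
  isOpen_univ := fun _ _ => ⟨1, one_pos, fun _ _ => mem_univ _⟩
  isOpen_inter := by
    intro U V hU hV T hT
    obtain ⟨ε, hε, h1⟩ := hU T hT.1
    obtain ⟨δ, hδ, h2⟩ := hV T hT.2
    have hm : 0 < min ε δ := lt_min hε hδ
    exact ⟨min ε δ, hm, fun T' h =>
      ⟨h1 T' (h.mono hm (min_le_left _ _)), h2 T' (h.mono hm (min_le_right _ _))⟩⟩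
  isOpen_sUnion := by
    intro 𝒰 h T hT
    obtain ⟨U, hU, hTU⟩ := hT
    obtain ⟨ε, hε, h1⟩ := h U hU T hTU
    exact ⟨ε, hε, fun T' h' => ⟨U, hU, h1 T' h'⟩⟩

instance : MeasurableSpace (Pattern A) := borel _

instance : BorelSpace (Pattern A) := ⟨rfl⟩

/-- Every patch of `T` reappears, exactly, within a bounded distance of every point, with a bound
that depends only on the radius of the patch. -/
def IsRepetitive (T : Pattern A) : Prop :=
  ∀ R : ℝ, 0 < R → ∃ R' : ℝ, 0 < R' ∧ ∀ x y : ℝ, ∃ z : ℝ, |z - y| ≤ R' ∧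
    (T.translate z).patch R = (T.translate x).patch R

/-- A set of points as a pattern with a single label. -/
def ofSet (Λ : Set ℝ) : Pattern Unit := ⟨{p | p.1 ∈ Λ}⟩

/-- `T'` is locally derivable from `T`: whether `T'` has a point with a given label at `x` is decided
by the patch of `T - x` of some fixed radius. -/
def IsLocallyDerivable (T' : Pattern B) (T : Pattern A) : Prop :=
  ∃ R : ℝ, 0 < R ∧ ∀ x y : ℝ, (T.translate x).patch R = (T.translate y).patch R →
    ∀ o : B, (x, o) ∈ T'.pts ↔ (y, o) ∈ T'.pts

/-- Mutual local derivability. -/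
def IsMLD (T : Pattern A) (T' : Pattern B) : Prop :=
  T'.IsLocallyDerivable T ∧ T.IsLocallyDerivable T'

end Pattern

/-! ### Delone sets, Meyer sets, diffraction -/

def IsRelativelyDense (Λ : Set ℝ) : Prop :=
  ∃ R : ℝ, 0 < R ∧ ∀ x : ℝ, ∃ y ∈ Λ, |x - y| ≤ R

def IsUniformlyDiscrete (Λ : Set ℝ) : Prop :=
  ∃ r : ℝ, 0 < r ∧ ∀ x ∈ Λ, ∀ y ∈ Λ, x ≠ y → r ≤ |x - y|

def IsDelone (Λ : Set ℝ) : Prop := IsUniformlyDiscrete Λ ∧ IsRelativelyDense Λ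

/-- `Λ` is harmonious: every algebraic character of the group generated by `Λ` is approximated
uniformly on `Λ` by continuous characters. -/
def IsHarmonious (Λ : Set ℝ) : Prop :=
  ∀ χ : AddChar (AddSubgroup.closure Λ) Circle, ∀ ε : ℝ, 0 < ε → ∃ β : ℝ,
    ∀ (x : ℝ) (hx : x ∈ Λ),
      ‖(χ ⟨x, AddSubgroup.subset_closure hx⟩ : ℂ) - Complex.exp (2 * Real.pi * Complex.I * β * x)‖ < ε

/-- A Meyer set is a relatively dense harmonious set. -/
def IsMeyerSet (Λ : Set ℝ) : Prop := IsRelativelyDense Λ ∧ IsHarmonious Λ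

/-- `γ` is the autocorrelation of the (locally finite) set `Λ`: the vague limit, as `R → ∞`, of
`(2 R)⁻¹ ∑ δ_{x - y}`, the sum over all `x, y ∈ Λ ∩ [-R, R]`. -/
def IsAutocorrelation (Λ : Set ℝ) (γ : Measure ℝ) : Prop :=
  IsLocallyFiniteMeasure γ ∧
  ∀ f : ℝ → ℂ, Continuous f → HasCompactSupport f →
    Tendsto (fun R : ℝ => (2 * R : ℂ)⁻¹ *
        ∑ᶠ x ∈ Λ ∩ Icc (-R) R, ∑ᶠ y ∈ Λ ∩ Icc (-R) R, f (x - y))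
      atTop (𝓝 (∫ x, f x ∂γ))

/-- The measure `ν` is the Fourier transform of the measure `γ`, in the sense of tempered
distributions. -/
def IsFourierTransform (γ ν : Measure ℝ) : Prop :=
  ∀ g : 𝓢(ℝ, ℂ), Integrable (fun x => (𝓕 g) x) γ ∧ Integrable (fun k => g k) ν ∧
    ∫ x, (𝓕 g) x ∂γ = ∫ k, g k ∂ν

/-- The measure `ν` is pure point: it is carried by a countable set. -/
def IsPurePoint (ν : Measure ℝ) : Prop := ∃ P : Set ℝ, P.Countable ∧ ν Pᶜ = 0

/-- `Λ` has an autocorrelation measure, whose Fourier transform is a pure point measure. -/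
def IsPurePointDiffractiveSet (Λ : Set ℝ) : Prop :=
  ∃ γ ν : Measure ℝ, IsAutocorrelation Λ γ ∧ IsFourierTransform γ ν ∧ IsPurePoint ν

namespace Pattern

variable {A : Type}

/-- A Meyer tiling is one that is MLD to a Meyer set. -/
def IsMeyer (T : Pattern A) : Prop := ∃ Λ : Set ℝ, IsMeyerSet Λ ∧ T.IsMLD (ofSet Λ)

/-- A tiling is pure point diffractive if all the Delone sets that encode it are, that is, all the
Delone sets that are MLD to it. -/
def IsPurePointDiffractive (T : Pattern A) : Prop :=
  ∀ Λ : Set ℝ, IsDelone Λ → T.IsMLD (ofSet Λ) → IsPurePointDiffractiveSet Λ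

end Pattern

/-! ### Eigenvalues of flows -/

section Flow

variable {Ω : Type} (Φ : ℝ → Ω → Ω)

/-- `f (Φ_t ω) = e^{2π i β t} f ω` for all `t`, `ω`, for some continuous `f ≠ 0`. -/
def IsTopologicalEigenvalue [TopologicalSpace Ω] (β : ℝ) : Prop :=
  ∃ f : Ω → ℂ, Continuous f ∧ f ≠ 0 ∧
    ∀ (t : ℝ) (ω : Ω), f (Φ t ω) = Complex.exp (2 * Real.pi * Complex.I * β * t) * f ω

variable [MeasurableSpace Ω] (μ : Measure Ω)

/-- For each `t`, `f (Φ_t ω) = e^{2π i β t} f ω` for almost all `ω`. -/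
def EigenEquation (β : ℝ) (f : Ω → ℂ) : Prop :=
  ∀ t : ℝ, ∀ᵐ ω ∂μ, f (Φ t ω) = Complex.exp (2 * Real.pi * Complex.I * β * t) * f ω

def IsEigenvalue (β : ℝ) : Prop :=
  ∃ f : Ω → ℂ, MemLp f 2 μ ∧ ¬ f =ᵐ[μ] 0 ∧ EigenEquation Φ μ β f

/-- The eigenfunctions span a dense subspace of `L²`. -/
def HasPurePointSpectrum : Prop :=
  (Submodule.span ℂ {f : Lp ℂ 2 μ | ∃ β : ℝ, EigenEquation Φ μ β f}).topologicalClosure = ⊤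

def IsInvariantProbability : Prop :=
  IsProbabilityMeasure μ ∧ ∀ t : ℝ, MeasurePreserving (Φ t) μ μ

end Flow

/-! ### Scrambled Fibonacci sequences -/

inductive Letter : Type
  | a | b | e

open Letter

/-- The Fibonacci substitution `a ↦ ab`, `b ↦ a`; it is applied only to words without `e`. -/
def fibSub : Letter → List Letter
  | a => [a, b]
  | b => [a]
  | e => [e]

/-- The word `σ^k(x)`. -/
def fibPow : ℕ → Letter → List Letter
  | 0, x => [x]
  | k + 1, x => (fibPow k x).flatMap fibSub

/-- Replace the first `b` of a word (if there is one) by `e`. -/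
def markFirst : List Letter → List Letter
  | [] => []
  | a :: w => a :: markFirst w
  | b :: w => e :: w
  | e :: w => e :: markFirst w

/-- Replace the last `b` of a word (if there is one) by `e`. -/
def markLast (w : List Letter) : List Letter := (markFirst w.reverse).reverse

/-- The word `σ^k(b)`, `k ≥ 1`, with all letters `a` moved in front of the letters `b`. -/
def sortedWord (k : ℕ) : List Letter :=
  List.replicate (Nat.fib k) a ++ List.replicate (Nat.fib (k - 1)) b

/-- `Δ(n) = N(n) - N(n - 1)`, for `n ≥ 1`. -/
def gap (N : ℕ → ℕ) (n : ℕ) : ℕ := N n - N (n - 1)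

/-- The `n`-th substitution of the scrambled Fibonacci fusion rule, `n ≥ 1`. -/
def rule (N : ℕ → ℕ) (n : ℕ) : Letter → List Letter
  | e => sortedWord (gap N n)
  | x => if Odd n then fibPow (gap N n) x else markLast (fibPow (gap N n) x)

/-- The superletters `S_n(x)`: `S_0 = id` and `S_n = S_{n-1} ∘ rule_n`. -/
def superletter (N : ℕ → ℕ) : ℕ → Letter → List Letter
  | 0, x => [x]
  | n + 1, x => (rule N (n + 1) x).flatMap (superletter N n)

/-- The space of scrambled Fibonacci sequences: all finite factors are subwords of superletters. -/
def sequenceSpace (N : ℕ → ℕ) : Set (ℤ → Letter) :=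
  {ξ | ∀ (i : ℤ) (k : ℕ), ∃ (n : ℕ) (x : Letter),
    (List.ofFn fun j : Fin k => ξ (i + (j : ℕ))) <:+: superletter N n x}

/-! ### Scrambled Fibonacci tilings -/

/-- Tiles of type `a` have length `L` and tiles of type `b` have length `S`. (The letter `e` does not
occur in scrambled Fibonacci sequences.) -/
def tileLength (L S : ℝ) : Letter → ℝ
  | a => L
  | b => S
  | e => S

/-- The left endpoint of the `n`-th tile, where tile number `0` starts at the origin. -/
def leftEndpoint (L S : ℝ) (ξ : ℤ → Letter) : ℤ → ℝ
  | Int.ofNat n => ∑ i ∈ Finset.range n, tileLength L S (ξ i)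
  | Int.negSucc n => -∑ i ∈ Finset.range (n + 1), tileLength L S (ξ (-(i : ℤ) - 1))

/-- The tiling made from the sequence `ξ`, with tile number `0` starting at the origin. -/
def suspension (L S : ℝ) (ξ : ℤ → Letter) : Pattern Letter :=
  ⟨Set.range fun n : ℤ => (leftEndpoint L S ξ n, ξ n)⟩

/-- The space of scrambled Fibonacci tilings with tile lengths `L` and `S`. -/
def tilingSpace (N : ℕ → ℕ) (L S : ℝ) : Set (Pattern Letter) :=
  {T | ∃ ξ ∈ sequenceSpace N, ∃ t : ℝ, T = (suspension L S ξ).translate t}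

theorem translate_mem_tilingSpace {N : ℕ → ℕ} {L S : ℝ} {T : Pattern Letter}
    (hT : T ∈ tilingSpace N L S) (t : ℝ) : T.translate t ∈ tilingSpace N L S := by
  obtain ⟨ξ, hξ, s, rfl⟩ := hT
  refine ⟨ξ, hξ, t + s, ?_⟩
  ext p
  simp only [Pattern.translate, mem_ofPred_eq, add_assoc]

/-- The translation action `T ↦ T - t` on the tiling space. -/
def flow (N : ℕ → ℕ) (L S : ℝ) (t : ℝ) (T : tilingSpace N L S) : tilingSpace N L S :=
  ⟨T.1.translate t, translate_mem_tilingSpace T.2 t⟩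

end ScrambledFibonacci

end

noncomputable section

namespace ScrambledFibonacci

open Letter

local notation "φ" => Real.goldenRatio
local notation "ψ" => Real.goldenConj

/-! Up to the order of letters (and reading `e` as `b`) the scrambled rule of level n is σ^Δ(n), so
lengths and letter counts of superletters are Fibonacci numbers (`perm_rule`,
`sum_map_superletter`). Everything measure-theoretic survives the scrambling because the rearranged
supertiles are rare; the topological eigenvalues that are lost are destroyed by the long periodic
runs inside the supertiles of type `e`.

Measurable side. A generic point of an interval of length 1 carries a nested sequence of Fibonacci
supertiles, computed by the renormalization `ren`, with φ-rotation as the passage to the next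
letter. Replacing these supertiles by scrambled ones changes the address only at marked levels. The
points in a marked supertile of level n have measure O(φ^(-Δ(n+1))), so Borel–Cantelli (`ae_good`)
shows that for almost every x the scrambled letter stabilizes. This gives an equivariant map `seq`
from the circle to the sequence space (`seq_mem`). At least half of the letters of each image word
are `a`, which makes pattern densities contract geometrically; hence uniform frequencies
(`exists_frequency`) and unique ergodicity (`invariantProbability_unique`).

Pure point spectrum. The discrepancy of the part of a supertile before x converges to a function h
with h(x + φ) - h(x) determined by the letter at the origin and h(x) ≡ x mod 1 (`exists_transfer`).
Averaging e(s h) along orbits, with s = 1/(m+1) so small that its integral is non-zero, expresses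
e(h(x)) = e(x) measurably through the sequence (`exists_descent`). So all characters of the 2-torus
are functions of the tiling, the flow being translation by (t, tφ) in these coordinates
(`flow_param`); the eigenvalues are ℤ + ℤφ (`isEigenvalue_iff`).

Topological eigenvalues. For n even, S_(n+1)(e) contains runs of S_n(a) and S_n(b) of lengths F_Δ
and F_(Δ-1), with Δ = Δ(n+1) ≥ N(n). For a continuous eigenfunction, β times every return time of a
suitable word is near an integer, so all multiples of F_(N(n)+2) β and F_(N(n)+1) β along the runs
are. Then F_(N(n)+2) β and F_(N(n)+1) β are within O(δ / F_N(n)) of integers, and a Cassini identity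
makes β itself O(δ)-close to an integer (`IsTopologicalEigenvalue.exists_int`).

Individual tilings. Repetitivity comes from the occurrence of every factor in some S_m(a). With unit
tiles, a code of the tiling lies in a coset of (1/5)ℤ, which is harmonious by Kronecker's theorem
(`isHarmonious_of_subset`). A Delone set MLD with a tiling is a finite union of integer combs with
local weights; its autocorrelation coefficients are integrals over the circle by uniform
frequencies, Parseval expands them in e(mnφ), and Poisson summation turns the autocorrelation into a
sum of point masses on ℤ + ℤφ (`isFourierTransform`). -/

instance : DecidableEq Letter := fun x y => by
  cases x <;> cases y <;> first | exact isTrue rfl | exact isFalse (by simp)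

instance : Fintype Letter := ⟨{a, b, e}, fun x => by cases x <;> simp⟩

/-! ### Words -/

/-- Replace `e` by `b`. -/
def forget : Letter → Letter
  | a => a
  | b => b
  | e => b

/-- The number of `b`'s (and `e`'s) in a letter minus its expected value. -/
def dval : Letter → ℝ
  | a => φ - 2
  | b => φ - 1
  | e => φ - 1

/-- The discrepancy of a word. -/
def disc (w : List Letter) : ℝ := (w.map dval).sum

@[simp] theorem disc_nil : disc [] = 0 := rfl

@[simp] theorem disc_append (u v : List Letter) : disc (u ++ v) = disc u + disc v := by
  simp [disc]

@[simp] theorem disc_cons (x : Letter) (v : List Letter) : disc (x :: v) = dval x + disc v := by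
  simp [disc]

theorem dval_forget (x : Letter) : dval (forget x) = dval x := by cases x <;> rfl

theorem psi_eq : ψ = 1 - φ := by linarith [Real.goldenRatio_add_goldenConj]

theorem phi_sq : φ * φ = φ + 1 := by rw [← sq]; exact Real.goldenRatio_sq

theorem phi_lower : (1.6 : ℝ) < φ := by
  have := phi_sq
  nlinarith [Real.one_lt_goldenRatio]

theorem phi_upper : φ < (1.625 : ℝ) := by
  have := phi_sq
  nlinarith [Real.one_lt_goldenRatio]

theorem abs_psi : |ψ| = φ⁻¹ := by
  rw [Real.inv_goldenRatio, abs_of_neg Real.goldenConj_neg]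

/-- The discrepancy of a word is congruent modulo `1` to `φ` times its length. -/
theorem disc_eq_int (w : List Letter) : ∃ n : ℤ, disc w = φ * w.length + n := by
  induction w with
  | nil => exact ⟨0, by simp⟩
  | cons x w ih =>
    obtain ⟨n, hn⟩ := ih
    cases x
    · exact ⟨n - 2, by simp [hn, dval]; ring⟩
    · exact ⟨n - 1, by simp [hn, dval]; ring⟩
    · exact ⟨n - 1, by simp [hn, dval]; ring⟩

/-- Powers of σ commute; peeling off the innermost application gives the concatenation recursion
σ^(k+1)(a) = σ^k(a) σ^k(b). -/
theorem fibPow_succ' (k : ℕ) (x : Letter) :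
    fibPow (k + 1) x = (fibSub x).flatMap (fibPow k) := by
  induction k generalizing x with
  | zero => cases x <;> rfl
  | succ k ih =>
    rw [fibPow, ih, List.flatMap_assoc]
    rfl

theorem fibPow_succ_a (k : ℕ) : fibPow (k + 1) a = fibPow k a ++ fibPow k b := by
  simp [fibPow_succ', fibSub]

theorem fibPow_succ_b (k : ℕ) : fibPow (k + 1) b = fibPow k a := by
  simp [fibPow_succ', fibSub]

theorem fibPow_add (k m : ℕ) (x : Letter) :
    fibPow (k + m) x = (fibPow m x).flatMap (fibPow k) := by
  induction k with
  | zero => simp [fibPow]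
  | succ k ih =>
    rw [Nat.add_right_comm k 1 m, fibPow, ih, List.flatMap_assoc]
    rfl

theorem count_fibPow_a (k : ℕ) :
    (fibPow k a).count a = Nat.fib (k + 1) ∧ (fibPow k a).count b = Nat.fib k := by
  induction k using Nat.twoStepInduction with
  | zero => simp [fibPow]
  | one => simp [fibPow, fibSub]
  | more k h0 h1 =>
    constructor
    · rw [fibPow_succ_a, List.count_append, fibPow_succ_b, h0.1, h1.1,
        Nat.fib_add_two (n := k + 1), add_comm]
    · rw [fibPow_succ_a, List.count_append, fibPow_succ_b, h0.2, h1.2,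
        Nat.fib_add_two (n := k), add_comm]

theorem forget_fibPow (k : ℕ) {x : Letter} (hx : x ≠ e) :
    ∀ y ∈ fibPow k x, y ≠ e := by
  induction k with
  | zero => simpa [fibPow] using hx
  | succ k ih =>
    intro y hy
    simp only [fibPow, List.mem_flatMap] at hy
    obtain ⟨z, hz, hy⟩ := hy
    have := ih z hz
    cases z <;> simp_all [fibSub]
    · rcases hy with rfl | rfl <;> simp

theorem forget_ne (x : Letter) : forget x ≠ e := by cases x <;> simp [forget]

theorem forget_of_ne {x : Letter} (hx : x ≠ e) : forget x = x := by cases x <;> simp_all [forget]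

theorem map_forget_fibPow (k : ℕ) {x : Letter} (hx : x ≠ e) :
    (fibPow k x).map forget = fibPow k x := by
  conv_rhs => rw [← List.map_id (fibPow k x)]
  exact List.map_congr_left fun y hy => forget_of_ne (forget_fibPow k hx y hy)

theorem length_eq_count {w : List Letter} (hw : ∀ y ∈ w, y ≠ e) :
    w.length = w.count a + w.count b := by
  induction w with
  | nil => rfl
  | cons x w ih =>
    have h1 := hw x (by simp)
    have h2 := ih fun y hy => hw y (by simp [hy])
    cases x <;> simp_all <;> omega

theorem length_fibPow_a (k : ℕ) : (fibPow k a).length = Nat.fib (k + 2) := by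
  rw [length_eq_count (forget_fibPow k (by simp)), (count_fibPow_a k).1, (count_fibPow_a k).2,
    Nat.fib_add_two (n := k), add_comm]

theorem length_fibPow_b (k : ℕ) : (fibPow k b).length = Nat.fib (k + 1) := by
  cases k with
  | zero => rfl
  | succ k => rw [fibPow_succ_b, length_fibPow_a]

/-- Both words have the same letter counts. This is why a supertile of type `e` can stand for one of
type `b` without affecting lengths or discrepancies. -/
theorem perm_sortedWord {k : ℕ} (hk : 1 ≤ k) : (fibPow k b).Perm (sortedWord k) := by
  obtain ⟨k, rfl⟩ := Nat.exists_eq_add_of_le' hk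
  rw [List.perm_iff_count]
  intro x
  rw [fibPow_succ_b]
  cases x
  · simp [sortedWord, (count_fibPow_a k).1, List.count_replicate]
  · simp [sortedWord, (count_fibPow_a k).2, List.count_replicate]
  · rw [List.count_eq_zero.2 fun h => forget_fibPow k (by simp) _ h rfl]
    simp [sortedWord, List.count_replicate]

/-! ### Marking the last `b` -/

theorem markFirst_append_of_mem {u : List Letter} (v : List Letter) (h : b ∈ u) :
    markFirst (u ++ v) = markFirst u ++ v := by
  induction u with
  | nil => simp at h
  | cons x u ih => cases x <;> simp_all [markFirst]

theorem markFirst_append_of_notMem {u : List Letter} (v : List Letter) (h : b ∉ u) :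
    markFirst (u ++ v) = u ++ markFirst v := by
  induction u with
  | nil => rfl
  | cons x u ih => cases x <;> simp_all [markFirst]

theorem markLast_append_of_mem (u : List Letter) {v : List Letter} (h : b ∈ v) :
    markLast (u ++ v) = u ++ markLast v := by
  simp [markLast, markFirst_append_of_mem _ (List.mem_reverse.2 h)]

theorem markLast_append_of_notMem (u : List Letter) {v : List Letter} (h : b ∉ v) :
    markLast (u ++ v) = markLast u ++ v := by
  simp [markLast, markFirst_append_of_notMem _ (mt List.mem_reverse.1 h)]

theorem map_forget_markFirst (w : List Letter) : (markFirst w).map forget = w.map forget := by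
  induction w with
  | nil => rfl
  | cons x u ih => cases x <;> simp [markFirst, ih, forget]

theorem map_forget_markLast (w : List Letter) : (markLast w).map forget = w.map forget := by
  rw [markLast, List.map_reverse, map_forget_markFirst, ← List.map_reverse, List.reverse_reverse]

theorem e_mem_markFirst {w : List Letter} (h : b ∈ w) : e ∈ markFirst w := by
  induction w with
  | nil => simp at h
  | cons x u ih => cases x <;> simp_all [markFirst]

theorem e_mem_markLast {w : List Letter} (h : b ∈ w) : e ∈ markLast w :=
  List.mem_reverse.2 (e_mem_markFirst (List.mem_reverse.2 h))

/-- The decomposition of a word about a letter, after marking. -/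
theorem markLast_append_cons (u : List Letter) (c : Letter) (v : List Letter) :
    ∃ u' v', markLast (u ++ c :: v) = u' ++ (if c = b ∧ b ∉ v then e else c) :: v' ∧
      u'.map forget = u.map forget := by
  by_cases hv : b ∈ v
  · refine ⟨u, markLast v, ?_, rfl⟩
    rw [List.append_cons, markLast_append_of_mem _ hv]
    simp [hv]
  · rw [List.append_cons, markLast_append_of_notMem _ hv]
    by_cases hc : c = b
    · refine ⟨u, v, ?_, rfl⟩
      subst hc
      rw [markLast_append_of_mem _ (by simp)]
      simp [hv, markLast, markFirst]
    · refine ⟨markLast u, v, ?_, map_forget_markLast u⟩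
      rw [markLast_append_of_notMem _ (by simpa using Ne.symm hc)]
      simp [hc]

/-! ### The fusion rule -/

section Fusion

variable {N : ℕ → ℕ}

theorem one_le_gap (hN : StrictMono N) {n : ℕ} (hn : 1 ≤ n) : 1 ≤ gap N n := by
  have := hN (show n - 1 < n by omega)
  simp only [gap]; omega

theorem add_gap (hN : StrictMono N) (n : ℕ) : N n + gap N (n + 1) = N (n + 1) := by
  have := hN (show n < n + 1 by omega)
  simp only [gap, Nat.add_sub_cancel]; omega

/-- Marking only renames one `b`, and sorting only permutes: abelianized, the scrambled rule is the
Fibonacci substitution. -/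
theorem perm_rule (hN : StrictMono N) {n : ℕ} (hn : 1 ≤ n) (x : Letter) :
    ((rule N n x).map forget).Perm (fibPow (gap N n) (forget x)) := by
  have key : ∀ y : Letter, y ≠ e →
      (((if Odd n then fibPow (gap N n) y else markLast (fibPow (gap N n) y)).map forget).Perm
        (fibPow (gap N n) y)) := by
    intro y hy
    split_ifs
    · rw [map_forget_fibPow _ hy]
    · rw [map_forget_markLast, map_forget_fibPow _ hy]
  cases x
  · exact key a (by simp)
  · exact key b (by simp)
  · have h := perm_sortedWord (one_le_gap hN hn)
    have h2 := (h.map forget).symm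
    rw [map_forget_fibPow _ (by simp)] at h2
    exact h2

theorem sum_map_flatMap {M : Type*} [AddCommMonoid M] (F : Letter → M) (f : Letter → List Letter)
    (w : List Letter) :
    ((w.flatMap f).map F).sum = (w.map fun y => ((f y).map F).sum).sum := by
  induction w with
  | nil => rfl
  | cons x w ih => simp [ih]

/-- Additive statistics that do not separate `e` from `b` see only the abelianization, so
`perm_rule` can be iterated. Used with F = 1 for lengths and F = `dval` for discrepancies. -/
theorem sum_map_superletter (hN₀ : N 0 = 0) (hN : StrictMono N) {M : Type*} [AddCommMonoid M]
    (F : Letter → M) (hF : F e = F b) (n : ℕ) (x : Letter) :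
    ((superletter N n x).map F).sum = ((fibPow (N n) (forget x)).map F).sum := by
  induction n generalizing x with
  | zero => cases x <;> simp [superletter, hN₀, fibPow, forget, hF]
  | succ n ih =>
    rw [superletter, sum_map_flatMap]
    simp only [ih]
    have h1 := (perm_rule hN (Nat.succ_pos n) x).map
      (fun y => ((fibPow (N n) y).map F).sum)
    rw [List.map_map] at h1
    have h2 := h1.sum_eq
    rw [← add_gap hN, fibPow_add, sum_map_flatMap, ← h2]
    rfl

theorem length_superletter (hN₀ : N 0 = 0) (hN : StrictMono N) (n : ℕ) (x : Letter) :
    (superletter N n x).length = (fibPow (N n) (forget x)).length := by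
  simpa using sum_map_superletter hN₀ hN (fun _ => (1 : ℕ)) rfl n x

theorem length_superletter_a (hN₀ : N 0 = 0) (hN : StrictMono N) (n : ℕ) :
    (superletter N n a).length = Nat.fib (N n + 2) := by
  rw [length_superletter hN₀ hN, forget, length_fibPow_a]

theorem length_superletter_b (hN₀ : N 0 = 0) (hN : StrictMono N) (n : ℕ) :
    (superletter N n b).length = Nat.fib (N n + 1) := by
  rw [length_superletter hN₀ hN, forget, length_fibPow_b]

theorem length_superletter_le (hN₀ : N 0 = 0) (hN : StrictMono N) (n : ℕ) (x : Letter) :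
    (superletter N n x).length ≤ Nat.fib (N n + 2) := by
  rw [length_superletter hN₀ hN]
  cases x <;> simp only [forget, length_fibPow_a, length_fibPow_b, le_refl]
  all_goals exact Nat.fib_mono (by omega)

theorem le_length_superletter (hN₀ : N 0 = 0) (hN : StrictMono N) (n : ℕ) (x : Letter) :
    Nat.fib (N n + 1) ≤ (superletter N n x).length := by
  rw [length_superletter hN₀ hN]
  cases x <;> simp only [forget, length_fibPow_a, length_fibPow_b, le_refl]
  all_goals
    exact Nat.fib_mono (by omega)

/-- The vector `dval` is the left eigenvector of the Fibonacci matrix for the contracting eigenvalue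
ψ. -/
theorem disc_flatMap_fibSub (w : List Letter) (hw : ∀ y ∈ w, y ≠ e) :
    disc (w.flatMap fibSub) = ψ * disc w := by
  induction w with
  | nil => simp
  | cons x w ih =>
    have h1 := hw x (by simp)
    have h2 := ih fun y hy => hw y (by simp [hy])
    have := phi_sq
    cases x
    · simp [fibSub, h2, dval, psi_eq]; linarith
    · simp [fibSub, h2, dval, psi_eq]; linarith
    · simp at h1

theorem disc_fibPow (k : ℕ) {x : Letter} (hx : x ≠ e) :
    disc (fibPow k x) = ψ ^ k * dval x := by
  induction k with
  | zero => simp [fibPow]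
  | succ k ih => rw [fibPow, disc_flatMap_fibSub _ (forget_fibPow k hx), ih]; ring

theorem disc_superletter (hN₀ : N 0 = 0) (hN : StrictMono N) (n : ℕ) (x : Letter) :
    disc (superletter N n x) = ψ ^ N n * dval x := by
  rw [disc, sum_map_superletter hN₀ hN dval rfl, ← dval_forget x]
  exact disc_fibPow _ (forget_ne x)

theorem disc_flatMap_superletter (hN₀ : N 0 = 0) (hN : StrictMono N) (n : ℕ) (w : List Letter) :
    disc (w.flatMap (superletter N n)) = ψ ^ N n * disc w := by
  induction w with
  | nil => simp
  | cons x w ih =>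
    rw [List.flatMap_cons, disc_append, ih, disc_superletter hN₀ hN, disc_cons, mul_add]

/-- At least half of the letters in the image of a letter are `a`. -/
theorem length_rule_le (hN : StrictMono N) {n : ℕ} (hn : 1 ≤ n) (x : Letter) :
    (rule N n x).length ≤ 2 * (rule N n x).count a := by
  have h := perm_rule hN hn x
  have h1 : (rule N n x).length = (fibPow (gap N n) (forget x)).length := by
    simpa using h.length_eq
  have h2 : (rule N n x).count a = (fibPow (gap N n) (forget x)).count a := by
    rw [← h.count_eq a]
    generalize rule N n x = w
    induction w with
    | nil => rfl
    | cons y w ih => cases y <;> simp [forget, ih]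
  rw [h1, h2]
  obtain ⟨k, hk⟩ := Nat.exists_eq_add_of_le' (one_le_gap hN hn)
  rw [hk]
  cases x
  · rw [forget, length_fibPow_a, (count_fibPow_a _).1, Nat.fib_add_two (n := k + 1)]
    have : Nat.fib (k + 1) ≤ Nat.fib (k + 1 + 1) := Nat.fib_mono (by omega)
    omega
  all_goals
    rw [forget, fibPow_succ_b, length_fibPow_a, (count_fibPow_a _).1, Nat.fib_add_two (n := k)]
    have : Nat.fib k ≤ Nat.fib (k + 1) := Nat.fib_mono (by omega)
    omega

theorem length_rule_pos (hN : StrictMono N) {n : ℕ} (hn : 1 ≤ n) (x : Letter) :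
    0 < (rule N n x).length := by
  have h1 : (rule N n x).length = (fibPow (gap N n) (forget x)).length := by
    simpa using (perm_rule hN hn x).length_eq
  rw [h1]
  cases x <;> simp only [forget, length_fibPow_a, length_fibPow_b] <;>
    exact Nat.fib_pos.2 (by omega)

theorem a_mem_rule (hN : StrictMono N) {n : ℕ} (hn : 1 ≤ n) (x : Letter) : a ∈ rule N n x := by
  have h1 := length_rule_le hN hn x
  have h2 := length_rule_pos hN hn x
  exact List.count_pos_iff.1 (by omega)

theorem superletter_infix_of_mem {n : ℕ} {x y : Letter} (h : x ∈ rule N (n + 1) y) :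
    superletter N n x <:+: superletter N (n + 1) y := by
  obtain ⟨u, v, huv⟩ := List.append_of_mem h
  refine ⟨u.flatMap (superletter N n), v.flatMap (superletter N n), ?_⟩
  simp [superletter, huv]

theorem superletter_a_infix (hN : StrictMono N) {n m : ℕ} (h : n ≤ m) :
    superletter N n a <:+: superletter N m a := by
  induction m, h using Nat.le_induction with
  | base => exact List.infix_rfl
  | succ m _ ih => exact ih.trans (superletter_infix_of_mem (a_mem_rule hN (Nat.succ_pos m) a))

theorem superletter_eq_flatMap {n m : ℕ} (h : n ≤ m) (x : Letter) :
    ∃ W : List Letter, superletter N m x = W.flatMap (superletter N n) := by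
  induction m, h using Nat.le_induction generalizing x with
  | base => exact ⟨[x], by simp⟩
  | succ m _ ih =>
    choose W hW using ih
    refine ⟨(rule N (m + 1) x).flatMap W, ?_⟩
    rw [superletter, List.flatMap_assoc]
    congr 1
    funext y
    exact hW y

end Fusion

/-! ### Factors of sequences -/

/-- The factor of length `k` at position `i`. -/
def word (ξ : ℤ → Letter) (i : ℤ) (k : ℕ) : List Letter := List.ofFn fun j : Fin k => ξ (i + (j : ℕ))

@[simp] theorem length_word (ξ : ℤ → Letter) (i : ℤ) (k : ℕ) : (word ξ i k).length = k := by
  simp [word]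

theorem getElem_word (ξ : ℤ → Letter) (i : ℤ) (k j : ℕ) (h : j < (word ξ i k).length) :
    (word ξ i k)[j] = ξ (i + j) := by
  simp [word]

theorem word_add (ξ : ℤ → Letter) (i : ℤ) (k l : ℕ) :
    word ξ i (k + l) = word ξ i k ++ word ξ (i + k) l := by
  apply List.ext_getElem (by simp)
  intro j h1 h2
  rw [List.getElem_append]
  split_ifs with h
  · simp [getElem_word]
  · simp only [length_word, not_lt] at h
    simp only [getElem_word, length_word]
    congr 1
    push_cast [h]
    ring

theorem exists_word_of_infix {ξ : ℤ → Letter} {i : ℤ} {L : ℕ} {w : List Letter}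
    (h : w <:+: word ξ i L) : ∃ j : ℕ, j + w.length ≤ L ∧ w = word ξ (i + j) w.length := by
  obtain ⟨s, t, h⟩ := h
  have hl : s.length + w.length + t.length = L := by
    simpa [add_assoc] using congrArg List.length h
  refine ⟨s.length, by omega, ?_⟩
  rw [← hl, word_add, word_add] at h
  have h1 := (List.append_inj h (by simp)).1
  exact (List.append_inj h1 (by simp)).2

theorem infix_append_cases {α : Type*} {u x y : List α} (h : u <:+: x ++ y) :
    u <:+: x ∨ u <:+: y ∨ ∃ u₁ u₂, u = u₁ ++ u₂ ∧ u₁ <:+ x ∧ u₂ <+: y := by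
  obtain ⟨s, t, h⟩ := h
  rw [List.append_assoc, List.append_eq_append_iff] at h
  rcases h with ⟨z, hx, hz⟩ | ⟨z, hs, hz⟩
  · rw [List.append_eq_append_iff] at hz
    rcases hz with ⟨q, h1, h2⟩ | ⟨q, h1, h2⟩
    · left; exact ⟨s, q, by rw [hx, h1, List.append_assoc]⟩
    · right; right; exact ⟨z, q, h1, ⟨s, hx.symm⟩, ⟨t, h2.symm⟩⟩
  · right; left; exact ⟨z, t, by rw [hz, List.append_assoc]⟩

theorem prefix_flatMap {α β : Type*} {f : α → List β} {L : ℕ} (hL : ∀ x, (f x).length ≤ L)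
    {u : List β} {W : List α} (h : u <+: W.flatMap f) :
    ∃ W' p, u = W'.flatMap f ++ p ∧ W' <+: W ∧ p.length ≤ L := by
  induction W generalizing u with
  | nil => exact ⟨[], [], by simpa using h, List.nil_prefix, by simp⟩
  | cons y W ih =>
    obtain ⟨t, h⟩ := h
    rw [List.flatMap_cons, List.append_eq_append_iff] at h
    rcases h with ⟨v, h, -⟩ | ⟨v, rfl, hv⟩
    · exact ⟨[], u, by simp, List.nil_prefix,
        (show u <+: f y from ⟨v, h.symm⟩).length_le.trans (hL y)⟩
    · obtain ⟨W', p, rfl, hW, hp⟩ := ih ⟨t, hv.symm⟩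
      exact ⟨y :: W', p, by simp, by simpa using hW, hp⟩

theorem infix_flatMap {α β : Type*} {f : α → List β} {L : ℕ} (hL : ∀ x, (f x).length ≤ L)
    {u : List β} {W : List α} (h : u <:+: W.flatMap f) :
    ∃ s W' p, u = s ++ W'.flatMap f ++ p ∧ W' <:+: W ∧ s.length ≤ L ∧ p.length ≤ L := by
  induction W with
  | nil => exact ⟨[], [], [], by simpa using h, List.infix_rfl, by simp, by simp⟩
  | cons y W ih =>
    rw [List.flatMap_cons] at h
    rcases infix_append_cases h with h | h | ⟨u₁, u₂, rfl, h1, h2⟩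
    · exact ⟨u, [], [], by simp, List.nil_infix, h.length_le.trans (hL y), by simp⟩
    · obtain ⟨s, W', p, h1, h2, h3⟩ := ih h
      exact ⟨s, W', p, h1, h2.trans (List.suffix_cons y W).isInfix, h3⟩
    · obtain ⟨W', p, rfl, hW, hp⟩ := prefix_flatMap hL h2
      exact ⟨u₁, W', p, by simp, hW.isInfix.trans (List.suffix_cons y W).isInfix,
        h1.length_le.trans (hL y), hp⟩

/-- A word not longer than any block cannot cover a block and also meet both of its neighbours. -/
theorem short_infix_flatMap {α β : Type*} {f : α → List β} {u : List β}
    (hu : ∀ x, u.length ≤ (f x).length) {W : List α} (hW : W ≠ []) (h : u <:+: W.flatMap f) :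
    (∃ y ∈ W, u <:+: f y) ∨ ∃ y z, [y, z] <:+: W ∧ u <:+: f y ++ f z := by
  induction W with
  | nil => exact absurd rfl hW
  | cons y W ih =>
    rw [List.flatMap_cons] at h
    rcases W with _ | ⟨z, W⟩
    · exact Or.inl ⟨y, by simp, by simpa using h⟩
    rcases infix_append_cases h with h | h | ⟨u₁, u₂, rfl, h1, h2⟩
    · exact Or.inl ⟨y, by simp, h⟩
    · rcases ih (by simp) h with ⟨x, hx, hx'⟩ | ⟨x, x', hx, hx'⟩
      · exact Or.inl ⟨x, by simp at hx ⊢; tauto, hx'⟩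
      · exact Or.inr ⟨x, x', hx.trans (List.suffix_cons y _).isInfix, hx'⟩
    · refine Or.inr ⟨y, z, ⟨[], W, by simp⟩, ?_⟩
      have h3 : u₂ <+: f z := by
        rw [List.flatMap_cons] at h2
        refine List.prefix_of_prefix_length_le h2 (List.prefix_append _ _) ?_
        have := hu z
        simp at this
        omega
      obtain ⟨s, hs⟩ := h1
      obtain ⟨t, ht⟩ := h3
      exact ⟨s, t, by simp [← hs, ← ht]⟩

section Language

variable {N : ℕ → ℕ}

/-- Factors of sequences occur in superletters of arbitrarily high level. -/
theorem word_infix_superletter (hN₀ : N 0 = 0) (hN : StrictMono N) {ξ : ℤ → Letter}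
    (hξ : ξ ∈ sequenceSpace N) (n : ℕ) (i : ℤ) (k : ℕ) :
    ∃ m ≥ n, ∃ x, word ξ i k <:+: superletter N m x := by
  -- Asking for a factor longer than all superletters of level at most n forces the level of the
  -- ambient superletter up.
  obtain ⟨m, x, h⟩ := hξ i (k + (Nat.fib (N n + 2) + 1))
  change word ξ i _ <:+: _ at h
  refine ⟨m, ?_, x, ?_⟩
  · by_contra hm
    have h1 := h.length_le.trans (length_superletter_le hN₀ hN m x)
    have h2 : Nat.fib (N m + 2) ≤ Nat.fib (N n + 2) :=
      Nat.fib_mono (by have := hN.monotone (le_of_not_ge hm); omega)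
    rw [length_word] at h1
    omega
  · refine List.IsInfix.trans ?_ h
    rw [word_add]
    exact List.infix_append_left

/-- A factor of a sequence is a concatenation of superletters of level `n`, up to short words at
both ends. -/
theorem word_eq_flatMap (hN₀ : N 0 = 0) (hN : StrictMono N) {ξ : ℤ → Letter}
    (hξ : ξ ∈ sequenceSpace N) (n : ℕ) (i : ℤ) (k : ℕ) :
    ∃ (s W p : List Letter), word ξ i k = s ++ W.flatMap (superletter N n) ++ p ∧
      s.length ≤ Nat.fib (N n + 2) ∧ p.length ≤ Nat.fib (N n + 2) := by
  obtain ⟨m, hm, x, h⟩ := word_infix_superletter hN₀ hN hξ n i k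
  obtain ⟨W, hW⟩ := superletter_eq_flatMap hm x
  rw [hW] at h
  obtain ⟨s, W', p, h1, -, h2, h3⟩ := infix_flatMap (length_superletter_le hN₀ hN n) h
  exact ⟨s, W', p, h1, h2, h3⟩

/-- `S_n(a)` occurs in all long factors. -/
theorem superletter_a_infix_word (hN₀ : N 0 = 0) (hN : StrictMono N) {ξ : ℤ → Letter}
    (hξ : ξ ∈ sequenceSpace N) (n : ℕ) (i : ℤ) :
    superletter N n a <:+: word ξ i (2 * Nat.fib (N (n + 1) + 2) + 1) := by
  obtain ⟨s, W, p, h, hs, hp⟩ :=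
    word_eq_flatMap hN₀ hN hξ (n + 1) i (2 * Nat.fib (N (n + 1) + 2) + 1)
  rcases W with _ | ⟨y, W⟩
  · have := congrArg List.length h
    simp at this
    omega
  · rw [h]
    refine (superletter_infix_of_mem (a_mem_rule hN (Nat.succ_pos n) y)).trans ?_
    exact ⟨s, W.flatMap (superletter N (n + 1)) ++ p, by simp⟩

/-- The second `b` is the point: it shields the first one from being marked, so `abaa` survives in
the even rules. -/
theorem abaab_prefix {k : ℕ} (hk : 3 ≤ k) : [a, b, a, a, b] <+: fibPow k a := by
  induction k, hk using Nat.le_induction with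
  | base => exact ⟨[], rfl⟩
  | succ k _ ih => rw [fibPow_succ_a]; exact ih.trans (List.prefix_append _ _)

theorem abaa_prefix_rule {n : ℕ} (hn : Even n) (h : 3 ≤ gap N n) : [a, b, a, a] <+: rule N n a := by
  obtain ⟨t, ht⟩ := abaab_prefix h
  have h1 : rule N n a = markLast (fibPow (gap N n) a) := by
    simp [rule, Nat.not_odd_iff_even.2 hn]
  rw [h1, ← ht]
  by_cases hb : b ∈ t
  · rw [markLast_append_of_mem _ hb]
    exact ⟨b :: markLast t, rfl⟩
  · rw [markLast_append_of_notMem _ hb]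
    exact ⟨e :: t, rfl⟩

theorem b_mem_fibPow_a {k : ℕ} (hk : 1 ≤ k) : b ∈ fibPow k a := by
  have h := (count_fibPow_a k).2
  have : 0 < Nat.fib k := Nat.fib_pos.2 hk
  exact List.count_pos_iff.1 (by omega)

theorem e_mem_rule (hN : StrictMono N) {n : ℕ} (hn : Even n) (h1 : 1 ≤ n) : e ∈ rule N n a := by
  have h1 : rule N n a = markLast (fibPow (gap N n) a) := by
    simp [rule, Nat.not_odd_iff_even.2 hn]
  rw [h1]
  exact e_mem_markLast (b_mem_fibPow_a (one_le_gap hN ‹_›))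

/-- The pair `bb` occurs in sorted words but not in Fibonacci words. At odd levels nothing is
marked, so S_n(b) is a prefix of S_n(a) and S_n(b)S_n(b) hides inside S_n(b)S_n(a). -/
theorem superletter_bb_infix (hN : StrictMono N) {n : ℕ} (hn : Odd n) :
    superletter N n b ++ superletter N n b <:+: superletter N n b ++ superletter N n a := by
  obtain ⟨j, rfl⟩ : ∃ j, n = j + 1 := ⟨n - 1, by have := hn.pos; omega⟩
  obtain ⟨g, hg⟩ := Nat.exists_eq_add_of_le' (one_le_gap hN (Nat.succ_pos j))
  have hb : superletter N (j + 1) b = (fibPow g a).flatMap (superletter N j) := by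
    simp [superletter, rule, hn, hg, fibPow_succ_b]
  have ha : superletter N (j + 1) a =
      (fibPow g a).flatMap (superletter N j) ++ (fibPow g b).flatMap (superletter N j) := by
    simp [superletter, rule, hn, hg, fibPow_succ_a]
  rw [hb, ha]
  exact ⟨[], (fibPow g b).flatMap (superletter N j), by simp⟩

/-- The pairs `aa`, `ab`, `ba` are read off from the prefix `abaa` of the rule; `bb` is reduced to
`ba`. -/
theorem superletter_pair_infix (hN : StrictMono N) {n : ℕ} (hn : Odd n)
    (h3 : 3 ≤ gap N (n + 1)) {y z : Letter} (hy : y ≠ e) (hz : z ≠ e) :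
    superletter N n y ++ superletter N n z <:+: superletter N (n + 1) a := by
  have key : ∀ y z, [y, z] <:+: [a, b, a, a] →
      superletter N n y ++ superletter N n z <:+: superletter N (n + 1) a := by
    intro y z h
    have := (h.trans (abaa_prefix_rule hn.add_one h3).isInfix).flatMap (superletter N n)
    simpa [superletter] using this
  cases y <;> cases z <;> simp at hy hz
  · exact key a a ⟨[a, b], [], rfl⟩
  · exact key a b ⟨[], [a, a], rfl⟩
  · exact key b a ⟨[a], [a], rfl⟩
  · exact (superletter_bb_infix hN hn).trans (key b a ⟨[a], [a], rfl⟩)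

/-- Every factor of a sequence occurs in some `S_m(a)`. -/
theorem word_infix_superletter_a (hN₀ : N 0 = 0) (hN : StrictMono N)
    {n₀ : ℕ} (h₀ : ∀ n ≥ n₀, Even n → 3 ≤ gap N n) {ξ : ℤ → Letter}
    (hξ : ξ ∈ sequenceSpace N) (i : ℤ) (k : ℕ) :
    ∃ m, word ξ i k <:+: superletter N m a := by
  obtain ⟨m, hm, x, h⟩ := word_infix_superletter hN₀ hN hξ (k + n₀ + 5 + 1) i k
  obtain ⟨j, rfl⟩ : ∃ j, m = j + 1 := ⟨m - 1, by omega⟩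
  rcases Nat.even_or_odd (j + 1) with hj | hj
  · have hj' : Odd j := by
      rcases Nat.even_or_odd j with h | h
      · exact absurd hj (Nat.not_even_iff_odd.2 h.add_one)
      · exact h
    cases x
    · exact ⟨_, h⟩
    · refine ⟨j + 1 + 1, h.trans (superletter_infix_of_mem ?_)⟩
      simpa [rule, hj.add_one] using b_mem_fibPow_a (one_le_gap hN (Nat.succ_pos (j + 1)))
    -- The following level is odd and its rule, applied to `a`, creates no `e`, so S_(j+1)(e) need
    -- not occur there. Instead the short factor is located in one or two consecutive constituents
    -- of level j, and such pairs occur in S_(j+1)(a).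
    · refine ⟨j + 1, ?_⟩
      have hk : ∀ x, (word ξ i k).length ≤ (superletter N j x).length := by
        intro x
        rw [length_word]
        have h1 : j ≤ N j := hN.id_le j
        have h2 : j ≤ Nat.fib j := Nat.le_fib_self (by omega)
        have h3 : Nat.fib j ≤ Nat.fib (N j + 1) := Nat.fib_mono (by omega)
        have := le_length_superletter hN₀ hN j x
        omega
      have he : ∀ y ∈ rule N (j + 1) e, y ≠ e := by
        intro y hy
        simp only [rule, sortedWord, List.mem_append, List.mem_replicate] at hy
        rcases hy with ⟨-, rfl⟩ | ⟨-, rfl⟩ <;> simp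
      have h3 : 3 ≤ gap N (j + 1) := h₀ _ (by omega) hj
      rcases short_infix_flatMap hk (List.length_pos_iff.1 (length_rule_pos hN (Nat.succ_pos j) e)) h
        with ⟨y, hy, h⟩ | ⟨y, z, hyz, h⟩
      · exact (h.trans List.infix_append_left).trans
          (superletter_pair_infix hN hj' h3 (he y hy) (he y hy))
      · exact h.trans (superletter_pair_infix hN hj' h3 (he y (hyz.subset (by simp)))
          (he z (hyz.subset (by simp))))
  · refine ⟨j + 1 + 1, h.trans ?_⟩
    cases x
    · exact superletter_a_infix hN (by omega)
    · exact superletter_infix_of_mem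
        ((abaa_prefix_rule hj.add_one (h₀ _ (by omega) hj.add_one)).subset (by simp))
    · exact superletter_infix_of_mem (e_mem_rule hN hj.add_one (by omega))

theorem finite_length_eq (k : ℕ) : {w : List Letter | w.length = k}.Finite :=
  List.finite_length_eq Letter k

/-- Every factor of length `k` occurs in every factor of a certain length. -/
theorem exists_recurrence (hN₀ : N 0 = 0) (hN : StrictMono N)
    {n₀ : ℕ} (h₀ : ∀ n ≥ n₀, Even n → 3 ≤ gap N n) (k : ℕ) :
    ∃ L : ℕ, ∀ ξ ∈ sequenceSpace N, ∀ i i' : ℤ, ∃ j : ℕ, j ≤ L ∧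
      word ξ (i' + j) k = word ξ i k := by
  -- A level for each word (0 if there is none); as there are finitely many words of length k, one
  -- level M serves all of them.
  have h1 : ∀ w : List Letter, ∃ m, (∃ m, w <:+: superletter N m a) → w <:+: superletter N m a := by
    intro w
    by_cases h : ∃ m, w <:+: superletter N m a
    · obtain ⟨m, hm⟩ := h
      exact ⟨m, fun _ => hm⟩
    · exact ⟨0, fun h' => absurd h' h⟩
  choose m hm using h1
  obtain ⟨M, hM⟩ := ((finite_length_eq k).image m).bddAbove
  refine ⟨2 * Nat.fib (N (M + 1) + 2) + 1, fun ξ hξ i i' => ?_⟩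
  have h2 : word ξ i k <:+: superletter N M a :=
    (hm _ (word_infix_superletter_a hN₀ hN h₀ hξ i k)).trans
      (superletter_a_infix hN (hM ⟨_, length_word ξ i k, rfl⟩))
  obtain ⟨j, hj, h⟩ := exists_word_of_infix (h2.trans (superletter_a_infix_word hN₀ hN hξ M i'))
  rw [length_word] at hj h
  exact ⟨j, by omega, h.symm⟩

/-- The terms of a convergent series tend to 0, so φ^(-Δ) ≥ φ^(-2) happens only finitely often. -/
theorem exists_three_le_gap (hsum : Summable fun κ : {κ : ℕ // Odd κ} =>
    (φ ^ gap N ((κ : ℕ) + 1))⁻¹) : ∃ n₀, ∀ n ≥ n₀, Even n → 3 ≤ gap N n := by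
  have h := hsum.tendsto_cofinite_zero.eventually_lt_const
    (show (0 : ℝ) < (φ ^ 2)⁻¹ by have := Real.goldenRatio_pos; positivity)
  rw [Filter.eventually_cofinite] at h
  obtain ⟨M, hM⟩ := (Set.Finite.image (fun κ : {κ : ℕ // Odd κ} => (κ : ℕ)) h).bddAbove
  refine ⟨M + 2, fun n hn he => ?_⟩
  have hodd : Odd (n - 1) := by
    obtain ⟨r, rfl⟩ := he
    exact ⟨r - 1, by omega⟩
  by_contra hg
  have : n - 1 ≤ M := by
    refine hM ⟨⟨n - 1, hodd⟩, ?_, rfl⟩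
    simp only [Set.mem_ofPred_eq, not_lt, Nat.sub_add_cancel (show 1 ≤ n by omega)]
    have h1 := Real.goldenRatio_pos
    exact inv_anti₀ (by positivity) (pow_le_pow_right₀ Real.one_lt_goldenRatio.le (by omega))
  omega

end Language

/-! ### Uniform frequencies -/

/-- `f ξ` depends only on the letters of `ξ` at distance at most `r` from the origin. -/
def IsLocal {β : Type*} (r : ℕ) (f : (ℤ → Letter) → β) : Prop :=
  ∀ ξ η : ℤ → Letter, (∀ j : ℤ, |j| ≤ r → ξ j = η j) → f ξ = f η

/-- The shift by `k` places. -/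
def shift (k : ℤ) (ξ : ℤ → Letter) : ℤ → Letter := fun j => ξ (j + k)

@[simp] theorem shift_apply (k : ℤ) (ξ : ℤ → Letter) (j : ℤ) : shift k ξ j = ξ (j + k) := rfl

theorem shift_shift (k l : ℤ) (ξ : ℤ → Letter) : shift k (shift l ξ) = shift (k + l) ξ := by
  funext j
  simp [add_assoc]

@[simp] theorem shift_zero (ξ : ℤ → Letter) : shift 0 ξ = ξ := by
  funext j
  simp

theorem shift_mem_sequenceSpace {N : ℕ → ℕ} {ξ : ℤ → Letter} (hξ : ξ ∈ sequenceSpace N) (k : ℤ) :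
    shift k ξ ∈ sequenceSpace N := by
  intro i l
  obtain ⟨n, x, h⟩ := hξ (i + k) l
  refine ⟨n, x, ?_⟩
  convert h using 4 with j
  simp only [shift]
  congr 1
  ring

/-- The sum of `f` along the orbit of `ξ` from time `p` to time `p + n`. -/
def orbitSum (f : (ℤ → Letter) → ℝ) (ξ : ℤ → Letter) (p : ℤ) (n : ℕ) : ℝ :=
  ∑ i ∈ Finset.range n, f (shift (p + i) ξ)

/-- A word, extended by `e` to a sequence. -/
def ext (u : List Letter) : ℤ → Letter := fun j => if j < 0 then e else u.getD j.toNat e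

theorem ext_append_left {u v : List Letter} {j : ℤ} (h : j < u.length) :
    ext (u ++ v) j = ext u j := by
  unfold ext
  split_ifs with h0
  · rfl
  · rw [List.getD_append]
    omega

theorem ext_append_right {u v : List Letter} {j : ℤ} (h : 0 ≤ j) :
    ext (u ++ v) (j + u.length) = ext v j := by
  unfold ext
  rw [if_neg (by omega), if_neg (by omega), List.getD_append_right _ _ _ _ (by omega)]
  congr 1
  omega

theorem ext_word {ξ : ℤ → Letter} {p : ℤ} {n : ℕ} {j : ℤ} (h0 : 0 ≤ j) (h : j < n) :
    ext (word ξ p n) j = ξ (j + p) := by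
  unfold ext
  rw [if_neg (by omega), List.getD_eq_getElem _ _ (by rw [length_word]; omega), getElem_word]
  congr 1
  omega

/-- Only the first r and the last r indices contribute. This is the boundary error made when a local
function is summed over a word instead of a sequence. -/
theorem abs_sum_range_sub_le {p q : ℕ → ℝ} {n r : ℕ} (h1 : ∀ i, |p i - q i| ≤ 1)
    (h2 : ∀ i, r ≤ i → i + r < n → p i = q i) :
    |∑ i ∈ Finset.range n, p i - ∑ i ∈ Finset.range n, q i| ≤ 2 * r := by
  rw [← Finset.sum_sub_distrib]
  refine (Finset.abs_sum_le_sum_abs _ _).trans ?_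
  calc ∑ i ∈ Finset.range n, |p i - q i|
      ≤ ∑ i ∈ Finset.range n, if i ∈ Finset.range r ∪ Finset.Ico (n - r) n then (1 : ℝ) else 0 := by
        refine Finset.sum_le_sum fun i hi => ?_
        split_ifs with h
        · exact h1 i
        · simp only [Finset.mem_union, Finset.mem_range, Finset.mem_Ico, not_or, not_and,
            not_lt] at h hi
          rw [h2 i (by omega) (by omega)]
          simp
    _ ≤ ∑ i ∈ Finset.range r ∪ Finset.Ico (n - r) n, (1 : ℝ) := by
        rw [Finset.sum_ite_mem]
        exact Finset.sum_le_sum_of_subset_of_nonneg Finset.inter_subset_right (by simp)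
    _ ≤ 2 * r := by
        rw [Finset.sum_const, nsmul_eq_mul, mul_one]
        have := Finset.card_union_le (Finset.range r) (Finset.Ico (n - r) n)
        simp only [Finset.card_range, Nat.card_Ico] at this
        have h3 : (Finset.range r ∪ Finset.Ico (n - r) n).card ≤ 2 * r := by omega
        exact_mod_cast h3

section Frequency

variable {N : ℕ → ℕ} {f : (ℤ → Letter) → ℝ} {r : ℕ}

/-- The sum of `f` over the positions in a word. -/
def wordSum (f : (ℤ → Letter) → ℝ) (u : List Letter) : ℝ := orbitSum f (ext u) 0 u.length

theorem abs_sub_le_one (h0 : ∀ ξ, 0 ≤ f ξ) (h1 : ∀ ξ, f ξ ≤ 1) (ξ η : ℤ → Letter) :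
    |f ξ - f η| ≤ 1 := by
  rw [abs_le]; constructor <;> linarith [h0 ξ, h1 ξ, h0 η, h1 η]

theorem abs_orbitSum_sub_wordSum (hf : IsLocal r f) (h0 : ∀ ξ, 0 ≤ f ξ) (h1 : ∀ ξ, f ξ ≤ 1)
    (ξ : ℤ → Letter) (p : ℤ) (n : ℕ) :
    |orbitSum f ξ p n - wordSum f (word ξ p n)| ≤ 2 * r := by
  rw [wordSum, length_word]
  refine abs_sum_range_sub_le (fun i => abs_sub_le_one h0 h1 _ _) fun i hi hn => hf _ _ fun j hj => ?_
  rw [abs_le] at hj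
  simp only [shift_apply, zero_add]
  rw [ext_word (by omega) (by omega)]
  congr 1
  ring

theorem abs_wordSum_append (hf : IsLocal r f) (h0 : ∀ ξ, 0 ≤ f ξ) (h1 : ∀ ξ, f ξ ≤ 1)
    (u v : List Letter) :
    |wordSum f (u ++ v) - wordSum f u - wordSum f v| ≤ 4 * r := by
  have e1 : wordSum f (u ++ v) = orbitSum f (ext (u ++ v)) 0 u.length +
      orbitSum f (ext (u ++ v)) u.length v.length := by
    rw [wordSum, List.length_append]
    simp only [orbitSum]
    rw [Finset.sum_range_add]
    simp
  have e2 : |orbitSum f (ext (u ++ v)) 0 u.length - wordSum f u| ≤ 2 * r := by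
    refine abs_sum_range_sub_le (fun i => abs_sub_le_one h0 h1 _ _)
      fun i hi hn => hf _ _ fun j hj => ?_
    rw [abs_le] at hj
    exact ext_append_left (by omega)
  have e3 : |orbitSum f (ext (u ++ v)) u.length v.length - wordSum f v| ≤ 2 * r := by
    refine abs_sum_range_sub_le (fun i => abs_sub_le_one h0 h1 _ _)
      fun i hi hn => hf _ _ fun j hj => ?_
    rw [abs_le] at hj
    simp only [shift_apply, zero_add]
    rw [← ext_append_right (u := u) (show 0 ≤ j + i by omega)]
    congr 1
    ring
  rw [e1]
  rw [abs_le] at *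
  constructor <;> linarith

theorem wordSum_nonneg (h0 : ∀ ξ, 0 ≤ f ξ) (u : List Letter) : 0 ≤ wordSum f u := by
  unfold wordSum orbitSum
  exact Finset.sum_nonneg fun _ _ => h0 _

theorem wordSum_le (h1 : ∀ ξ, f ξ ≤ 1) (u : List Letter) : wordSum f u ≤ u.length := by
  unfold wordSum orbitSum
  refine (Finset.sum_le_sum fun _ _ => h1 _).trans ?_
  simp

theorem abs_wordSum_flatMap (hf : IsLocal r f) (h0 : ∀ ξ, 0 ≤ f ξ) (h1 : ∀ ξ, f ξ ≤ 1)
    (g : Letter → List Letter) (W : List Letter) :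
    |wordSum f (W.flatMap g) - (W.map fun y => wordSum f (g y)).sum| ≤ 4 * r * W.length := by
  induction W with
  | nil => simp [wordSum, orbitSum]
  | cons y W ih =>
    have h := abs_wordSum_append hf h0 h1 (g y) (W.flatMap g)
    rw [List.flatMap_cons, List.map_cons, List.sum_cons, List.length_cons]
    push_cast
    rw [abs_le] at *
    constructor <;> linarith

/-- The density of `f` in superletters of level `n` varies by at most `δ`. -/
def HasOscillation (N : ℕ → ℕ) (f : (ℤ → Letter) → ℝ) (n : ℕ) (ρ δ : ℝ) : Prop :=
  ∀ y, |wordSum f (superletter N n y) - ρ * (superletter N n y).length| ≤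
    δ * (superletter N n y).length

theorem abs_flatMap_le (hf : IsLocal r f) (h0 : ∀ ξ, 0 ≤ f ξ) (h1 : ∀ ξ, f ξ ≤ 1)
    {n : ℕ} {ρ δ : ℝ} (h : HasOscillation N f n ρ δ) (W : List Letter) :
    |wordSum f (W.flatMap (superletter N n)) - ρ * (W.flatMap (superletter N n)).length| ≤
      δ * (W.flatMap (superletter N n)).length + 4 * r * W.length := by
  have h2 := abs_wordSum_flatMap hf h0 h1 (superletter N n) W
  have h3 : |(W.map fun y => wordSum f (superletter N n y)).sum -
      ρ * (W.flatMap (superletter N n)).length| ≤ δ * (W.flatMap (superletter N n)).length := by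
    clear h2
    induction W with
    | nil => simp
    | cons y W ih =>
      have h := h y
      simp only [List.flatMap_cons, List.map_cons, List.sum_cons, List.length_append]
      push_cast
      rw [abs_le] at *
      constructor <;> linarith
  rw [abs_le] at *
  constructor <;> linarith

theorem length_flatMap_ge {g : Letter → List Letter} {l : ℕ} (hg : ∀ y, l ≤ (g y).length)
    (W : List Letter) : W.length * l ≤ (W.flatMap g).length := by
  induction W with
  | nil => simp
  | cons y W ih =>
    have := hg y
    simp only [List.length_cons, List.flatMap_cons, List.length_append]
    nlinarith

/-- At least half of the length of S_(n+1)(x) is covered by copies of S_n(a), which all have the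
same density. A common block of relative length 1/2 halves the oscillation; the second term is the
boundary error, at most 4r per block. -/
theorem HasOscillation.succ (hN₀ : N 0 = 0) (hN : StrictMono N)
    (hf : IsLocal r f) (h0 : ∀ ξ, 0 ≤ f ξ) (h1 : ∀ ξ, f ξ ≤ 1) {n : ℕ} {ρ δ : ℝ}
    (h : HasOscillation N f n ρ δ) :
    ∃ ρ', HasOscillation N f (n + 1) ρ' (δ / 2 + 4 * r / Nat.fib (N n + 1)) := by
  set l : ℝ := ((superletter N n a).length : ℝ) with hl
  have hlpos : 0 < l := by
    rw [hl, length_superletter_a hN₀ hN]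
    exact_mod_cast Nat.fib_pos.2 (by omega)
  set ρa : ℝ := wordSum f (superletter N n a) / l with hρa
  have hca : wordSum f (superletter N n a) = ρa * l := by rw [hρa]; field_simp
  have hd : |ρa - ρ| ≤ δ := by
    have h2 := h a
    rw [← hl, hca, ← sub_mul, abs_mul, abs_of_pos hlpos] at h2
    exact le_of_mul_le_mul_right h2 hlpos
  -- With A and B the lengths covered by `a`-blocks and by the others, ρa A + ρ B differs from (ρ +
  -- ρa)(A + B)/2 by (ρa - ρ)(A - B)/2. Since B ≤ A, this is at most δ(A - B)/2, and adding the
  -- error δB of the other blocks gives δ(A + B)/2.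
  refine ⟨(ρ + ρa) / 2, fun x => ?_⟩
  set W := rule N (n + 1) x with hW
  have key : ∀ W : List Letter, ∃ B : ℝ, 0 ≤ B ∧
      ((W.flatMap (superletter N n)).length : ℝ) = W.count a * l + B ∧
      B ≤ (W.length - W.count a) * l ∧
      |(W.map fun y => wordSum f (superletter N n y)).sum - ρa * (W.count a * l) - ρ * B| ≤
        δ * B := by
    intro W
    induction W with
    | nil => exact ⟨0, by simp⟩
    | cons y W ih =>
      obtain ⟨B, hB0, hB1, hB2, hB3⟩ := ih
      by_cases hy : y = a
      · subst hy
        refine ⟨B, hB0, ?_, ?_, ?_⟩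
        · rw [List.flatMap_cons, List.length_append, List.count_cons_self]
          push_cast
          rw [hB1, ← hl]; ring
        · simp; linarith
        · convert hB3 using 2
          simp [hca]; ring
      · refine ⟨B + (superletter N n y).length, by positivity, ?_, ?_, ?_⟩
        · rw [List.flatMap_cons, List.length_append, List.count_cons_of_ne hy]
          push_cast
          rw [hB1]; ring
        · have : ((superletter N n y).length : ℝ) ≤ l := by
            rw [hl, length_superletter_a hN₀ hN]
            exact_mod_cast length_superletter_le hN₀ hN n y
          simp [hy]; linarith
        · have h2 := h y
          simp only [List.map_cons, List.sum_cons, List.count_cons_of_ne hy]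
          rw [abs_le] at *
          constructor <;> linarith
  obtain ⟨B, hB0, hB1, hB2, hB3⟩ := key W
  have hS : superletter N (n + 1) x = W.flatMap (superletter N n) := rfl
  have h2 := abs_wordSum_flatMap hf h0 h1 (superletter N n) W
  rw [← hS] at h2 hB1
  set A : ℝ := W.count a * l with hA
  have hAB : B ≤ A := by
    refine hB2.trans (mul_le_mul_of_nonneg_right ?_ hlpos.le)
    have := length_rule_le hN (Nat.succ_pos n) x
    have : (W.length : ℝ) ≤ 2 * W.count a := by exact_mod_cast this
    linarith
  have hlen : (4 * r * W.length : ℝ) ≤ 4 * r / Nat.fib (N n + 1) * (A + B) := by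
    have hF : (0 : ℝ) < Nat.fib (N n + 1) := by exact_mod_cast Nat.fib_pos.2 (by omega)
    have h3 := length_flatMap_ge (le_length_superletter hN₀ hN n) W
    rw [← hS] at h3
    have h4 : (W.length : ℝ) * Nat.fib (N n + 1) ≤ A + B := by rw [← hB1]; exact_mod_cast h3
    rw [div_mul_eq_mul_div, le_div_iff₀ hF, mul_assoc]
    gcongr
  rw [hB1]
  have h5 : |(ρa - ρ) / 2 * (A - B)| ≤ δ / 2 * (A - B) := by
    rw [abs_mul, abs_of_nonneg (sub_nonneg.2 hAB), abs_div, abs_two]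
    gcongr
  rw [abs_le] at *
  constructor <;> nlinarith

/-- The recursion δ ↦ δ/2 + η with η → 0 drives the oscillation to 0, from the trivial bound 1 at
level 0. -/
theorem exists_small_oscillation (hN₀ : N 0 = 0) (hN : StrictMono N)
    (hf : IsLocal r f) (h0 : ∀ ξ, 0 ≤ f ξ) (h1 : ∀ ξ, f ξ ≤ 1) {ε : ℝ} (hε : 0 < ε) :
    ∃ m, ∀ n ≥ m, (∃ ρ, HasOscillation N f n ρ ε) ∧ 4 * r / (Nat.fib (N n + 1) : ℝ) ≤ ε := by
  set η : ℕ → ℝ := fun n => 4 * r / (Nat.fib (N n + 1) : ℝ) with hη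
  have hη0 : ∀ n, 0 ≤ η n := fun n => by positivity
  have hlim : Tendsto η atTop (𝓝 0) := by
    refine Tendsto.div_atTop tendsto_const_nhds ?_
    refine tendsto_natCast_atTop_atTop.comp (tendsto_atTop_mono' _ ?_ tendsto_id)
    filter_upwards [eventually_ge_atTop 5] with n hn
    exact (Nat.le_fib_self hn).trans (Nat.fib_mono (by have := hN.id_le n; simp at this; omega))
  set δ : ℕ → ℝ := fun n => Nat.rec 1 (fun n d => d / 2 + η n) n with hδ
  have hδs : ∀ n, δ (n + 1) = δ n / 2 + η n := fun n => rfl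
  have hosc : ∀ n, ∃ ρ, HasOscillation N f n ρ (δ n) := by
    intro n
    induction n with
    | zero =>
      refine ⟨0, fun y => ?_⟩
      rw [zero_mul, sub_zero, abs_of_nonneg (wordSum_nonneg h0 _)]
      exact (wordSum_le h1 _).trans (by simp [hδ])
    | succ n ih =>
      obtain ⟨ρ, h⟩ := ih
      exact h.succ hN₀ hN hf h0 h1
  obtain ⟨m, hm⟩ := (eventually_atTop.1 (hlim.eventually_le_const (show 0 < ε / 4 by linarith)))
  have hk : ∀ k, δ (m + k) ≤ ε / 2 + δ m * (1 / 2) ^ k := by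
    intro k
    induction k with
    | zero => simp; linarith
    | succ k ih =>
      rw [← add_assoc, hδs, pow_succ]
      have := hm (m + k) (by omega)
      linarith
  have hlim2 : Tendsto (fun k : ℕ => δ m * (1 / 2 : ℝ) ^ k) atTop (𝓝 (δ m * 0)) :=
    (tendsto_pow_atTop_nhds_zero_of_lt_one (by norm_num) (by norm_num)).const_mul _
  rw [mul_zero] at hlim2
  obtain ⟨k₀, hk₀⟩ := eventually_atTop.1 (hlim2.eventually_le_const (show 0 < ε / 2 by linarith))
  refine ⟨m + k₀, fun n hn => ⟨?_, (hm n (by omega)).trans (by linarith)⟩⟩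
  obtain ⟨ρ, hρ⟩ := hosc n
  refine ⟨ρ, fun y => (hρ y).trans (mul_le_mul_of_nonneg_right ?_ (by positivity))⟩
  obtain ⟨k, rfl⟩ := Nat.exists_eq_add_of_le (show m ≤ n by omega)
  have := hk k
  have := hk₀ k (by omega)
  linarith

theorem exists_approx_frequency (hN₀ : N 0 = 0) (hN : StrictMono N)
    (hf : IsLocal r f) (h0 : ∀ ξ, 0 ≤ f ξ) (h1 : ∀ ξ, f ξ ≤ 1) {ε : ℝ} (hε : 0 < ε) :
    ∃ (ρ : ℝ) (L : ℕ), ∀ ξ ∈ sequenceSpace N, ∀ (p : ℤ) (n : ℕ), L ≤ n →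
      |orbitSum f ξ p n - ρ * n| ≤ ε * n := by
  obtain ⟨m, hm⟩ := exists_small_oscillation hN₀ hN hf h0 h1 (show 0 < ε / 4 by linarith)
  obtain ⟨⟨ρ, hρ⟩, hsmall⟩ := hm m le_rfl
  set M : ℝ := (Nat.fib (N m + 2) : ℝ) with hM
  -- Two incomplete superletters at the ends, plus boundary errors 2r + 4r + 4r for passing to a
  -- word and cutting it twice.
  set K : ℝ := 2 * (1 + |ρ|) * M + 10 * r with hK
  obtain ⟨L, hL⟩ := exists_nat_ge (K / (ε / 2))
  refine ⟨ρ, L, fun ξ hξ p n hn => ?_⟩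
  have hKn : K ≤ ε / 2 * n := by
    rw [div_le_iff₀ (by linarith)] at hL
    have : (L : ℝ) ≤ n := by exact_mod_cast hn
    nlinarith
  have e1 := abs_orbitSum_sub_wordSum hf h0 h1 ξ p n
  obtain ⟨s, W, t, hw, hs, ht⟩ := word_eq_flatMap hN₀ hN hξ m p n
  have hn' : (n : ℝ) = s.length + (W.flatMap (superletter N m)).length + t.length := by
    have := congrArg List.length hw
    rw [length_word, List.length_append, List.length_append] at this
    exact_mod_cast this
  rw [hw] at e1
  have e2 := abs_wordSum_append hf h0 h1 (s ++ W.flatMap (superletter N m)) t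
  have e3 := abs_wordSum_append hf h0 h1 s (W.flatMap (superletter N m))
  have e4 := abs_flatMap_le hf h0 h1 hρ W
  set Q : ℝ := ((W.flatMap (superletter N m)).length : ℝ) with hQ
  have e5 : (4 * r * W.length : ℝ) ≤ ε / 4 * Q := by
    have hF : (0 : ℝ) < Nat.fib (N m + 1) := by exact_mod_cast Nat.fib_pos.2 (by omega)
    have h3 := length_flatMap_ge (le_length_superletter hN₀ hN m) W
    have h4 : (W.length : ℝ) * Nat.fib (N m + 1) ≤ Q := by rw [hQ]; exact_mod_cast h3
    rw [div_le_iff₀ hF] at hsmall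
    have h5 : (0 : ℝ) ≤ W.length := by positivity
    nlinarith
  have short : ∀ u : List Letter, u.length ≤ Nat.fib (N m + 2) →
      |wordSum f u - ρ * u.length| ≤ (1 + |ρ|) * M := by
    intro u hu
    have hu' : (u.length : ℝ) ≤ M := by rw [hM]; exact_mod_cast hu
    have h2 := wordSum_nonneg h0 u
    have h3 := wordSum_le h1 u
    refine (abs_sub _ _).trans ?_
    rw [abs_mul, abs_of_nonneg h2, Nat.abs_cast, add_mul, one_mul]
    gcongr
    exact h3.trans hu'
  have e6 := short s hs
  have e7 := short t ht
  have hQn : Q ≤ n := by rw [hn']; linarith [(Nat.cast_nonneg s.length : (0:ℝ) ≤ _),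
    (Nat.cast_nonneg t.length : (0:ℝ) ≤ _)]
  have e8 : ρ * n = ρ * s.length + ρ * Q + ρ * t.length := by rw [hn']; ring
  rw [e8]
  have e9 : ε / 4 * Q ≤ ε / 4 * n := by gcongr
  rw [abs_le] at *
  constructor <;> linarith

/-- Local functions have uniform averages on the sequence space. -/
theorem exists_frequency (hN₀ : N 0 = 0) (hN : StrictMono N) (hne : (sequenceSpace N).Nonempty)
    (hf : IsLocal r f) (h0 : ∀ ξ, 0 ≤ f ξ) (h1 : ∀ ξ, f ξ ≤ 1) :
    ∃ ρ : ℝ, ∀ ε > 0, ∃ L : ℕ, ∀ ξ ∈ sequenceSpace N, ∀ (p : ℤ) (n : ℕ), L ≤ n →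
      |orbitSum f ξ p n - ρ * n| ≤ ε * n := by
  obtain ⟨ξ₀, hξ₀⟩ := hne
  set s : ℕ → ℝ := fun n => orbitSum f ξ₀ 0 n / n with hs
  have hA : ∀ ε > 0, ∃ (ρ : ℝ) (L : ℕ), (∀ n ≥ L, |s n - ρ| ≤ ε) ∧
      ∀ ξ ∈ sequenceSpace N, ∀ (p : ℤ) (n : ℕ), L ≤ n → |orbitSum f ξ p n - ρ * n| ≤ ε * n := by
    intro ε hε
    obtain ⟨ρ, L, h⟩ := exists_approx_frequency hN₀ hN hf h0 h1 hε
    refine ⟨ρ, L + 1, fun n hn => ?_, fun ξ hξ p n hn => h ξ hξ p n (by omega)⟩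
    have h2 := h ξ₀ hξ₀ 0 n (by omega)
    have hn0 : (0 : ℝ) < n := by exact_mod_cast (show 0 < n by omega)
    have h3 : s n - ρ = (orbitSum f ξ₀ 0 n - ρ * n) / n := by simp only [hs]; field_simp
    rw [h3, abs_div, abs_of_pos hn0, div_le_iff₀ hn0]
    exact h2
  -- The approximate frequencies depend on ε; the averages along one fixed sequence tie them
  -- together into a limit.
  have hC : CauchySeq s := by
    refine Metric.cauchySeq_iff'.2 fun ε hε => ?_
    obtain ⟨ρ, L, h, -⟩ := hA (ε / 3) (by linarith)
    refine ⟨L, fun n hn => ?_⟩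
    have h2 := h n hn
    have h3 := h L le_rfl
    rw [Real.dist_eq, abs_lt]
    rw [abs_le] at h2 h3
    constructor <;> linarith
  obtain ⟨ρ, hρ⟩ := cauchySeq_tendsto_of_complete hC
  refine ⟨ρ, fun ε hε => ?_⟩
  obtain ⟨ρ', L, h, h'⟩ := hA (ε / 2) (by linarith)
  have hρ' : |ρ - ρ'| ≤ ε / 2 := by
    refine le_of_tendsto ((hρ.sub_const ρ').abs) ?_
    filter_upwards [eventually_ge_atTop L] with n hn using h n hn
  refine ⟨L, fun ξ hξ p n hn => ?_⟩
  have h2 := h' ξ hξ p n hn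
  have hn0 : (0 : ℝ) ≤ n := by positivity
  rw [abs_le] at *
  constructor <;> nlinarith

end Frequency

/-! ### Renormalization of the golden interval exchange -/

/-- The letter of a point of `[1 - φ, 2 - φ)`. -/
def lt (z : ℝ) : Letter := if z < 3 - 2 * φ then b else a

/-- The exchange of two intervals that generates Fibonacci sequences. -/
def step (z : ℝ) : ℝ := z + dval (lt z)

/-- The renormalization map. -/
def ren (z : ℝ) : ℝ := if z < 3 - 2 * φ then -φ * (z + (2 - φ)) else -φ * z

/-- Points of the open interval that are not in `ℤ + ℤ φ`. -/
def Gen (z : ℝ) : Prop := 1 - φ < z ∧ z < 2 - φ ∧ ∀ m n : ℤ, z ≠ m + n * φ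

/-- Since φ is a unit of ℤ + ℤφ, the excluded set is invariant under `ren`. Excluding it keeps all
iterates off the discontinuities and endpoints. -/
theorem gen_ren {z : ℝ} (h : Gen z) : Gen (ren z) := by
  obtain ⟨h1, h2, h3⟩ := h
  have hp := phi_sq
  have hl := phi_lower
  have key : ∀ w, (∀ m n : ℤ, w ≠ m + n * φ) → ∀ m n : ℤ, -φ * w ≠ m + n * φ := by
    intro w hw m n hmn
    apply hw (m - n) (-m)
    have : w = -(φ - 1) * (-φ * w) := by linear_combination (-w) * hp
    rw [this, hmn]
    push_cast
    linear_combination (-n : ℝ) * hp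
  unfold ren
  split_ifs with h
  · refine ⟨by nlinarith, by nlinarith, key _ fun m n hmn => h3 (m - 2) (n + 1) ?_⟩
    push_cast
    linarith
  · have h4 := h3 3 (-2)
    have h5 : 3 - 2 * φ < z := lt_of_le_of_ne (not_lt.1 h) (by
      intro h6; apply h4; rw [← h6]; push_cast; ring)
    exact ⟨by nlinarith, by nlinarith, key _ h3⟩

theorem gen_step {z : ℝ} (h : Gen z) : Gen (step z) := by
  obtain ⟨h1, h2, h3⟩ := h
  have h4 := h3 3 (-2)
  unfold step lt
  split_ifs with h
  · refine ⟨?_, ?_, fun m n hmn => h3 (m + 1) (n - 1) ?_⟩ <;> simp only [dval] at *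
    · linarith [phi_lower]
    · linarith
    · push_cast; linarith
  · have h5 : 3 - 2 * φ < z := lt_of_le_of_ne (not_lt.1 h) (by
      intro h6; apply h4; rw [← h6]; push_cast; ring)
    refine ⟨?_, ?_, fun m n hmn => h3 (m + 2) (n - 1) ?_⟩ <;> simp only [dval] at *
    · linarith
    · linarith [phi_upper]
    · push_cast; linarith

theorem gen_iterate_ren {z : ℝ} (h : Gen z) (k : ℕ) : Gen (ren^[k] z) := by
  induction k with
  | zero => exact h
  | succ k ih => rw [Function.iterate_succ_apply']; exact gen_ren ih

theorem lt_ne_e (z : ℝ) : lt z ≠ e := by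
  unfold lt; split_ifs <;> simp

theorem lt_eq_a_or_b (z : ℝ) : lt z = a ∨ lt z = b := by
  unfold lt; split_ifs <;> simp

theorem lt_ren_of_b {z : ℝ} (hz : lt z = b) : lt (ren z) = a := by
  unfold lt at hz ⊢
  unfold ren
  split_ifs at hz ⊢ with h1 h2
  · have := phi_sq
    nlinarith [phi_lower]
  · rfl

/-- An `a` whose parent is `a` begins the block `ab`, so the next letter is the `b` with the same
parent. -/
theorem ren_step_of_aa {z : ℝ} (h : Gen z) (hz : lt z = a) (hz' : lt (ren z) = a) :
    lt (step z) = b ∧ ren (step z) = ren z := by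
  have hp := phi_sq
  have hl := phi_lower
  have hlt : step z < 3 - 2 * φ := by
    unfold lt ren at *
    unfold step lt
    split_ifs at * with h1 h2
    · simp only [dval]
      -- The point 5 - 3φ is carried to the discontinuity 3 - 2φ both by `step` and by
      -- multiplication with -φ.
      have h3 := h.2.2 5 (-3)
      push_cast at h3
      rcases lt_trichotomy z (5 + -3 * φ) with h4 | h4 | h4
      · linarith
      · exact absurd h4 h3
      · nlinarith
  refine ⟨by simp [lt, hlt], ?_⟩
  have h1 : ¬ z < 3 - 2 * φ := by
    intro h1; simp [lt, h1] at hz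
  rw [ren, if_pos hlt, ren, if_neg h1, step, hz, dval]
  ring

/-- In all other cases the letter ends its block. The next block begins with `a`, and its parent is
the successor of the present one. -/
theorem ren_step_of_not_aa {z : ℝ} (h : Gen z) (hz : ¬ (lt z = a ∧ lt (ren z) = a)) :
    lt (step z) = a ∧ ren (step z) = step (ren z) := by
  have hp := phi_sq
  have hl := phi_lower
  have hu := phi_upper
  rcases lt_eq_a_or_b z with ha | hb
  · have hb : lt (ren z) = b := (lt_eq_a_or_b (ren z)).resolve_left fun h' => hz ⟨ha, h'⟩
    have h1 : ¬ z < 3 - 2 * φ := by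
      intro h1; simp [lt, h1] at ha
    have hr : ren z = -φ * z := by rw [ren, if_neg h1]
    have h2 : -φ * z < 3 - 2 * φ := by
      rw [← hr]; by_contra h2; simp [lt, h2] at hb
    have hs : step z = z + (φ - 2) := by rw [step, ha, dval]
    have h3 : ¬ step z < 3 - 2 * φ := by
      rw [hs]
      intro h3
      nlinarith
    refine ⟨by simp [lt, h3], ?_⟩
    rw [ren, if_neg h3, step, step, ha, hb, hr, dval, dval]
    linear_combination -hp
  · have h1 : z < 3 - 2 * φ := by
      by_contra h1; simp [lt, h1] at hb
    have ha := lt_ren_of_b hb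
    have hs : step z = z + (φ - 1) := by rw [step, hb, dval]
    have h3 : ¬ step z < 3 - 2 * φ := by
      rw [hs]; have := h.1; linarith
    refine ⟨by simp [lt, h3], ?_⟩
    rw [ren, if_neg h3, step, step, hb, ha, ren, if_pos h1, dval, dval]
    linear_combination (-2 : ℝ) * hp

/-- The word before the letter of `z` in the Fibonacci supertile of level `k` about `z`. -/
def pre : ℕ → ℝ → List Letter
  | 0, _ => []
  | k + 1, z => (pre k (ren z)).flatMap fibSub ++ (if lt z = b then [a] else [])

/-- The word after the letter of `z` in the Fibonacci supertile of level `k` about `z`. -/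
def suf : ℕ → ℝ → List Letter
  | 0, _ => []
  | k + 1, z => (if lt z = a ∧ lt (ren z) = a then [b] else []) ++ (suf k (ren z)).flatMap fibSub

/-- Desubstitution: `ren` passes to the parent, and inside a block only `b` has a predecessor and
only an `a` with parent `a` has a successor. This ties the interval dynamics to the substitution. -/
theorem fibPow_eq_pre_append {z : ℝ} (h : Gen z) (k : ℕ) :
    fibPow k (lt (ren^[k] z)) = pre k z ++ lt z :: suf k z := by
  induction k generalizing z with
  | zero => rfl
  | succ k ih =>
    rw [Function.iterate_succ_apply, fibPow, ih (gen_ren h), pre, suf, List.flatMap_append,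
      List.flatMap_cons]
    rcases lt_eq_a_or_b z with ha | hb
    · rcases lt_eq_a_or_b (ren z) with h1 | h1 <;> simp [ha, h1, fibSub]
    · simp [hb, lt_ren_of_b hb, fibSub]

/-- Moving by one step inside a supertile. -/
theorem pre_step {z : ℝ} (h : Gen z) {k : ℕ} (hs : suf k z ≠ []) :
    ren^[k] (step z) = ren^[k] z ∧ pre k (step z) = pre k z ++ [lt z] := by
  induction k generalizing z with
  | zero => exact absurd rfl hs
  | succ k ih =>
    rw [Function.iterate_succ_apply, Function.iterate_succ_apply, pre, pre]
    by_cases haa : lt z = a ∧ lt (ren z) = a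
    · obtain ⟨h1, h2⟩ := ren_step_of_aa h haa.1 haa.2
      rw [h2]
      simp [h1, haa.1]
    · obtain ⟨h1, h2⟩ := ren_step_of_not_aa h haa
      have hs' : suf k (ren z) ≠ [] := by
        intro h3
        apply hs
        simp [suf, haa, h3]
      obtain ⟨h3, h4⟩ := ih (gen_ren h) hs'
      rw [h2, h3, h4]
      refine ⟨rfl, ?_⟩
      rcases lt_eq_a_or_b z with ha | hb
      · have hb : lt (ren z) = b := (lt_eq_a_or_b (ren z)).resolve_left fun h' => haa ⟨ha, h'⟩
        simp [h1, ha, hb, fibSub]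
      · simp [h1, hb, lt_ren_of_b hb, fibSub]

theorem pre_add (k m : ℕ) (z : ℝ) :
    pre (k + m) z = (pre m (ren^[k] z)).flatMap (fibPow k) ++ pre k z := by
  induction k generalizing z with
  | zero => simp [pre, fibPow]
  | succ k ih =>
    rw [Nat.add_right_comm, pre, ih, Function.iterate_succ_apply, pre, List.flatMap_append,
      List.flatMap_assoc, List.append_assoc]
    rfl

theorem pre_ne_e {z : ℝ} (h : Gen z) (k : ℕ) : ∀ y ∈ pre k z, y ≠ e := by
  intro y hy
  refine forget_fibPow k (lt_ne_e (ren^[k] z)) y ?_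
  rw [fibPow_eq_pre_append h]
  exact List.mem_append_left _ hy

/-- One renormalization reads z = ψ · `ren z` + (discrepancy of the letter before z in its block),
because -φ = 1/ψ; iterating telescopes. Thus z is the limit of the discrepancies of its supertile
prefixes. -/
theorem disc_pre {z : ℝ} (h : Gen z) (k : ℕ) : disc (pre k z) = z - ψ ^ k * ren^[k] z := by
  induction k generalizing z with
  | zero => simp [pre]
  | succ k ih =>
    have hp := phi_sq
    rw [pre, disc_append, disc_flatMap_fibSub _ (pre_ne_e (gen_ren h) k), ih (gen_ren h),
      Function.iterate_succ_apply, pow_succ']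
    have : ψ * ren z = z - disc (if lt z = b then [a] else []) := by
      unfold ren lt
      rw [psi_eq]
      by_cases h1 : z < 3 - 2 * φ
      · simp only [h1, if_true, disc_cons, disc_nil, dval]
        linear_combination (z + 2 - φ) * hp
      · simp only [h1, reduceCtorEq, if_false, disc_nil]
        linear_combination z * hp
    rw [mul_sub, this]
    ring

/-! ### Measurability and volume of address sets -/

section Measurability

instance : MeasurableSpace Letter := ⊤

instance : MeasurableSpace (List Letter) := ⊤

theorem measurable_lt : Measurable lt :=
  Measurable.ite (measurableSet_lt measurable_id measurable_const) measurable_const measurable_const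

theorem measurable_ren : Measurable ren :=
  Measurable.ite (measurableSet_lt measurable_id measurable_const) (by fun_prop) (by fun_prop)

theorem measurable_pre (k : ℕ) : Measurable (pre k) := by
  induction k with
  | zero => exact measurable_const
  | succ k ih =>
    exact (measurable_of_countable fun p : List Letter × Letter =>
        p.1.flatMap fibSub ++ (if p.2 = b then [a] else [])).comp ((ih.comp measurable_ren).prodMk measurable_lt)

theorem measurable_suf (k : ℕ) : Measurable (suf k) := by
  induction k with
  | zero => exact measurable_const
  | succ k ih =>
    exact (measurable_of_countable fun p : List Letter × Letter × Letter =>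
        (if p.2.1 = a ∧ p.2.2 = a then [b] else []) ++ p.1.flatMap fibSub).comp ((ih.comp measurable_ren).prodMk
      (measurable_lt.prodMk (measurable_lt.comp measurable_ren)))

end Measurability

/-- The volume of a set of points, in terms of its addresses of level `k`. -/
theorem volume_le_of_pre {A M : Set ℝ} {k : ℕ} (U : Finset (List Letter)) (hA : ∀ z ∈ A, Gen z)
    (hU : ∀ z ∈ A, pre k z ∈ U) (hM : ∀ z ∈ A, ren^[k] z ∈ M) :
    volume A ≤ U.card * (ENNReal.ofReal (φ⁻¹ ^ k) * volume M) := by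
  -- By `disc_pre`, a point with address u is the discrepancy of u plus its renormalization scaled
  -- by ψ^k.
  have h1 : A ⊆ ⋃ u ∈ U, (fun m => disc u + m) '' ((fun m => ψ ^ k * m) '' M) := by
    intro z hz
    refine Set.mem_iUnion₂.2 ⟨pre k z, hU z hz, ψ ^ k * ren^[k] z, ⟨_, hM z hz, rfl⟩, ?_⟩
    simp only
    rw [disc_pre (hA z hz)]
    ring
  refine (measure_mono h1).trans ((measure_biUnion_finset_le _ _).trans ?_)
  refine (Finset.sum_le_sum fun u _ => ?_).trans (by rw [Finset.sum_const, nsmul_eq_mul])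
  rw [Set.image_add_left, measure_preimage_add]
  have := Measure.addHaar_smul volume (ψ ^ k) M
  simp only [Module.finrank_self, pow_one, abs_pow, abs_psi] at this
  exact this.le

/-! ### Scrambled addresses -/

section Address

variable (N : ℕ → ℕ)

/-- The supertile of level `n` about `x` is the marked one in its supertile of level `n + 1`. -/
def IsMarked (n : ℕ) (x : ℝ) : Prop :=
  Odd n ∧ lt (ren^[N n] x) = b ∧ b ∉ suf (gap N (n + 1)) (ren^[N n] x)

open Classical in
/-- The type of the supertile of level `n` about `x`. -/
def tau (n : ℕ) (x : ℝ) : Letter := if IsMarked N n x then e else lt (ren^[N n] x)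

/-- The position of `x` in its supertile of level `n`. -/
def pos (n : ℕ) (x : ℝ) : ℕ := (pre (N n) x).length

/-- The letter of the scrambled supertile of level `n` at the position of `x`. -/
def gl (n : ℕ) (x : ℝ) : Letter := (superletter N n (tau N n x)).getD (pos N n x) e

/-- The discrepancy of the scrambled supertile of level `n` before the position of `x`. -/
def discTake (n : ℕ) (x : ℝ) : ℝ := disc ((superletter N n (tau N n x)).take (pos N n x))

variable {N}

theorem forget_tau (n : ℕ) (x : ℝ) : forget (tau N n x) = lt (ren^[N n] x) := by
  unfold tau
  split_ifs with h
  · rw [h.2.1]; rfl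
  · exact forget_of_ne (lt_ne_e _)

theorem tau_ne_e_iff {n : ℕ} {x : ℝ} : tau N n x ≠ e ↔ ¬ IsMarked N n x := by
  unfold tau
  split_ifs with h <;> simp [h, lt_ne_e]

theorem length_superletter_tau (hN₀ : N 0 = 0) (hN : StrictMono N) {x : ℝ} (h : Gen x) (n : ℕ) :
    (superletter N n (tau N n x)).length = pos N n x + 1 + (suf (N n) x).length := by
  rw [length_superletter hN₀ hN, forget_tau, fibPow_eq_pre_append h, pos]
  simp
  omega

theorem pos_lt (hN₀ : N 0 = 0) (hN : StrictMono N) {x : ℝ} (h : Gen x) (n : ℕ) :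
    pos N n x < (superletter N n (tau N n x)).length := by
  rw [length_superletter_tau hN₀ hN h]; omega

theorem length_flatMap_eq_of_forget (hN₀ : N 0 = 0) (hN : StrictMono N) (n : ℕ)
    {u v : List Letter} (h : u.map forget = v.map forget) :
    (u.flatMap (superletter N n)).length = (v.flatMap (fibPow (N n) ∘ forget)).length := by
  have h1 : ∀ w : List Letter, (w.flatMap (superletter N n)).length =
      ((w.map forget).map fun y => (fibPow (N n) y).length).sum := by
    intro w
    simp [List.length_flatMap, length_superletter hN₀ hN, Function.comp_def]
  rw [h1, h]
  simp [List.length_flatMap, Function.comp_def]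

theorem pos_succ (hN : StrictMono N) {x : ℝ} (h : Gen x)
    (n : ℕ) : pos N (n + 1) x =
      ((pre (gap N (n + 1)) (ren^[N n] x)).flatMap (fibPow (N n) ∘ forget)).length +
        pos N n x := by
  rw [pos, ← add_gap hN, pre_add, List.length_append, ← pos]
  congr 2
  refine List.flatMap_congr fun y hy => ?_
  rw [Function.comp_apply, forget_of_ne (pre_ne_e (gen_iterate_ren h _) _ y hy)]

theorem disc_eq_of_forget {u v : List Letter} (h : u.map forget = v.map forget) :
    disc u = disc v := by
  have h1 : ∀ w : List Letter, disc w = ((w.map forget).map dval).sum := by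
    intro w
    simp [disc, Function.comp_def, dval_forget]
  rw [h1, h1, h]

/-- The supertile of level `n` of an unmarked supertile of level `n + 1`. -/
theorem exists_superletter_eq (hN₀ : N 0 = 0) (hN : StrictMono N) {x : ℝ} (h : Gen x) {n : ℕ}
    (hn : tau N (n + 1) x ≠ e) :
    ∃ A B, superletter N (n + 1) (tau N (n + 1) x) = A ++ superletter N n (tau N n x) ++ B ∧
      pos N (n + 1) x = A.length + pos N n x ∧
      disc A = ψ ^ N n * disc (pre (gap N (n + 1)) (ren^[N n] x)) := by
  have h1 : tau N (n + 1) x = lt (ren^[N (n + 1)] x) := by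
    rw [← forget_tau, forget_of_ne hn]
  have h2 : fibPow (gap N (n + 1)) (tau N (n + 1) x) =
      pre (gap N (n + 1)) (ren^[N n] x) ++ lt (ren^[N n] x) ::
        suf (gap N (n + 1)) (ren^[N n] x) := by
    rw [← fibPow_eq_pre_append (gen_iterate_ren h _), ← Function.iterate_add_apply,
      Nat.add_comm (gap N (n + 1)) (N n), add_gap hN, h1]
  have key : ∃ u' v', rule N (n + 1) (tau N (n + 1) x) = u' ++ tau N n x :: v' ∧
      u'.map forget = (pre (gap N (n + 1)) (ren^[N n] x)).map forget := by
    have hr : rule N (n + 1) (tau N (n + 1) x) = if Odd (n + 1)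
        then fibPow (gap N (n + 1)) (tau N (n + 1) x)
        else markLast (fibPow (gap N (n + 1)) (tau N (n + 1) x)) := by
      generalize tau N (n + 1) x = y at hn
      cases y <;> simp_all [rule]
    rw [hr, h2]
    split_ifs with ho
    · refine ⟨_, suf (gap N (n + 1)) (ren^[N n] x), ?_, rfl⟩
      have : ¬ IsMarked N n x := fun hm => by
        have := hm.1.add_one
        exact Nat.not_even_iff_odd.2 ho this
      rw [tau, if_neg this]
    -- At even level n + 1 the letter becomes `e` precisely if it is a `b` with no `b` after it,
    -- which is what `IsMarked` records for the odd level n.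
    · obtain ⟨u', v', h3, h4⟩ := markLast_append_cons (pre (gap N (n + 1)) (ren^[N n] x))
        (lt (ren^[N n] x)) (suf (gap N (n + 1)) (ren^[N n] x))
      refine ⟨u', v', ?_, h4⟩
      rw [h3]
      have hodd : Odd n := by
        by_contra h5
        exact ho (Nat.not_odd_iff_even.1 h5).add_one
      congr 2
      unfold tau IsMarked
      simp [hodd]
  obtain ⟨u', v', h3, h4⟩ := key
  refine ⟨u'.flatMap (superletter N n), v'.flatMap (superletter N n), ?_, ?_, ?_⟩
  · simp [superletter, h3]
  · rw [pos_succ hN h, length_flatMap_eq_of_forget hN₀ hN n h4]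
  · rw [disc_flatMap_superletter hN₀ hN, disc_eq_of_forget h4]

/-- Outside type `e` the constituents keep their Fibonacci order, and all lengths are unchanged; so
x occupies the same place in the same constituent. -/
theorem gl_succ (hN₀ : N 0 = 0) (hN : StrictMono N) {x : ℝ} (h : Gen x) {n : ℕ}
    (hn : tau N (n + 1) x ≠ e) : gl N (n + 1) x = gl N n x := by
  obtain ⟨A, B, h1, h2, -⟩ := exists_superletter_eq hN₀ hN h hn
  have := pos_lt hN₀ hN h n
  rw [gl, gl, h1, h2, List.append_assoc, List.getD_append_right _ _ _ _ (by omega),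
    Nat.add_sub_cancel_left, List.getD_append _ _ _ _ this]

theorem discTake_succ (hN₀ : N 0 = 0) (hN : StrictMono N) {x : ℝ} (h : Gen x) {n : ℕ}
    (hn : tau N (n + 1) x ≠ e) : discTake N (n + 1) x =
      ψ ^ N n * disc (pre (gap N (n + 1)) (ren^[N n] x)) + discTake N n x := by
  obtain ⟨A, B, h1, h2, h3⟩ := exists_superletter_eq hN₀ hN h hn
  have := pos_lt hN₀ hN h n
  rw [discTake, discTake, h1, h2, List.append_assoc, List.take_length_add_append,
    List.take_append_of_le_length this.le, disc_append, h3]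

theorem gl_eq_of_le (hN₀ : N 0 = 0) (hN : StrictMono N) {x : ℝ} (h : Gen x) {n m : ℕ}
    (hn : ∀ k > n, tau N k x ≠ e) (hm : n ≤ m) : gl N m x = gl N n x := by
  induction m, hm using Nat.le_induction with
  | base => rfl
  | succ m hm ih => rw [gl_succ hN₀ hN h (hn _ (by omega)), ih]

/-- The type depends on x only through the renormalized point, which is constant along a supertile.
-/
theorem tau_step {x : ℝ} (h : Gen x) {n : ℕ} (hs : suf (N n) x ≠ []) :
    tau N n (step x) = tau N n x ∧ pos N n (step x) = pos N n x + 1 := by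
  obtain ⟨h1, h2⟩ := pre_step h hs
  constructor
  · unfold tau IsMarked
    rw [h1]
  · rw [pos, h2, pos]; simp

theorem discTake_step (hN₀ : N 0 = 0) (hN : StrictMono N) {x : ℝ} (h : Gen x) {n : ℕ}
    (hs : suf (N n) x ≠ []) : discTake N n (step x) = discTake N n x + dval (gl N n x) := by
  obtain ⟨h1, h2⟩ := tau_step h hs
  have := pos_lt hN₀ hN h n
  rw [discTake, h1, h2, List.take_add_one, disc_append, List.getElem?_eq_getElem this, discTake, gl,
    List.getD_eq_getElem _ _ this]
  simp

/-- Points whose addresses determine scrambled sequences. -/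
structure Good (N : ℕ → ℕ) (x : ℝ) : Prop where
  gen : Gen x
  tau_ne : ∀ᶠ n in atTop, tau N n x ≠ e
  suf_ne : ∀ᶠ n in atTop, suf (N n) x ≠ []

theorem measurableSet_isMarked (n : ℕ) : MeasurableSet {x | IsMarked N n x} := by
  have h1 := measurable_ren.iterate (N n)
  have h2 : Measurable fun x => (lt (ren^[N n] x), suf (gap N (n + 1)) (ren^[N n] x)) :=
    (measurable_lt.comp h1).prodMk ((measurable_suf _).comp h1)
  exact h2 (MeasurableSet.of_discrete
    (s := {p : Letter × List Letter | Odd n ∧ p.1 = b ∧ b ∉ p.2}))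

theorem measurable_tau (n : ℕ) : Measurable (tau N n) := by
  classical
  have h : Measurable fun x => lt (ren^[N n] x) :=
    measurable_lt.comp (measurable_ren.iterate (N n))
  unfold tau
  exact Measurable.ite (measurableSet_isMarked n) measurable_const h

theorem measurable_pos (n : ℕ) : Measurable (pos N n) :=
  (measurable_of_countable List.length).comp (measurable_pre (N n))

theorem measurable_gl (n : ℕ) : Measurable (gl N n) :=
  (measurable_of_countable fun p : Letter × ℕ => (superletter N n p.1).getD p.2 e).comp
    ((measurable_tau n).prodMk (measurable_pos n))

theorem measurable_discTake (n : ℕ) : Measurable (discTake N n) :=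
  (measurable_of_countable fun p : Letter × ℕ => disc ((superletter N n p.1).take p.2)).comp
    ((measurable_tau n).prodMk (measurable_pos n))

/-! ### Exceptional sets and Borel–Cantelli -/

theorem fib_le_pow (k : ℕ) : (Nat.fib (k + 2) : ℝ) ≤ φ ^ (k + 1) := by
  rw [← Real.goldenRatio_mul_fib_succ_add_fib, Nat.fib_add_two]
  push_cast
  have : (0 : ℝ) ≤ Nat.fib (k + 1) := by positivity
  nlinarith [phi_lower]

theorem volume_gen_le {A : Set ℝ} (hA : ∀ z ∈ A, Gen z) : volume A ≤ 1 := by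
  have : A ⊆ Ioo (1 - φ) (2 - φ) := fun z hz => ⟨(hA z hz).1, (hA z hz).2.1⟩
  refine (measure_mono this).trans ?_
  rw [Real.volume_Ioo, show 2 - φ - (1 - φ) = 1 by ring, ENNReal.ofReal_one]

/-- A last position has only two possible addresses, one for each type of supertile, and each
cylinder is a φ^(-k)-scaled copy of a set of volume at most 1. -/
theorem volume_last_le (k : ℕ) :
    volume {x | Gen x ∧ suf k x = []} ≤ 2 * ENNReal.ofReal (φ⁻¹ ^ k) := by
  refine (volume_le_of_pre (k := k) (M := {z | Gen z})
    (Finset.image (fun y => (fibPow k y).dropLast) {a, b}) (fun z hz => hz.1) ?_ ?_).trans ?_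
  · intro z hz
    refine Finset.mem_image.2 ⟨lt (ren^[k] z), ?_, ?_⟩
    · rcases lt_eq_a_or_b (ren^[k] z) with h | h <;> simp [h]
    · rw [fibPow_eq_pre_append hz.1, hz.2]
      simp
  · intro z hz
    exact gen_iterate_ren hz.1 k
  · have h1 : (Finset.image (fun y => (fibPow k y).dropLast) {a, b}).card ≤ 2 :=
      Finset.card_image_le
    have h2 : volume {z | Gen z} ≤ 1 := volume_gen_le fun z hz => hz
    calc _ ≤ ((2 : ℕ) : ENNReal) * (ENNReal.ofReal (φ⁻¹ ^ k) * 1) := by gcongr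
      _ = _ := by simp

/-- Each type of supertile has at most one last `b`, so again there are only two addresses. In the
covering family this position is found as the first `b` of the reversed word. -/
theorem volume_mark_le (k : ℕ) :
    volume {x | Gen x ∧ lt x = b ∧ b ∉ suf k x} ≤ 2 * ENNReal.ofReal (φ⁻¹ ^ k) := by
  refine (volume_le_of_pre (k := k) (M := {z | Gen z}) (Finset.image (fun y =>
    (fibPow k y).take ((fibPow k y).length - 1 - (fibPow k y).reverse.idxOf b)) {a, b})
    (fun z hz => hz.1) ?_ ?_).trans ?_
  · intro z hz
    refine Finset.mem_image.2 ⟨lt (ren^[k] z), ?_, ?_⟩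
    · rcases lt_eq_a_or_b (ren^[k] z) with h | h <;> simp [h]
    · rw [fibPow_eq_pre_append hz.1, hz.2.1]
      have h1 : (pre k z ++ b :: suf k z).reverse.idxOf b = (suf k z).length := by
        simp [List.idxOf_append, hz.2.2]
      rw [h1]
      simp only [List.length_append, List.length_cons]
      rw [show (pre k z).length + ((suf k z).length + 1) - 1 - (suf k z).length =
        (pre k z).length by omega, List.take_left]
  · intro z hz
    exact gen_iterate_ren hz.1 k
  · have h1 : (Finset.image (fun y =>
        (fibPow k y).take ((fibPow k y).length - 1 - (fibPow k y).reverse.idxOf b)) {a, b}).card ≤ 2 :=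
      Finset.card_image_le
    have h2 : volume {z | Gen z} ≤ 1 := volume_gen_le fun z hz => hz
    calc _ ≤ ((2 : ℕ) : ENNReal) * (ENNReal.ofReal (φ⁻¹ ^ k) * 1) := by gcongr
      _ = _ := by simp

/-- There are at most 2 F_(N(n)+2) ≤ 2 φ^(N(n)+1) addresses of level N(n), each scaling by φ^(-N(n))
a set of volume at most 2 φ^(-Δ(n+1)). -/
theorem volume_isMarked_le (n : ℕ) : volume {x | Gen x ∧ IsMarked N n x} ≤
    ENNReal.ofReal (4 * φ * φ⁻¹ ^ gap N (n + 1)) := by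
  refine (volume_le_of_pre (k := N n)
    (M := {x | Gen x ∧ lt x = b ∧ b ∉ suf (gap N (n + 1)) x})
    (Finset.image (fun p : Letter × ℕ => (fibPow (N n) p.1).take p.2)
      ({a, b} ×ˢ Finset.range (Nat.fib (N n + 2)))) (fun z hz => hz.1) ?_ ?_).trans ?_
  · intro z hz
    refine Finset.mem_image.2 ⟨(lt (ren^[N n] z), (pre (N n) z).length), ?_, ?_⟩
    · refine Finset.mem_product.2 ⟨?_, Finset.mem_range.2 ?_⟩
      · rcases lt_eq_a_or_b (ren^[N n] z) with h | h <;> simp [h]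
      · have h1 := congrArg List.length (fibPow_eq_pre_append hz.1 (N n))
        have h2 : (fibPow (N n) (lt (ren^[N n] z))).length ≤ Nat.fib (N n + 2) := by
          rcases lt_eq_a_or_b (ren^[N n] z) with h | h
          · rw [h, length_fibPow_a]
          · rw [h, length_fibPow_b]; exact Nat.fib_mono (by omega)
        simp only [List.length_append, List.length_cons] at h1
        simp only
        omega
    · simp only
      rw [fibPow_eq_pre_append hz.1, List.take_left]
  · intro z hz
    exact ⟨gen_iterate_ren hz.1 _, hz.2.2⟩
  · have h1 : (Finset.image (fun p : Letter × ℕ => (fibPow (N n) p.1).take p.2)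
        ({a, b} ×ˢ Finset.range (Nat.fib (N n + 2)))).card ≤ 2 * Nat.fib (N n + 2) := by
      refine Finset.card_image_le.trans ?_
      rw [Finset.card_product, Finset.card_range]
      exact Nat.mul_le_mul_right _ (by decide)
    have hp := Real.goldenRatio_pos
    calc _ ≤ ((2 * Nat.fib (N n + 2) : ℕ) : ENNReal) * (ENNReal.ofReal (φ⁻¹ ^ N n) *
          (2 * ENNReal.ofReal (φ⁻¹ ^ gap N (n + 1)))) := by
            gcongr
            exact volume_mark_le _
      _ = ENNReal.ofReal ((2 * Nat.fib (N n + 2) : ℕ) * (φ⁻¹ ^ N n *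
          (2 * φ⁻¹ ^ gap N (n + 1)))) := by
            rw [ENNReal.ofReal_mul (by positivity), ENNReal.ofReal_mul (by positivity),
              ENNReal.ofReal_mul (by positivity), ENNReal.ofReal_natCast]
            simp
      _ ≤ _ := by
            refine ENNReal.ofReal_le_ofReal ?_
            have h3 := fib_le_pow (N n)
            have h4 : φ ^ (N n + 1) * φ⁻¹ ^ N n = φ := by
              rw [pow_succ, mul_right_comm, ← mul_pow, mul_inv_cancel₀ hp.ne', one_pow, one_mul]
            push_cast
            calc 2 * (Nat.fib (N n + 2) : ℝ) * (φ⁻¹ ^ N n * (2 * φ⁻¹ ^ gap N (n + 1)))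
                ≤ 2 * (φ ^ (N n + 1)) * (φ⁻¹ ^ N n * (2 * φ⁻¹ ^ gap N (n + 1))) := by gcongr
              _ = 4 * (φ ^ (N n + 1) * φ⁻¹ ^ N n) * φ⁻¹ ^ gap N (n + 1) := by ring
              _ = _ := by rw [h4]

/-- Borel–Cantelli for marked supertiles, which exist only at odd levels, and for last positions.
The first use is where the summability assumption enters. -/
theorem ae_good (hN : StrictMono N) (hsum : Summable fun κ : {κ : ℕ // Odd κ} =>
    (φ ^ gap N ((κ : ℕ) + 1))⁻¹) : ∀ᵐ x : ℝ, Gen x → Good N x := by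
  have hp := Real.goldenRatio_pos
  have h1 : ∀ᵐ x : ℝ, ∀ᶠ n in atTop, x ∉ {x | Gen x ∧ IsMarked N n x} := by
    refine ae_eventually_notMem ?_
    have hs : Summable fun n => {κ : ℕ | Odd κ}.indicator
        (fun κ => 4 * φ * φ⁻¹ ^ gap N (κ + 1)) n := by
      rw [← summable_subtype_iff_indicator]
      simp only [inv_pow]
      exact hsum.mul_left (4 * φ)
    refine ne_top_of_le_ne_top hs.tsum_ofReal_ne_top (ENNReal.tsum_le_tsum fun n => ?_)
    by_cases hn : Odd n
    · rw [Set.indicator_of_mem (by exact hn)]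
      exact volume_isMarked_le n
    · have : {x | Gen x ∧ IsMarked N n x} = ∅ := by
        ext x
        simp [IsMarked, hn]
      rw [this]
      simp
  have h2 : ∀ᵐ x : ℝ, ∀ᶠ n in atTop, x ∉ {x | Gen x ∧ suf (N n) x = []} := by
    refine ae_eventually_notMem ?_
    have hs : Summable fun n : ℕ => 2 * φ⁻¹ ^ n :=
      (summable_geometric_of_lt_one (by positivity)
        (inv_lt_one_of_one_lt₀ Real.one_lt_goldenRatio)).mul_left 2
    refine ne_top_of_le_ne_top hs.tsum_ofReal_ne_top (ENNReal.tsum_le_tsum fun n => ?_)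
    refine (volume_last_le _).trans ?_
    rw [ENNReal.ofReal_mul (by norm_num)]
    simp only [ENNReal.ofReal_ofNat]
    exact mul_le_mul' le_rfl (ENNReal.ofReal_le_ofReal (pow_le_pow_of_le_one (by positivity)
      (inv_le_one_of_one_le₀ Real.one_lt_goldenRatio.le) (hN.id_le n)))
  filter_upwards [h1, h2] with x hx1 hx2 hx
  refine ⟨hx, ?_, ?_⟩
  · filter_upwards [hx1] with n hn
    rw [tau_ne_e_iff]
    exact fun h => hn ⟨hx, h⟩
  · filter_upwards [hx2] with n hn h
    exact hn ⟨hx, h⟩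

end Address

/-! ### Scrambled sequences over the circle -/

section Circle

/-- The representative of a point of the circle in `[1 - φ, 2 - φ)`. -/
def rep (x : UnitAddCircle) : ℝ := AddCircle.equivIco 1 (1 - φ) x

theorem coe_rep (x : UnitAddCircle) : (rep x : UnitAddCircle) = x := AddCircle.coe_equivIco

theorem rep_coe {z : ℝ} (h1 : 1 - φ ≤ z) (h2 : z < 2 - φ) : rep (z : UnitAddCircle) = z :=
  AddCircle.equivIco_coe_of_mem (p := (1 : ℝ)) ⟨h1, by linarith⟩

theorem rep_mem (x : UnitAddCircle) : 1 - φ ≤ rep x ∧ rep x < 2 - φ := by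
  have h := (AddCircle.equivIco 1 (1 - φ) x).2
  exact ⟨h.1, by have := h.2; unfold rep; linarith⟩

theorem measurable_rep : Measurable rep :=
  measurable_subtype_coe.comp (AddCircle.measurableEquivIco 1 (1 - φ)).measurable

/-- Haar measure is Lebesgue measure on a fundamental interval; its other endpoint is the single
extra point in the covering. Almost-everywhere statements can thus be pulled back from the line. -/
theorem quasiMeasurePreserving_rep : Measure.QuasiMeasurePreserving rep := by
  refine ⟨measurable_rep, Measure.AbsolutelyContinuous.mk fun s hs h0 => ?_⟩
  rw [Measure.map_apply measurable_rep hs,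
    AddCircle.add_projection_respects_measure 1 (1 - φ) (measurable_rep hs)]
  refine measure_mono_null (t := s ∪ {1 - φ + 1}) ?_ ?_
  · rintro y ⟨h1, h2⟩
    rcases eq_or_lt_of_le h2.2 with h | h
    · exact Or.inr h
    · left
      have := rep_coe h2.1.le (by linarith)
      rw [← this]
      exact h1
  · exact measure_union_null h0 (by simp)

theorem ae_gen_rep : ∀ᵐ x : UnitAddCircle, Gen (rep x) := by
  have h : ∀ᵐ z : ℝ, ∀ m n : ℤ, z ≠ m + n * φ := by
    rw [ae_all_iff]; intro m
    rw [ae_all_iff]; intro n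
    exact Measure.ae_ne volume _
  have h2 : ∀ᵐ z : ℝ, z ≠ 1 - φ := Measure.ae_ne volume _
  filter_upwards [quasiMeasurePreserving_rep.ae h, quasiMeasurePreserving_rep.ae h2] with x hx hx2
  exact ⟨lt_of_le_of_ne (rep_mem x).1 (Ne.symm hx2), (rep_mem x).2, hx⟩

theorem rep_add_phi {x : UnitAddCircle} (h : Gen (rep x)) :
    rep (x + (φ : ℝ)) = step (rep x) := by
  have h1 := gen_step h
  have h2 : x + (φ : ℝ) = ((step (rep x) : ℝ) : UnitAddCircle) := by
    have : step (rep x) = rep x + φ - 1 ∨ step (rep x) = rep x + φ - 2 := by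
      unfold step lt
      split_ifs <;> simp only [dval]
      · left; ring
      · right; ring
    rcases this with h | h <;> rw [h]
    · rw [AddCircle.coe_sub, AddCircle.coe_add, coe_rep, AddCircle.coe_period, sub_zero]
    · have h3 : ((2 : ℝ) : UnitAddCircle) = 0 := by
        have : (2 : ℝ) = 1 + 1 := by norm_num
        rw [this, AddCircle.coe_add, AddCircle.coe_period, add_zero]
      rw [AddCircle.coe_sub, AddCircle.coe_add, coe_rep, h3, sub_zero]
  rw [h2, rep_coe h1.1.le h1.2.1]

variable (N : ℕ → ℕ)

open Classical in
/-- The letter at the origin of the scrambled sequence of `z`. -/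
def glim (z : ℝ) : Letter :=
  if ∀ᶠ n in atTop, gl N n z = b then b else if ∀ᶠ n in atTop, gl N n z = e then e else a

/-- The scrambled sequence of a point of the circle. -/
def seq (x : UnitAddCircle) : ℤ → Letter := fun j => glim N (rep (x + ((j * φ : ℝ) : UnitAddCircle)))

variable {N}

theorem glim_eq {z : ℝ} {y : Letter} (h : ∀ᶠ n in atTop, gl N n z = y) : glim N z = y := by
  have key : ∀ x, x ≠ y → ¬ ∀ᶠ n in atTop, gl N n z = x := by
    intro x hx h'
    obtain ⟨n, h1, h2⟩ := (h.and h').exists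
    exact hx (h2.symm.trans h1)
  unfold glim
  cases y
  · rw [if_neg (key b (by simp)), if_neg (key e (by simp))]
  · rw [if_pos h]
  · rw [if_neg (key b (by simp)), if_pos h]

theorem eventually_gl_eq (hN₀ : N 0 = 0) (hN : StrictMono N) {z : ℝ} (h : Good N z) :
    ∀ᶠ n in atTop, gl N n z = glim N z := by
  obtain ⟨n₀, h₀⟩ := eventually_atTop.1 h.tau_ne
  have h1 : ∀ᶠ n in atTop, gl N n z = gl N n₀ z := by
    filter_upwards [eventually_ge_atTop n₀] with n hn
    exact gl_eq_of_le hN₀ hN h.gen (fun k hk => h₀ k hk.le) hn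
  rw [glim_eq h1]
  exact h1

theorem measurableSet_eventually_gl (y : Letter) :
    MeasurableSet {z | ∀ᶠ n in atTop, gl N n z = y} := by
  have : {z | ∀ᶠ n in atTop, gl N n z = y} = ⋃ n₀ : ℕ, ⋂ n : ℕ, ⋂ _ : n₀ ≤ n, {z | gl N n z = y} := by
    ext z
    simp [eventually_atTop]
  rw [this]
  exact MeasurableSet.iUnion fun _ => MeasurableSet.iInter fun n => MeasurableSet.iInter fun _ =>
    measurable_gl n (MeasurableSet.of_discrete (s := {y}))

theorem measurable_glim : Measurable (glim N) :=
  Measurable.ite (measurableSet_eventually_gl b) measurable_const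
    (Measurable.ite (measurableSet_eventually_gl e) measurable_const measurable_const)

theorem measurable_seq : Measurable (seq N) :=
  measurable_pi_lambda _ fun _ =>
    measurable_glim.comp (measurable_rep.comp (measurable_id.add_const _))

theorem seq_add (x : UnitAddCircle) (k : ℤ) :
    seq N (x + ((k * φ : ℝ) : UnitAddCircle)) = shift k (seq N x) := by
  funext j
  simp only [seq, shift]
  congr 2
  rw [add_assoc, ← AddCircle.coe_add]
  push_cast
  ring_nf

/-- All points of the orbit of `x` are good. -/
def AllGood (N : ℕ → ℕ) (x : UnitAddCircle) : Prop :=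
  ∀ j : ℤ, Good N (rep (x + ((j * φ : ℝ) : UnitAddCircle)))

theorem ae_allGood (hN : StrictMono N) (hsum : Summable fun κ : {κ : ℕ // Odd κ} =>
    (φ ^ gap N ((κ : ℕ) + 1))⁻¹) : ∀ᵐ x : UnitAddCircle, AllGood N x := by
  unfold AllGood
  rw [ae_all_iff]
  intro j
  have h : ∀ᵐ x : UnitAddCircle, Good N (rep x) := by
    filter_upwards [quasiMeasurePreserving_rep.ae (ae_good hN hsum), ae_gen_rep] with x h1 h2
      using h1 h2
  exact (measurePreserving_add_right volume _).quasiMeasurePreserving.ae h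

theorem AllGood.rep_add_one {x : UnitAddCircle} (h : AllGood N x) (j : ℤ) :
    rep (x + (((j + 1 : ℤ) * φ : ℝ) : UnitAddCircle)) =
      step (rep (x + ((j * φ : ℝ) : UnitAddCircle))) := by
  rw [← rep_add_phi (h j).gen, add_assoc, ← AddCircle.coe_add]
  push_cast
  ring_nf

/-- For a finite window, some level has all letters stabilized and no position of the window last in
its supertile. The window then lies at consecutive positions of one superletter. -/
theorem seq_mem (hN₀ : N 0 = 0) (hN : StrictMono N) {x : UnitAddCircle} (h : AllGood N x) :
    seq N x ∈ sequenceSpace N := by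
  intro i k
  have h1 : ∀ᶠ n in atTop, ∀ j ∈ Finset.range k,
      gl N n (rep (x + (((i + j : ℤ) * φ : ℝ) : UnitAddCircle))) = seq N x (i + j) ∧
      suf (N n) (rep (x + (((i + j : ℤ) * φ : ℝ) : UnitAddCircle))) ≠ [] := by
    rw [Filter.eventually_all_finset]
    intro j _
    exact (eventually_gl_eq hN₀ hN (h (i + j))).and (h (i + j)).suf_ne
  obtain ⟨n, hn⟩ := h1.exists
  set z : ℕ → ℝ := fun j => rep (x + (((i + j : ℤ) * φ : ℝ) : UnitAddCircle)) with hz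
  have hzs : ∀ j, z (j + 1) = step (z j) := by
    intro j
    simp only [hz]
    rw [← h.rep_add_one]
    push_cast
    ring_nf
  have h2 : ∀ j ≤ k, tau N n (z j) = tau N n (z 0) ∧ pos N n (z j) = pos N n (z 0) + j := by
    intro j hj
    induction j with
    | zero => simp
    | succ j ih =>
      obtain ⟨h3, h4⟩ := ih (by omega)
      obtain ⟨h5, h6⟩ := tau_step (h (i + j)).gen (hn j (by simp; omega)).2
      rw [hzs]
      refine ⟨h5.trans h3, h6.trans ?_⟩
      rw [show pos N n (rep (x + (((i + j : ℤ) * φ : ℝ) : UnitAddCircle))) =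
        pos N n (z 0) + j from h4, add_assoc]
  refine ⟨n, tau N n (z 0), ?_⟩
  have h3 : (List.ofFn fun j : Fin k => seq N x (i + (j : ℕ))) =
      ((superletter N n (tau N n (z 0))).drop (pos N n (z 0))).take k := by
    have hlen : ∀ j < k, pos N n (z 0) + j < (superletter N n (tau N n (z 0))).length := by
      intro j hj
      obtain ⟨h4, h5⟩ := h2 j hj.le
      rw [← h4, ← h5]
      exact pos_lt hN₀ hN (h (i + j)).gen n
    apply List.ext_getElem
    · simp
      rcases Nat.eq_zero_or_pos k with rfl | hk
      · simp
      · have := hlen (k - 1) (by omega)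
        omega
    · intro j hj1 hj2
      simp only [List.length_ofFn] at hj1
      simp only [List.getElem_ofFn, List.getElem_take, List.getElem_drop]
      rw [← (hn j (by simpa using hj1)).1, gl]
      obtain ⟨h4, h5⟩ := h2 j hj1.le
      rw [show tau N n (rep (x + (((i + j : ℤ) * φ : ℝ) : UnitAddCircle))) = tau N n (z 0) from h4,
        show pos N n (rep (x + (((i + j : ℤ) * φ : ℝ) : UnitAddCircle))) = pos N n (z 0) + j from h5,
        List.getD_eq_getElem _ _ (hlen j hj1)]
  rw [h3]
  exact (List.take_prefix _ _).isInfix.trans (List.drop_suffix _ _).isInfix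

theorem sequenceSpace_nonempty (hN₀ : N 0 = 0) (hN : StrictMono N)
    (hsum : Summable fun κ : {κ : ℕ // Odd κ} => (φ ^ gap N ((κ : ℕ) + 1))⁻¹) :
    (sequenceSpace N).Nonempty := by
  obtain ⟨x, hx⟩ := (ae_allGood hN hsum).exists
  exact ⟨_, seq_mem hN₀ hN hx⟩

/-! ### The transfer function -/

/-- Once type `e` has ceased to occur, the increment of level n is ψ^N(n) times a discrepancy
bounded by 2, so the increments are summable. -/
theorem tendsto_discTake (hN₀ : N 0 = 0) (hN : StrictMono N) {z : ℝ} (h : Good N z) :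
    ∃ l, Tendsto (fun n => discTake N n z) atTop (𝓝 l) := by
  obtain ⟨n₀, h₀⟩ := eventually_atTop.1 h.tau_ne
  have hp := Real.goldenRatio_pos
  have hψ0 : 0 ≤ |ψ| := abs_nonneg _
  have hψ : |ψ| < 1 := by
    rw [abs_psi]; exact inv_lt_one_of_one_lt₀ Real.one_lt_goldenRatio
  refine cauchySeq_tendsto_of_complete (cauchySeq_of_summable_dist ?_)
  rw [← summable_nat_add_iff n₀]
  refine Summable.of_nonneg_of_le (fun _ => dist_nonneg) (fun n => ?_)
    ((summable_geometric_of_lt_one hψ0 hψ).mul_left 2)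
  have h1 := discTake_succ hN₀ hN h.gen (n := n + n₀) (h₀ _ (by omega))
  have hg := gen_iterate_ren h.gen (N (n + n₀))
  have h2 : |disc (pre (gap N (n + n₀ + 1)) (ren^[N (n + n₀)] z))| ≤ 2 := by
    rw [disc_pre hg]
    have hg' := gen_iterate_ren hg (gap N (n + n₀ + 1))
    have h3 : ∀ w, Gen w → |w| ≤ 1 := fun w hw => by
      rw [abs_le]; constructor <;> linarith [hw.1, hw.2.1, phi_lower, phi_upper]
    have h4 : |ψ ^ gap N (n + n₀ + 1)| ≤ 1 := by
      rw [abs_pow]; exact pow_le_one₀ hψ0 hψ.le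
    refine (abs_sub _ _).trans ?_
    rw [abs_mul]
    have := h3 _ hg
    have := mul_le_mul h4 (h3 _ hg') (abs_nonneg _) zero_le_one
    linarith
  rw [Nat.succ_eq_add_one, dist_comm, Real.dist_eq, h1, add_sub_cancel_right, abs_mul, abs_pow]
  have h5 : |ψ| ^ N (n + n₀) ≤ |ψ| ^ n :=
    pow_le_pow_of_le_one hψ0 hψ.le (by have := hN.id_le (n + n₀); simp only [id] at this; omega)
  calc _ ≤ |ψ| ^ n * 2 := by gcongr
    _ = _ := by ring

/-- Modulo 1 the discrepancy depends only on the length of the word, and scrambled and unscrambled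
prefixes have equal length. -/
theorem coe_discTake (hN₀ : N 0 = 0) (hN : StrictMono N) {z : ℝ} (h : Gen z) (n : ℕ) :
    ((discTake N n z : ℝ) : UnitAddCircle) = ((z - ψ ^ N n * ren^[N n] z : ℝ) : UnitAddCircle) := by
  rw [← disc_pre h, discTake]
  obtain ⟨k, hk⟩ := disc_eq_int ((superletter N n (tau N n z)).take (pos N n z))
  obtain ⟨l, hl⟩ := disc_eq_int (pre (N n) z)
  rw [hk, hl, List.length_take, min_eq_left (pos_lt hN₀ hN h n).le, pos]
  have h1 : ∀ m : ℤ, ((m : ℝ) : UnitAddCircle) = 0 := fun m => by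
    have := AddCircle.coe_eq_zero_iff (1 : ℝ) (x := (m : ℝ))
    rw [this]
    exact ⟨m, by simp⟩
  rw [AddCircle.coe_add, AddCircle.coe_add, h1, h1]

/-- The transfer function: the limiting discrepancy. -/
theorem exists_transfer (hN₀ : N 0 = 0) (hN : StrictMono N)
    (hsum : Summable fun κ : {κ : ℕ // Odd κ} => (φ ^ gap N ((κ : ℕ) + 1))⁻¹) :
    ∃ h : UnitAddCircle → ℝ, Measurable h ∧
      (∀ᵐ x : UnitAddCircle, h (x + (φ : ℝ)) = h x + dval (seq N x 0)) ∧
      ∀ᵐ x : UnitAddCircle, (h x : UnitAddCircle) = x := by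
  have hlim : ∀ᵐ x : UnitAddCircle, ∃ l,
      Tendsto (fun n => discTake N n (rep x)) atTop (𝓝 l) := by
    filter_upwards [ae_allGood hN hsum] with x hx
    have := tendsto_discTake hN₀ hN (hx 0)
    simpa using this
  obtain ⟨h, hm, hh⟩ := exists_stronglyMeasurable_limit_of_tendsto_ae
    (fun n => ((measurable_discTake (N := N) n).comp measurable_rep).aestronglyMeasurable) hlim
  refine ⟨h, hm.measurable, ?_, ?_⟩
  · have hh' := (measurePreserving_add_right volume
      ((φ : ℝ) : UnitAddCircle)).quasiMeasurePreserving.ae hh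
    filter_upwards [hh, hh', ae_allGood hN hsum] with x h1 h2 h3
    have h30 : Good N (rep x) := by simpa using h3 0
    refine tendsto_nhds_unique h2 ((h1.add_const (dval (seq N x 0))).congr' ?_)
    have hs : seq N x 0 = glim N (rep x) := by simp [seq]
    filter_upwards [eventually_gl_eq hN₀ hN h30, h30.suf_ne] with n hn1 hn2
    rw [Function.comp_apply, Function.comp_apply, rep_add_phi h30.gen,
      discTake_step hN₀ hN h30.gen hn2, hn1, hs]
  · filter_upwards [hh, ae_gen_rep] with x h1 h2
    have hc : Continuous ((↑) : ℝ → UnitAddCircle) := AddCircle.continuous_mk' 1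
    have h3 := (hc.tendsto _).comp h1
    have h4 : Tendsto (fun n => rep x - ψ ^ N n * ren^[N n] (rep x)) atTop (𝓝 (rep x - 0)) := by
      refine tendsto_const_nhds.sub ?_
      refine squeeze_zero_norm (a := fun n => |ψ| ^ N n) (fun n => ?_) ?_
      · have hw := gen_iterate_ren h2 (N n)
        rw [norm_mul, norm_pow, Real.norm_eq_abs]
        refine mul_le_of_le_one_right (by positivity) ?_
        rw [Real.norm_eq_abs, abs_le]
        constructor <;> linarith [hw.1, hw.2.1, phi_lower, phi_upper]
      · refine (tendsto_pow_atTop_nhds_zero_of_lt_one (abs_nonneg _) ?_).comp hN.tendsto_atTop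
        rw [abs_psi]; exact inv_lt_one_of_one_lt₀ Real.one_lt_goldenRatio
    rw [sub_zero] at h4
    have h5 := (hc.tendsto _).comp h4
    rw [coe_rep] at h5
    refine tendsto_nhds_unique h3 (h5.congr fun n => ?_)
    exact (coe_discTake hN₀ hN h2 n).symm

end Circle

/-! ### Characters of the circle are functions of the scrambled sequence -/

section Descent

theorem ergodic_add_phi : Ergodic fun x : UnitAddCircle => x + (φ : ℝ) := by
  rw [AddCircle.ergodic_add_right, addOrderOf_eq_zero_iff,
    AddCircle.not_isOfFinAddOrder_iff_forall_rat_ne_div]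
  intro q hq
  rw [div_one] at hq
  exact Real.goldenRatio_irrational ⟨q, hq⟩

instance : IsProbabilityMeasure (volume : Measure UnitAddCircle) :=
  ⟨UnitAddCircle.measure_univ⟩

/-- Averages along the orbits of the golden rotation converge almost everywhere, along a
subsequence, to the mean. -/
theorem exists_tendsto_average {f : UnitAddCircle → ℂ} (hf : Measurable f)
    (hb : ∀ x, ‖f x‖ ≤ 1) :
    ∃ ns : ℕ → ℕ, ∀ᵐ x : UnitAddCircle, Tendsto
      (fun i => (ns i : ℂ)⁻¹ * ∑ j ∈ Finset.range (ns i), f (x + ((j * φ : ℝ) : UnitAddCircle)))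
      atTop (𝓝 (∫ x, f x)) := by
  have hm : MemLp f 2 (volume : Measure UnitAddCircle) :=
    MemLp.of_bound hf.aestronglyMeasurable 1 (ae_of_all _ hb)
  have hrot := ergodic_add_phi.toMeasurePreserving
  set U := Lp.compMeasurePreservingₗᵢ (p := 2) (E := ℂ) ℂ _ hrot with hU
  set F := hm.toLp f with hF
  have hUs : ∀ G : Lp ℂ 2 (volume : Measure UnitAddCircle), U G = Lp.compMeasurePreserving _ hrot G :=
    fun G => rfl
  -- The mean ergodic theorem suffices: the projection to invariant functions is constant by
  -- ergodicity, and L² convergence gives almost everywhere convergence along a subsequence.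
  have hlim := ContinuousLinearMap.tendsto_birkhoffAverage_orthogonalProjection
    U.toContinuousLinearMap U.norm_toContinuousLinearMap_le F
  set K := U.toContinuousLinearMap.eqLocus
    (1 : Lp ℂ 2 (volume : Measure UnitAddCircle) →L[ℂ] Lp ℂ 2 (volume : Measure UnitAddCircle)) with hK
  set G : Lp ℂ 2 (volume : Measure UnitAddCircle) := (K.orthogonalProjectionOnto F).val with hG
  have hGK : U G = G := (K.orthogonalProjectionOnto F).2
  have hGc : ∃ c, G =ᵐ[volume] fun _ => c := by
    refine ergodic_add_phi.ae_eq_const_of_ae_eq_comp_ae (Lp.aestronglyMeasurable G) ?_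
    have h1 := Lp.coeFn_compMeasurePreserving G hrot
    rw [← hUs, hGK] at h1
    exact h1.symm
  obtain ⟨c, hc⟩ := hGc
  have hone : MemLp (fun _ : UnitAddCircle => (1 : ℂ)) 2 volume := memLp_const 1
  -- The constant is identified by pairing the difference of the function and its projection with
  -- the invariant function 1.
  have hcint : c = ∫ x, f x := by
    have h1K : hone.toLp _ ∈ K := by
      change U (hone.toLp _) = hone.toLp _
      rw [hUs, Lp.toLp_compMeasurePreserving hone hrot]
      rfl
    have h2 : inner ℂ (hone.toLp _) (F - G) = 0 :=
      (Submodule.mem_orthogonal K _).1 (K.sub_starProjection_mem_orthogonal F) _ h1K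
    rw [inner_sub_right, sub_eq_zero, L2.inner_def, L2.inner_def] at h2
    have h3 : ∀ (H : Lp ℂ 2 (volume : Measure UnitAddCircle)) (k : UnitAddCircle → ℂ),
        H =ᵐ[volume] k → ∫ x, inner ℂ (hone.toLp _ x) (H x) = ∫ x, k x := by
      intro H k hk
      refine integral_congr_ae ?_
      filter_upwards [hk, hone.coeFn_toLp] with x h4 h5
      rw [h4, h5]
      simp
    rw [h3 F f hm.coeFn_toLp, h3 G _ hc] at h2
    rw [h2]
    simp
  have hit : ∀ j : ℕ, (U.toContinuousLinearMap^[j] F : UnitAddCircle → ℂ) =ᵐ[volume]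
      fun x => f (x + ((j * φ : ℝ) : UnitAddCircle)) := by
    intro j
    induction j with
    | zero => simpa using hm.coeFn_toLp
    | succ j ih =>
      rw [Function.iterate_succ_apply']
      have h1 := Lp.coeFn_compMeasurePreserving (U.toContinuousLinearMap^[j] F) hrot
      have h2 := hrot.quasiMeasurePreserving.ae ih
      filter_upwards [h1, h2] with x h3 h4
      change (Lp.compMeasurePreserving _ hrot (U.toContinuousLinearMap^[j] F)) x = _
      rw [h3, Function.comp_apply, h4, add_assoc, ← AddCircle.coe_add]
      push_cast
      ring_nf
  obtain ⟨ns, -, hns⟩ := (tendstoInMeasure_of_tendsto_Lp hlim).exists_seq_tendsto_ae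
  refine ⟨ns, ?_⟩
  have hav : ∀ n, ((birkhoffAverage ℂ U.toContinuousLinearMap _root_.id n F :
      Lp ℂ 2 (volume : Measure UnitAddCircle)) : UnitAddCircle → ℂ)
      =ᵐ[volume] fun x => (n : ℂ)⁻¹ * ∑ j ∈ Finset.range n, f (x + ((j * φ : ℝ) : UnitAddCircle)) := by
    intro n
    rw [birkhoffAverage, birkhoffSum]
    have h1 := Lp.coeFn_smul (n : ℂ)⁻¹
      (∑ k ∈ Finset.range n, _root_.id (U.toContinuousLinearMap^[k] F))
    have h2 : ((∑ k ∈ Finset.range n, _root_.id (U.toContinuousLinearMap^[k] F) :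
        Lp ℂ 2 (volume : Measure UnitAddCircle)) : UnitAddCircle → ℂ) =ᵐ[volume]
        fun x => ∑ j ∈ Finset.range n, f (x + ((j * φ : ℝ) : UnitAddCircle)) := by
      induction n with
      | zero => 
        simp only [Finset.range_zero, Finset.sum_empty]
        exact Lp.coeFn_zero ℂ 2 (volume : Measure UnitAddCircle)
      | succ n ih =>
        have ih := ih (Lp.coeFn_smul _ _)
        rw [Finset.sum_range_succ]
        filter_upwards [Lp.coeFn_add (∑ k ∈ Finset.range n, _root_.id
          (U.toContinuousLinearMap^[k] F)) (_root_.id (U.toContinuousLinearMap^[n] F)), ih, hit n]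
          with x h3 h4 h5
        rw [h3, Pi.add_apply, h4, Finset.sum_range_succ, ← h5]
        rfl
    filter_upwards [h1, h2] with x h3 h4
    rw [h3, Pi.smul_apply, h4, smul_eq_mul]
  filter_upwards [hns, hc, ae_all_iff.2 hav] with x h1 h2 h3
  rw [← hcint, ← h2]
  refine h1.congr fun i => ?_
  exact h3 (ns i)

variable {N : ℕ → ℕ}

/-- The sum of the discrepancies of the first `j` letters. -/
def discSum (j : ℕ) (ξ : ℤ → Letter) : ℝ := ∑ i ∈ Finset.range j, dval (ξ i)

theorem measurable_discSum (j : ℕ) : Measurable (discSum j) :=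
  Finset.measurable_fun_sum _ fun i _ =>
    (measurable_of_countable dval).comp (measurable_pi_apply (i : ℤ))

/-- The sequence determines h along the orbit up to the constant h(x). Averaging e(s h) along the
orbit gives a known non-zero constant, hence determines e(s h(x)); a power of this is e(h(x)) =
e(x). No injectivity of `seq` has to be proved. -/
theorem exists_descent (hN₀ : N 0 = 0) (hN : StrictMono N)
    (hsum : Summable fun κ : {κ : ℕ // Odd κ} => (φ ^ gap N ((κ : ℕ) + 1))⁻¹) :
    ∃ χ : (ℤ → Letter) → ℂ, Measurable χ ∧
      ∀ᵐ x : UnitAddCircle, χ (seq N x) = fourier 1 x := by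
  obtain ⟨h, hm, hstep, hcoe⟩ := exists_transfer hN₀ hN hsum
  set E : ℝ → ℝ → ℂ := fun s t => Complex.exp ((2 * Real.pi * (s * t) : ℝ) * Complex.I) with hE
  have hEc : ∀ s, Continuous (E s) := fun s => by
    simp only [hE]; fun_prop
  have hEn : ∀ s t, ‖E s t‖ = 1 := fun s t => Complex.norm_exp_ofReal_mul_I _
  have hEadd : ∀ s t u, E s (t + u) = E s t * E s u := fun s t u => by
    simp only [hE]; rw [← Complex.exp_add]; push_cast; ring_nf
  -- The integral of e(h) itself might vanish; for small s that of e(s h) is near 1. Taking s as a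
  -- reciprocal of an integer lets an integral power undo it.
  have hlim : Tendsto (fun m : ℕ => ∫ x : UnitAddCircle, E (1 / ((m : ℝ) + 1)) (h x)) atTop
      (𝓝 (∫ _ : UnitAddCircle, (1 : ℂ))) := by
    refine tendsto_integral_of_dominated_convergence (fun _ => (1 : ℝ))
      (fun m => ((hEc _).measurable.comp hm).aestronglyMeasurable) (integrable_const _)
      (fun m => ae_of_all _ fun x => (hEn _ _).le) (ae_of_all _ fun x => ?_)
    have h1 : Tendsto (fun m : ℕ => Complex.exp
        ((2 * Real.pi * (1 / ((m : ℝ) + 1) * h x) : ℝ) * Complex.I)) atTop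
        (𝓝 (Complex.exp ((2 * Real.pi * (0 * h x) : ℝ) * Complex.I))) := by
      have hc : Continuous fun s : ℝ => Complex.exp ((2 * Real.pi * (s * h x) : ℝ) * Complex.I) := by
        fun_prop
      exact (hc.tendsto 0).comp tendsto_one_div_add_atTop_nhds_zero_nat
    simpa [hE] using h1
  have hne : ∀ᶠ m : ℕ in atTop, ∫ x : UnitAddCircle, E (1 / ((m : ℝ) + 1)) (h x) ≠ 0 := by
    refine hlim.eventually_ne ?_
    simp
  obtain ⟨m, hm0⟩ := hne.exists
  set s : ℝ := 1 / ((m : ℝ) + 1) with hs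
  set c : ℂ := ∫ x : UnitAddCircle, E s (h x) with hc
  obtain ⟨ns, hns⟩ := exists_tendsto_average ((hEc s).measurable.comp hm) (fun x => (hEn _ _).le)
  set β : ℕ → (ℤ → Letter) → ℂ := fun i ξ =>
    (ns i : ℂ)⁻¹ * ∑ j ∈ Finset.range (ns i), E s (discSum j ξ) with hβ
  have hβm : ∀ i, StronglyMeasurable (β i) := fun i =>
    (Measurable.const_mul (Finset.measurable_fun_sum _ fun j _ =>
      (hEc s).measurable.comp (measurable_discSum j)) _).stronglyMeasurable
  refine ⟨fun ξ => (star (limUnder atTop (fun i => β i ξ) / c)) ^ (m + 1), ?_, ?_⟩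
  · have h1 : StronglyMeasurable fun ξ => limUnder atTop fun i => β i ξ :=
      StronglyMeasurable.limUnder hβm
    exact ((continuous_star.measurable.comp (h1.measurable.div_const c)).pow_const _)
  · have hsteps : ∀ᵐ x : UnitAddCircle, ∀ j : ℕ,
        h (x + ((j * φ : ℝ) : UnitAddCircle)) = h x + discSum j (seq N x) := by
      rw [ae_all_iff]
      intro j
      induction j with
      | zero => simp [discSum]
      | succ j ih =>
        have h2 := (measurePreserving_add_right volume
          ((j * φ : ℝ) : UnitAddCircle)).quasiMeasurePreserving.ae hstep
        filter_upwards [ih, h2] with x h3 h4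
        rw [discSum, Finset.sum_range_succ, ← discSum, ← add_assoc, ← h3]
        have h5 : seq N (x + ((j * φ : ℝ) : UnitAddCircle)) 0 = seq N x j := by
          have := congrFun (seq_add (N := N) x j) 0
          simpa using this
        rw [← h5, ← h4, add_assoc, ← AddCircle.coe_add]
        push_cast
        ring_nf
    filter_upwards [hns, hsteps, hcoe] with x h1 h2 h3
    -- The averages in `β` start from 0 instead of h(x), so they differ from the orbit averages by
    -- the factor conj e(s h(x)).
    have h4 : Tendsto (fun i => β i (seq N x)) atTop (𝓝 (star (E s (h x)) * c)) := by
      refine (h1.const_mul (star (E s (h x)))).congr fun i => ?_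
      simp only [hβ, Function.comp_apply]
      rw [mul_left_comm, Finset.mul_sum]
      congr 1
      refine Finset.sum_congr rfl fun j _ => ?_
      rw [h2, hEadd, ← mul_assoc]
      have : star (E s (h x)) * E s (h x) = 1 := by
        rw [Complex.star_def, ← Complex.normSq_eq_conj_mul_self, Complex.normSq_eq_norm_sq, hEn]
        simp
      rw [this, one_mul]
    rw [h4.limUnder_eq, mul_div_assoc, div_self hm0, mul_one, star_star]
    have h5 : (m + 1 : ℝ) * s = 1 := by rw [hs]; field_simp
    have h6 : E s (h x) ^ (m + 1) = E 1 (h x) := by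
      simp only [hE]
      rw [← Complex.exp_nat_mul]
      congr 1
      have h7 : ((m + 1 : ℕ) : ℂ) * s = 1 := by exact_mod_cast h5
      push_cast at h7 ⊢
      linear_combination (2 * Real.pi * h x * Complex.I) * h7
    rw [h6]
    conv_rhs => rw [← h3]
    rw [fourier_coe_apply]
    simp only [hE]
    congr 1
    push_cast
    ring

end Descent

/-! ### The tiling topology -/

namespace Pattern

variable {A : Type}

theorem mem_translate {T : Pattern A} {t x : ℝ} {o : A} :
    (x, o) ∈ (T.translate t).pts ↔ (x + t, o) ∈ T.pts := Iff.rfl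

theorem patch_eq_iff {T T' : Pattern A} {R : ℝ} : T.patch R = T'.patch R ↔
    ∀ x o, |x| ≤ R → ((x, o) ∈ T.pts ↔ (x, o) ∈ T'.pts) := by
  constructor
  · intro h x o hx
    have h1 : (x, o) ∈ T.patch R ↔ (x, o) ∈ T'.patch R := by rw [h]
    simpa [patch, hx] using h1
  · intro h
    ext ⟨x, o⟩
    simp only [patch, mem_ofPred_eq]
    constructor
    · rintro ⟨h1, h2⟩; exact ⟨(h x o h2).1 h1, h2⟩
    · rintro ⟨h1, h2⟩; exact ⟨(h x o h2).2 h1, h2⟩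

theorem close_iff {T T' : Pattern A} {ε : ℝ} : Close ε T T' ↔
    ∃ s : ℝ, |s| ≤ ε ∧ ∀ x o, |x| ≤ 1 / ε → ((x + s, o) ∈ T'.pts ↔ (x, o) ∈ T.pts) := by
  unfold Close
  simp only [patch_eq_iff, mem_translate]

theorem close_refl (T : Pattern A) {ε : ℝ} (hε : 0 ≤ ε) : Close ε T T :=
  close_iff.2 ⟨0, by simpa using hε, fun x o _ => by simp⟩

/-- A weak triangle inequality: the two translations add up, and the radius 1/δ is chosen at least
1/ε + 1 to absorb the first of them. -/
theorem exists_close_trans {ε : ℝ} (hε : 0 < ε) : ∃ δ > 0, ∀ T T' T'' : Pattern A,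
    Close δ T T' → Close δ T' T'' → Close ε T T'' := by
  have h1 : 0 < 1 / (1 / ε + 1) := by positivity
  refine ⟨min (min (ε / 2) 1) (1 / (1 / ε + 1)), by positivity, fun T T' T'' h h' => ?_⟩
  set δ := min (min (ε / 2) 1) (1 / (1 / ε + 1)) with hδ
  have hδ0 : 0 < δ := by positivity
  have hδ1 : δ ≤ ε / 2 := (min_le_left _ _).trans (min_le_left _ _)
  have hδ2 : δ ≤ 1 := (min_le_left _ _).trans (min_le_right _ _)
  have hδ3 : 1 / ε + 1 ≤ 1 / δ := by
    rw [le_one_div (by positivity) hδ0]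
    exact min_le_right _ _
  obtain ⟨s, hs, h⟩ := close_iff.1 h
  obtain ⟨s', hs', h'⟩ := close_iff.1 h'
  refine close_iff.2 ⟨s + s', (abs_add_le _ _).trans (by linarith), fun x o hx => ?_⟩
  rw [← add_assoc, h' _ _ ((abs_add_le _ _).trans (by linarith)), h _ _ (by linarith)]

/-- The topology is given by its open sets, so it is not automatic that `Close`-balls are
neighbourhoods; the set of points with a ball inside U is open by `exists_close_trans`. -/
theorem mem_nhds_iff {T : Pattern A} {U : Set (Pattern A)} :
    U ∈ 𝓝 T ↔ ∃ ε > 0, ∀ T', Close ε T T' → T' ∈ U := by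
  rw [_root_.mem_nhds_iff]
  constructor
  · rintro ⟨V, hVU, hV, hT⟩
    obtain ⟨ε, hε, h⟩ := hV T hT
    exact ⟨ε, hε, fun T' h' => hVU (h T' h')⟩
  · rintro ⟨ε, hε, h⟩
    refine ⟨{T' | ∃ δ > 0, ∀ T'', Close δ T' T'' → T'' ∈ U}, ?_, ?_, ⟨ε, hε, h⟩⟩
    · rintro T' ⟨δ, hδ, h'⟩
      exact h' T' (close_refl T' hδ.le)
    · rintro T' ⟨δ, hδ, h'⟩
      obtain ⟨δ', hδ', htr⟩ := exists_close_trans (A := A) hδ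
      exact ⟨δ', hδ', fun T'' h'' => ⟨δ', hδ', fun T₃ h₃ => h' T₃ (htr _ _ _ h'' h₃)⟩⟩

theorem nhds_hasBasis (T : Pattern A) :
    (𝓝 T).HasBasis (fun ε : ℝ => 0 < ε) fun ε => {T' | Close ε T T'} :=
  ⟨fun _ => mem_nhds_iff⟩

/-- The patterns with a point with label `y` in an open set form an open set. -/
theorem isOpen_hit {O : Set ℝ} (hO : IsOpen O) (y : A) :
    IsOpen {T : Pattern A | ∃ p ∈ O, (p, y) ∈ T.pts} := by
  rw [isOpen_iff_mem_nhds]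
  rintro T ⟨p, hp, hT⟩
  obtain ⟨ε, hε, h⟩ := Metric.isOpen_iff.1 hO p hp
  have h1 : 0 < 1 / (|p| + 1) := by positivity
  refine mem_nhds_iff.2 ⟨min (ε / 2) (1 / (|p| + 1)), by positivity, fun T' hc => ?_⟩
  set δ := min (ε / 2) (1 / (|p| + 1)) with hδ
  have hδ0 : 0 < δ := by positivity
  have hδ3 : |p| + 1 ≤ 1 / δ := by
    rw [le_one_div (by positivity) hδ0]
    exact min_le_right _ _
  obtain ⟨s, hs, h'⟩ := close_iff.1 hc
  refine ⟨p + s, h ?_, (h' p y (by linarith)).2 hT⟩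
  rw [Metric.mem_ball, Real.dist_eq, add_sub_cancel_left]
  have : δ ≤ ε / 2 := min_le_left _ _
  linarith

end Pattern

/-! ### Tilings with unit tiles -/

section Tilings

open Pattern

/-- The tiling with unit tiles and label sequence `ξ`, translated by `t`. -/
def tl (ξ : ℤ → Letter) (t : ℝ) : Pattern Letter := (suspension 1 1 ξ).translate t

theorem leftEndpoint_one (ξ : ℤ → Letter) (n : ℤ) : leftEndpoint 1 1 ξ n = n := by
  have h : ∀ x, tileLength 1 1 x = 1 := fun x => by cases x <;> rfl
  cases n with
  | ofNat n => simp [leftEndpoint, h]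
  | negSucc n => simp [leftEndpoint, h, Int.cast_negSucc]

theorem mem_tl {ξ : ℤ → Letter} {t x : ℝ} {o : Letter} :
    (x, o) ∈ (tl ξ t).pts ↔ ∃ n : ℤ, (n : ℝ) = x + t ∧ ξ n = o := by
  rw [tl, mem_translate, suspension]
  simp [leftEndpoint_one]

theorem tl_shift (ξ : ℤ → Letter) (k : ℤ) (t : ℝ) : tl (shift k ξ) t = tl ξ (t + k) := by
  ext ⟨x, o⟩
  rw [mem_tl, mem_tl]
  constructor
  · rintro ⟨n, h1, h2⟩
    exact ⟨n + k, by push_cast; rw [h1]; ring, h2⟩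
  · rintro ⟨n, h1, h2⟩
    exact ⟨n - k, by push_cast; rw [h1]; ring, by simpa using h2⟩

theorem translate_tl (ξ : ℤ → Letter) (t s : ℝ) : (tl ξ t).translate s = tl ξ (t + s) := by
  ext ⟨x, o⟩
  rw [mem_translate, mem_tl, mem_tl, add_assoc, add_comm s t]

theorem tl_inj {ξ ξ' : ℤ → Letter} {s s' : ℝ} (hs : s ∈ Ico (0 : ℝ) 1) (hs' : s' ∈ Ico (0 : ℝ) 1)
    (h : tl ξ s = tl ξ' s') : s = s' ∧ ξ = ξ' := by
  have key : ∀ n : ℤ, ∃ m : ℤ, (m : ℝ) = n - s + s' ∧ ξ' m = ξ n := by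
    intro n
    have h1 : ((n : ℝ) - s, ξ n) ∈ (tl ξ s).pts := mem_tl.2 ⟨n, by ring, rfl⟩
    rw [h] at h1
    exact mem_tl.1 h1
  have hss : s = s' := by
    obtain ⟨m, hm, -⟩ := key 0
    have h1 : (m : ℝ) < 1 := by rw [hm]; push_cast; linarith [hs.1, hs'.2]
    have h2 : (-1 : ℝ) < m := by rw [hm]; push_cast; linarith [hs.2, hs'.1]
    have h3 : m = 0 := by
      have h1 : m < 1 := by exact_mod_cast h1
      have h2 : -1 < m := by exact_mod_cast h2
      omega
    rw [h3] at hm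
    push_cast at hm
    linarith
  refine ⟨hss, funext fun n => ?_⟩
  obtain ⟨m, hm, h1⟩ := key n
  have : m = n := by
    have : (m : ℝ) = n := by rw [hm, hss]; ring
    exact_mod_cast this
  rw [← h1, this]

instance : TopologicalSpace Letter := ⊥

instance : DiscreteTopology Letter := ⟨rfl⟩

instance : BorelSpace Letter := ⟨borel_eq_top_of_discrete.symm⟩

variable {N : ℕ → ℕ}

theorem tl_mem {ξ : ℤ → Letter} (hξ : ξ ∈ sequenceSpace N) (t : ℝ) : tl ξ t ∈ tilingSpace N 1 1 :=
  ⟨ξ, hξ, t, rfl⟩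

theorem exists_eq_tl {T : Pattern Letter} (hT : T ∈ tilingSpace N 1 1) :
    ∃ ξ ∈ sequenceSpace N, ∃ s ∈ Ico (0 : ℝ) 1, T = tl ξ s := by
  obtain ⟨ξ, hξ, t, rfl⟩ := hT
  refine ⟨shift ⌊t⌋ ξ, shift_mem_sequenceSpace hξ _, Int.fract t,
    ⟨Int.fract_nonneg t, Int.fract_lt_one t⟩, ?_⟩
  rw [tl_shift, Int.fract_add_floor]
  rfl

/-- The label sequence of a tiling, the tile `0` containing the origin. -/
def labels (T : tilingSpace N 1 1) : ℤ → Letter := (exists_eq_tl T.2).choose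

theorem labels_mem (T : tilingSpace N 1 1) : labels T ∈ sequenceSpace N :=
  (exists_eq_tl T.2).choose_spec.1

/-- The distance of the origin from the left endpoint of its tile. -/
def offset (T : tilingSpace N 1 1) : ℝ := (exists_eq_tl T.2).choose_spec.2.choose

theorem offset_mem (T : tilingSpace N 1 1) : offset T ∈ Ico (0 : ℝ) 1 :=
  (exists_eq_tl T.2).choose_spec.2.choose_spec.1

theorem eq_tl (T : tilingSpace N 1 1) : (T : Pattern Letter) = tl (labels T) (offset T) :=
  (exists_eq_tl T.2).choose_spec.2.choose_spec.2

theorem labels_eq {T : tilingSpace N 1 1} {ξ : ℤ → Letter} {s : ℝ} (hs : s ∈ Ico (0 : ℝ) 1)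
    (h : (T : Pattern Letter) = tl ξ s) : labels T = ξ ∧ offset T = s := by
  obtain ⟨h1, h2⟩ := tl_inj (offset_mem T) hs ((eq_tl T).symm.trans h)
  exact ⟨h2, h1⟩

/-- The offset of a tiling as a point of the circle. -/
def phase (T : tilingSpace N 1 1) : UnitAddCircle := (offset T : UnitAddCircle)

theorem coe_int (k : ℤ) : ((k : ℝ) : UnitAddCircle) = 0 :=
  (AddCircle.coe_eq_zero_iff (1 : ℝ) (x := (k : ℝ))).2 ⟨k, by simp⟩

theorem phase_of_mem {T : tilingSpace N 1 1} {p : ℝ} {o : Letter}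
    (h : (p, o) ∈ (T : Pattern Letter).pts) : phase T = ((-p : ℝ) : UnitAddCircle) := by
  rw [eq_tl T] at h
  obtain ⟨n, hn, -⟩ := mem_tl.1 h
  rw [phase, show offset T = n + -p by rw [hn]; ring, AddCircle.coe_add, coe_int, zero_add]

theorem exists_mem (T : tilingSpace N 1 1) :
    ∃ p o, |p| ≤ 1 ∧ (p, o) ∈ (T : Pattern Letter).pts := by
  refine ⟨-offset T, labels T 0, ?_, ?_⟩
  · rw [abs_neg, abs_of_nonneg (offset_mem T).1]; exact (offset_mem T).2.le
  · rw [eq_tl T]; exact mem_tl.2 ⟨0, by simp, rfl⟩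

/-- All left endpoints lie in one coset of ℤ, so the phase can be read off from any tile near the
origin. The offset itself jumps when an endpoint crosses the origin; its class in the circle does
not. -/
theorem continuous_phase : Continuous (phase (N := N)) := by
  rw [continuous_iff_continuousAt]
  intro T
  rw [Metric.continuousAt_iff']
  intro ε hε
  rw [nhds_subtype_eq_comap, ((nhds_hasBasis T.1).comap _).eventually_iff]
  refine ⟨min (ε / 2) 1, by positivity, fun T' hT' => ?_⟩
  obtain ⟨s, hs, h⟩ := close_iff.1 hT'
  obtain ⟨p, o, hp, hpo⟩ := exists_mem T
  have h1 : 1 ≤ 1 / min (ε / 2) 1 := by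
    rw [le_one_div one_pos (by positivity)]; simp
  rw [phase_of_mem hpo, phase_of_mem ((h p o (hp.trans h1)).2 hpo), dist_eq_norm,
    ← AddCircle.coe_sub]
  have : -(p + s) - -p = -s := by ring
  rw [this]
  have h2 : ‖((-s : ℝ) : UnitAddCircle)‖ ≤ |s| := by
    rw [UnitAddCircle.norm_eq, ← abs_neg s]
    simpa using round_le (-s) 0
  calc _ ≤ |s| := h2
    _ ≤ ε / 2 := hs.trans (min_le_left _ _)
    _ < ε := by linarith

theorem coe_flow (t : ℝ) (T : tilingSpace N 1 1) :
    (flow N 1 1 t T : Pattern Letter) = (T : Pattern Letter).translate t := rfl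

theorem phase_flow (t : ℝ) (T : tilingSpace N 1 1) : phase (flow N 1 1 t T) = phase T + (t : ℝ) := by
  obtain ⟨p, o, -, h⟩ := exists_mem T
  have h1 : (p - t, o) ∈ (flow N 1 1 t T : Pattern Letter).pts := by
    rw [coe_flow, mem_translate]; simpa using h
  rw [phase_of_mem h, phase_of_mem h1, ← AddCircle.coe_add]
  congr 1
  ring

theorem labels_flow_int (k : ℤ) (T : tilingSpace N 1 1) :
    labels (flow N 1 1 k T) = shift k (labels T) ∧ offset (flow N 1 1 k T) = offset T := by
  refine labels_eq (offset_mem T) ?_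
  rw [coe_flow, eq_tl T, translate_tl, tl_shift]

/-- The tiling with given labels and translation. -/
def mkTiling (p : sequenceSpace N × ℝ) : tilingSpace N 1 1 := ⟨tl p.1 p.2, tl_mem p.1.2 p.2⟩

theorem continuous_mkTiling : Continuous (mkTiling (N := N)) := by
  rw [continuous_iff_continuousAt]
  rintro ⟨ξ, t⟩
  rw [ContinuousAt, nhds_subtype_eq_comap, tendsto_comap_iff,
    (nhds_hasBasis _).tendsto_right_iff]
  intro ε hε
  obtain ⟨K, hK⟩ := exists_nat_ge (1 / ε + |t|)
  have h1 : ∀ᶠ p : sequenceSpace N × ℝ in 𝓝 (ξ, t), |p.2 - t| < ε := by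
    have : Continuous fun p : sequenceSpace N × ℝ => |p.2 - t| := by fun_prop
    refine this.continuousAt.eventually_lt_const ?_
    simpa using hε
  have h2 : ∀ᶠ p : sequenceSpace N × ℝ in 𝓝 (ξ, t),
      ∀ j ∈ Finset.Icc (-K : ℤ) K, (p.1 : ℤ → Letter) j = ξ.1 j := by
    rw [Filter.eventually_all_finset]
    intro j _
    have : Continuous fun p : sequenceSpace N × ℝ => (p.1 : ℤ → Letter) j :=
      (continuous_apply j).comp (continuous_subtype_val.comp continuous_fst)
    exact (this.continuousAt (x := (ξ, t))).preimage_mem_nhds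
      ((isOpen_discrete {ξ.1 j}).mem_nhds (mem_singleton _))
  filter_upwards [h1, h2] with p hp1 hp2
  refine close_iff.2 ⟨t - p.2, by rw [abs_sub_comm]; exact hp1.le, fun x o hx => ?_⟩
  simp only [Function.comp_apply, mkTiling]
  rw [mem_tl, mem_tl, add_assoc, sub_add_cancel]
  refine exists_congr fun n => and_congr_right fun hn => ?_
  rw [hp2 n]
  have h3 : |(n : ℝ)| ≤ K := by
    rw [hn]; exact (abs_add_le _ _).trans (by linarith)
  rw [abs_le] at h3
  rw [Finset.mem_Icc]
  constructor
  · exact_mod_cast h3.1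
  · exact_mod_cast h3.2

theorem measurable_mkTiling : Measurable (mkTiling (N := N)) := continuous_mkTiling.measurable

theorem measurable_phase : Measurable (phase (N := N)) := continuous_phase.measurable

/-- Tile j begins at j - offset: in the open interval (j - 1, j) if the offset is non-zero, exactly
at j if it is 0. The latter is a countable intersection of open conditions, which explains the two
parts of the set. -/
theorem measurable_labels : Measurable (labels (N := N)) := by
  refine measurable_pi_lambda _ fun j => measurable_to_countable' fun y => ?_
  have h1 : (fun T : tilingSpace N 1 1 => labels T j) ⁻¹' {y} =
      {T : tilingSpace N 1 1 | ∃ p ∈ Ioo ((j : ℝ) - 1) j, (p, y) ∈ (T : Pattern Letter).pts} ∪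
      ⋂ k : ℕ, {T : tilingSpace N 1 1 | ∃ p ∈ Ioo ((j : ℝ) - 1 / (k + 1)) (j + 1 / (k + 1)),
        (p, y) ∈ (T : Pattern Letter).pts} := by
    ext T
    have hs := offset_mem T
    simp only [mem_preimage, mem_singleton_iff, mem_union, mem_ofPred_eq, mem_iInter]
    rw [eq_tl T]
    simp only [mem_tl]
    constructor
    · intro h
      rcases eq_or_lt_of_le hs.1 with h0 | h0
      · right
        intro k
        have hk : (0 : ℝ) < 1 / (k + 1) := by positivity
        exact ⟨j, ⟨by linarith, by linarith⟩, j, by rw [← h0]; ring, h⟩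
      · left
        exact ⟨j - offset T, ⟨by linarith [hs.2], by linarith⟩, j, by ring, h⟩
    · rintro (⟨p, hp, n, hn, h⟩ | h)
      · have h1 : (n : ℝ) < j + 1 := by rw [hn]; linarith [hp.2, hs.2]
        have h2 : (j - 1 : ℝ) < n := by rw [hn]; linarith [hp.1, hs.1]
        have h1 : n < j + 1 := by exact_mod_cast h1
        have h2 : j - 1 < n := by exact_mod_cast h2
        rw [← h, show n = j by omega]
      · rcases eq_or_lt_of_le hs.1 with h0 | h0
        · obtain ⟨p, hp, n, hn, h⟩ := h 0
          rw [← h0] at hn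
          simp at hp
          have h1 : (n : ℝ) < j + 1 := by rw [hn]; linarith [hp.2]
          have h2 : (j - 1 : ℝ) < n := by rw [hn]; linarith [hp.1]
          have h1 : n < j + 1 := by exact_mod_cast h1
          have h2 : j - 1 < n := by exact_mod_cast h2
          rw [← h, show n = j by omega]
        · exfalso
          obtain ⟨k, hk⟩ := exists_nat_one_div_lt (show 0 < min (offset T) (1 - offset T) from
            lt_min h0 (by linarith [hs.2]))
          obtain ⟨hk1, hk2⟩ := lt_min_iff.1 hk
          obtain ⟨p, hp, n, hn, -⟩ := h k
          have h1 : (n : ℝ) < j + 1 := by rw [hn]; linarith [hp.2]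
          have h2 : (j : ℝ) < n := by rw [hn]; linarith [hp.1]
          have h1 : n < j + 1 := by exact_mod_cast h1
          have h2 : j < n := by exact_mod_cast h2
          omega
  rw [h1]
  refine MeasurableSet.union ?_ (MeasurableSet.iInter fun k => ?_)
  · exact ((isOpen_hit isOpen_Ioo y).preimage continuous_subtype_val).measurableSet
  · exact ((isOpen_hit isOpen_Ioo y).preimage continuous_subtype_val).measurableSet

end Tilings

/-! ### The invariant measure -/

section Measure

variable {N : ℕ → ℕ}

/-- The representative of a point of the circle in `[0, 1)`. -/
def rep0 (θ : UnitAddCircle) : ℝ := AddCircle.equivIco 1 0 θ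

theorem coe_rep0 (θ : UnitAddCircle) : (rep0 θ : UnitAddCircle) = θ := AddCircle.coe_equivIco

theorem rep0_mem (θ : UnitAddCircle) : rep0 θ ∈ Ico (0 : ℝ) 1 := by
  have h := (AddCircle.equivIco 1 0 θ).2
  exact ⟨h.1, by have := h.2; unfold rep0; linarith⟩

theorem rep0_coe {s : ℝ} (hs : s ∈ Ico (0 : ℝ) 1) : rep0 (s : UnitAddCircle) = s :=
  AddCircle.equivIco_coe_of_mem (p := (1 : ℝ)) ⟨hs.1, by linarith [hs.2]⟩

theorem measurable_rep0 : Measurable rep0 :=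
  measurable_subtype_coe.comp (AddCircle.measurableEquivIco 1 0).measurable

theorem rep0_phase (T : tilingSpace N 1 1) : rep0 (phase T) = offset T := rep0_coe (offset_mem T)

theorem exists_int_of_coe_eq {x y : ℝ} (h : (x : UnitAddCircle) = (y : UnitAddCircle)) :
    ∃ m : ℤ, y = x + m := by
  have h1 : ((y - x : ℝ) : UnitAddCircle) = 0 := by rw [AddCircle.coe_sub, h, sub_self]
  obtain ⟨m, hm⟩ := (AddCircle.coe_eq_zero_iff (1 : ℝ)).1 h1
  exact ⟨m, by simp at hm; linarith⟩

theorem mkTiling_labels (T : tilingSpace N 1 1) :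
    mkTiling (⟨labels T, labels_mem T⟩, rep0 (phase T)) = T := by
  apply Subtype.ext
  rw [rep0_phase]
  exact (eq_tl T).symm

theorem measurable_flow (t : ℝ) : Measurable (flow N 1 1 t) := by
  have h : flow N 1 1 t = fun T => mkTiling (⟨labels T, labels_mem T⟩, rep0 (phase T) + t) := by
    funext T
    apply Subtype.ext
    rw [coe_flow, rep0_phase]
    simp only [mkTiling]
    rw [← translate_tl, ← eq_tl]
  rw [h]
  exact measurable_mkTiling.comp ((measurable_labels.subtype_mk).prodMk
    ((measurable_rep0.comp measurable_phase).add_const t))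

theorem measurableSet_sequenceSpace : MeasurableSet (sequenceSpace N) := by
  have h : sequenceSpace N = ⋂ (i : ℤ) (k : ℕ), ⋃ (n : ℕ) (x : Letter),
      (fun (ξ : ℤ → Letter) (j : Fin k) => ξ (i + (j : ℕ))) ⁻¹'
        {w | List.ofFn w <:+: superletter N n x} := by
    ext ξ
    simp [sequenceSpace]
  rw [h]
  refine MeasurableSet.iInter fun i => MeasurableSet.iInter fun k => MeasurableSet.iUnion fun n =>
    MeasurableSet.iUnion fun x => ?_
  exact measurable_pi_lambda _ (fun j => measurable_pi_apply _) (Set.toFinite _).measurableSet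

open Classical in
/-- A retraction to the sequence space. -/
def retract (ξ₀ : sequenceSpace N) (ξ : ℤ → Letter) : sequenceSpace N :=
  if h : ξ ∈ sequenceSpace N then ⟨ξ, h⟩ else ξ₀

theorem retract_of_mem (ξ₀ : sequenceSpace N) {ξ : ℤ → Letter} (h : ξ ∈ sequenceSpace N) :
    retract ξ₀ ξ = ⟨ξ, h⟩ := dif_pos h

open Classical in
theorem measurable_retract (ξ₀ : sequenceSpace N) : Measurable (retract ξ₀) := by
  have h : (fun ξ => (retract ξ₀ ξ : ℤ → Letter)) =
      fun ξ => if ξ ∈ sequenceSpace N then ξ else ξ₀ := by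
    funext ξ
    unfold retract
    split_ifs <;> rfl
  have h1 : Measurable fun ξ => (retract ξ₀ ξ : ℤ → Letter) := by
    rw [h]
    exact Measurable.ite measurableSet_sequenceSpace measurable_id measurable_const
  exact h1.subtype_mk

/-- The tiling with given phase and labels. -/
def assemble (ξ₀ : sequenceSpace N) (p : UnitAddCircle × (ℤ → Letter)) : tilingSpace N 1 1 :=
  mkTiling (retract ξ₀ p.2, rep0 p.1)

theorem measurable_assemble (ξ₀ : sequenceSpace N) : Measurable (assemble ξ₀) :=
  measurable_mkTiling.comp (((measurable_retract ξ₀).comp measurable_snd).prodMk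
    (measurable_rep0.comp measurable_fst))

theorem assemble_phase_labels (ξ₀ : sequenceSpace N) (T : tilingSpace N 1 1) :
    assemble ξ₀ (phase T, labels T) = T := by
  rw [assemble, retract_of_mem ξ₀ (labels_mem T)]
  exact mkTiling_labels T

theorem assemble_of_mem (ξ₀ : sequenceSpace N) (θ : UnitAddCircle) {ξ : ℤ → Letter}
    (h : ξ ∈ sequenceSpace N) : phase (assemble ξ₀ (θ, ξ)) = θ ∧ labels (assemble ξ₀ (θ, ξ)) = ξ ∧
      (assemble ξ₀ (θ, ξ) : Pattern Letter) = tl ξ (rep0 θ) := by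
  have h1 : (assemble ξ₀ (θ, ξ) : Pattern Letter) = tl ξ (rep0 θ) := by
    rw [assemble, retract_of_mem ξ₀ h]; rfl
  obtain ⟨h2, h3⟩ := labels_eq (rep0_mem θ) h1
  exact ⟨by rw [phase, h3, coe_rep0], h2, h1⟩

/-- The almost everywhere defined parametrization of the tiling space by the torus. -/
def param (ξ₀ : sequenceSpace N) (p : UnitAddCircle × UnitAddCircle) : tilingSpace N 1 1 :=
  assemble ξ₀ (p.1, seq N (p.2 + ((-(rep0 p.1 * φ) : ℝ) : UnitAddCircle)))

/-- The good points of the torus. -/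
def TorusGood (N : ℕ → ℕ) (p : UnitAddCircle × UnitAddCircle) : Prop :=
  AllGood N (p.2 + ((-(rep0 p.1 * φ) : ℝ) : UnitAddCircle))

theorem measurePreserving_skew : MeasurePreserving
    (fun p : UnitAddCircle × UnitAddCircle =>
      (p.1, p.2 + ((-(rep0 p.1 * φ) : ℝ) : UnitAddCircle))) volume volume := by
  refine (MeasurePreserving.id volume).skew_product (μc := volume) (μd := volume)
    (g := fun θ y => y + ((-(rep0 θ * φ) : ℝ) : UnitAddCircle)) ?_ ?_
  · have : Measurable fun x : ℝ => (x : UnitAddCircle) := AddCircle.measurable_mk'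
    exact measurable_snd.add (this.comp ((measurable_rep0.comp measurable_fst).mul_const _).neg)
  · exact Eventually.of_forall fun θ => (measurePreserving_add_right volume _).map_eq

theorem ae_torusGood (hN : StrictMono N) (hsum : Summable fun κ : {κ : ℕ // Odd κ} =>
    (φ ^ gap N ((κ : ℕ) + 1))⁻¹) : ∀ᵐ p : UnitAddCircle × UnitAddCircle, TorusGood N p := by
  have h : ∀ᵐ p : UnitAddCircle × UnitAddCircle, AllGood N p.2 :=
    Measure.quasiMeasurePreserving_snd.ae (ae_allGood hN hsum)
  exact measurePreserving_skew.quasiMeasurePreserving.ae h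

theorem measurable_param (ξ₀ : sequenceSpace N) : Measurable (param ξ₀) :=
  (measurable_assemble ξ₀).comp (measurable_fst.prodMk
    (measurable_seq.comp (measurable_snd.comp measurePreserving_skew.measurable)))

theorem phase_param (hN₀ : N 0 = 0) (hN : StrictMono N) (ξ₀ : sequenceSpace N)
    {p : UnitAddCircle × UnitAddCircle} (h : TorusGood N p) : phase (param ξ₀ p) = p.1 :=
  (assemble_of_mem ξ₀ p.1 (seq_mem hN₀ hN h)).1

theorem labels_param (hN₀ : N 0 = 0) (hN : StrictMono N) (ξ₀ : sequenceSpace N)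
    {p : UnitAddCircle × UnitAddCircle} (h : TorusGood N p) :
    labels (param ξ₀ p) = seq N (p.2 + ((-(rep0 p.1 * φ) : ℝ) : UnitAddCircle)) :=
  (assemble_of_mem ξ₀ p.1 (seq_mem hN₀ hN h)).2.1

theorem AllGood.add {x : UnitAddCircle} (h : AllGood N x) (k : ℤ) :
    AllGood N (x + ((k * φ : ℝ) : UnitAddCircle)) := by
  intro j
  have := h (k + j)
  rw [add_assoc, ← AddCircle.coe_add]
  convert this using 4
  push_cast
  ring

/-- The integer m counts the tile boundaries crossed in time t. Flowing by t shifts the base point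
of the label sequence by m rotations. -/
theorem exists_skew_add (p : UnitAddCircle × UnitAddCircle) (t : ℝ) : ∃ m : ℤ,
    rep0 p.1 + t = rep0 (p.1 + (t : UnitAddCircle)) + m ∧
    (p.2 + ((t * φ : ℝ) : UnitAddCircle)) +
      ((-(rep0 (p.1 + (t : UnitAddCircle)) * φ) : ℝ) : UnitAddCircle) =
    (p.2 + ((-(rep0 p.1 * φ) : ℝ) : UnitAddCircle)) + ((m * φ : ℝ) : UnitAddCircle) := by
  obtain ⟨m, hm⟩ := exists_int_of_coe_eq (x := rep0 (p.1 + (t : UnitAddCircle)))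
    (y := rep0 p.1 + t) (by rw [coe_rep0, AddCircle.coe_add, coe_rep0])
  refine ⟨m, hm, ?_⟩
  rw [add_assoc, add_assoc, ← AddCircle.coe_add, ← AddCircle.coe_add]
  congr 2
  linear_combination φ * hm

/-- The shear by -θφ in `param` straightens the suspension of the rotation into the linear flow on
the torus with direction (1, φ). -/
theorem flow_param (hN₀ : N 0 = 0) (hN : StrictMono N) (ξ₀ : sequenceSpace N)
    {p : UnitAddCircle × UnitAddCircle} (h : TorusGood N p) (t : ℝ) :
    flow N 1 1 t (param ξ₀ p) =
      param ξ₀ (p + ((t : UnitAddCircle), ((t * φ : ℝ) : UnitAddCircle))) := by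
  obtain ⟨m, h1, h2⟩ := exists_skew_add p t
  have h3 : AllGood N ((p + ((t : UnitAddCircle), ((t * φ : ℝ) : UnitAddCircle))).2 +
      ((-(rep0 (p + ((t : UnitAddCircle), ((t * φ : ℝ) : UnitAddCircle))).1 * φ) : ℝ) :
        UnitAddCircle)) := by
    rw [Prod.snd_add, Prod.fst_add, h2]
    exact h.add m
  apply Subtype.ext
  rw [coe_flow, param, (assemble_of_mem ξ₀ _ (seq_mem hN₀ hN h)).2.2, param,
    (assemble_of_mem ξ₀ _ (seq_mem hN₀ hN h3)).2.2, translate_tl, Prod.snd_add, Prod.fst_add, h2,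
    seq_add, tl_shift, h1]

/-- The invariant measure. -/
def tilingMeasure (ξ₀ : sequenceSpace N) : Measure (tilingSpace N 1 1) :=
  Measure.map (param ξ₀) volume

theorem measurePreserving_param (ξ₀ : sequenceSpace N) :
    MeasurePreserving (param ξ₀) volume (tilingMeasure ξ₀) :=
  ⟨measurable_param ξ₀, rfl⟩

instance (ξ₀ : sequenceSpace N) : IsProbabilityMeasure (tilingMeasure ξ₀) :=
  Measure.isProbabilityMeasure_map (measurable_param ξ₀).aemeasurable

theorem measurePreserving_torus (v : UnitAddCircle × UnitAddCircle) :
    MeasurePreserving (fun p : UnitAddCircle × UnitAddCircle => p + v) volume volume :=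
  (measurePreserving_add_right volume v.1).prod (measurePreserving_add_right volume v.2)

theorem isInvariantProbability_tilingMeasure (hN₀ : N 0 = 0) (hN : StrictMono N)
    (hsum : Summable fun κ : {κ : ℕ // Odd κ} => (φ ^ gap N ((κ : ℕ) + 1))⁻¹)
    (ξ₀ : sequenceSpace N) : IsInvariantProbability (flow N 1 1) (tilingMeasure ξ₀) := by
  refine ⟨inferInstance, fun t => ⟨measurable_flow t, ?_⟩⟩
  have h1 : flow N 1 1 t ∘ param ξ₀ =ᵐ[volume]
      param ξ₀ ∘ fun p => p + ((t : UnitAddCircle), ((t * φ : ℝ) : UnitAddCircle)) := by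
    filter_upwards [ae_torusGood hN hsum] with p hp using flow_param hN₀ hN ξ₀ hp t
  rw [tilingMeasure, Measure.map_map (measurable_flow t) (measurable_param ξ₀),
    Measure.map_congr h1, ← Measure.map_map (measurable_param ξ₀)
      (measurePreserving_torus _).measurable, (measurePreserving_torus _).map_eq]

end Measure

/-! ### Unique ergodicity -/

section Uniqueness

variable {N : ℕ → ℕ}

theorem labels_flow_natCast (j : ℕ) (T : tilingSpace N 1 1) :
    labels (flow N 1 1 (j : ℝ) T) = shift (j : ℤ) (labels T) := by
  exact_mod_cast (labels_flow_int (j : ℤ) T).1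

theorem phase_flow_natCast (j : ℕ) (T : tilingSpace N 1 1) :
    phase (flow N 1 1 (j : ℝ) T) = phase T := by
  rw [phase_flow]
  simpa using coe_int (j : ℤ)

/-- For an invariant probability measure, labels and phase are independent, and the frequencies of
local patterns are the uniform ones. -/
theorem measure_real_phase_labels {ν : Measure (tilingSpace N 1 1)}
    (hν : IsInvariantProbability (flow N 1 1) ν) {C : Set (ℤ → Letter)} (hC : MeasurableSet C)
    {ρ : ℝ} (hρ : ∀ ε > 0, ∃ L : ℕ, ∀ ξ ∈ sequenceSpace N, ∀ (p : ℤ) (n : ℕ), L ≤ n →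
      |orbitSum (C.indicator 1) ξ p n - ρ * n| ≤ ε * n) {B : Set UnitAddCircle}
    (hB : MeasurableSet B) :
    ν.real (phase ⁻¹' B ∩ labels ⁻¹' C) = ρ * ν.real (phase ⁻¹' B) := by
  obtain ⟨hp, hinv⟩ := hν
  have hmB : MeasurableSet (phase (N := N) ⁻¹' B) := measurable_phase hB
  -- Integer translations fix the phase and shift the labels, so by invariance all g j have the same
  -- integral, while their averages are uniformly close to ρ times the indicator of the phase
  -- condition.
  set g : ℕ → tilingSpace N 1 1 → ℝ := fun j T =>
    (phase ⁻¹' B).indicator 1 T * C.indicator 1 (shift j (labels T)) with hg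
  have hshift : ∀ j : ℕ, Measurable fun T : tilingSpace N 1 1 => shift (j : ℤ) (labels T) :=
    fun j => measurable_pi_lambda _ fun i => (measurable_pi_apply _).comp measurable_labels
  have hgm : ∀ j, Measurable (g j) := fun j =>
    (measurable_one.indicator hmB).mul ((measurable_one.indicator hC).comp (hshift j))
  have hgb : ∀ j T, ‖g j T‖ ≤ 1 := by
    intro j T
    simp only [hg, indicator, Pi.one_apply]
    split_ifs <;> simp
  have hgi : ∀ j, Integrable (g j) ν := fun j =>
    Integrable.of_bound (hgm j).aestronglyMeasurable 1 (Eventually.of_forall (hgb j))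
  have hg0 : ∫ T, g 0 T ∂ν = ν.real (phase ⁻¹' B ∩ labels ⁻¹' C) := by
    rw [← integral_indicator_one (hmB.inter (measurable_labels hC))]
    refine integral_congr_ae (Eventually.of_forall fun T => ?_)
    simp only [hg, Nat.cast_zero, shift_zero]
    by_cases h1 : phase T ∈ B <;> by_cases h2 : labels T ∈ C <;> simp [indicator, h1, h2]
  have hgj : ∀ j : ℕ, ∫ T, g j T ∂ν = ∫ T, g 0 T ∂ν := by
    intro j
    conv_rhs => rw [← (hinv j).map_eq]
    rw [integral_map (hinv j).measurable.aemeasurable (hgm 0).aestronglyMeasurable]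
    refine integral_congr_ae (Eventually.of_forall fun T => ?_)
    simp only [hg, Nat.cast_zero, shift_zero, labels_flow_natCast]
    have e : flow N 1 1 (j : ℝ) T ∈ phase ⁻¹' B ↔ T ∈ phase ⁻¹' B := by
      rw [mem_preimage, mem_preimage, phase_flow_natCast]
    by_cases h : T ∈ phase ⁻¹' B
    · rw [indicator_of_mem h, indicator_of_mem (e.2 h)]; rfl
    · rw [indicator_of_notMem h, indicator_of_notMem (mt e.1 h)]
  set I := ∫ T, g 0 T ∂ν
  rw [← hg0]
  have key : ∀ ε > 0, |I - ρ * ν.real (phase ⁻¹' B)| ≤ ε := by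
    intro ε hε
    obtain ⟨L, hL⟩ := hρ ε hε
    have hn : (0 : ℝ) < (L + 1 : ℕ) := by positivity
    have h1 : ∫ T, (∑ j ∈ Finset.range (L + 1), g j T -
        ρ * (L + 1 : ℕ) * (phase ⁻¹' B).indicator 1 T) ∂ν =
        (L + 1 : ℕ) * (I - ρ * ν.real (phase ⁻¹' B)) := by
      have hi : Integrable (fun T => ρ * (L + 1 : ℕ) *
          (phase (N := N) ⁻¹' B).indicator (1 : tilingSpace N 1 1 → ℝ) T) ν :=
        ((integrable_const (1 : ℝ)).indicator hmB).const_mul _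
      rw [integral_sub (integrable_finsetSum _ fun j _ => hgi j) hi, integral_finsetSum _ fun j _ => hgi j,
        integral_const_mul, integral_indicator_one hmB, Finset.sum_congr rfl fun j _ => hgj j]
      simp
      ring
    have h2 : |∫ T, (∑ j ∈ Finset.range (L + 1), g j T -
        ρ * (L + 1 : ℕ) * (phase ⁻¹' B).indicator 1 T) ∂ν| ≤ ε * (L + 1 : ℕ) := by
      rw [← Real.norm_eq_abs]
      refine (norm_integral_le_of_norm_le_const (C := ε * (L + 1 : ℕ))
        (Eventually.of_forall fun T => ?_)).trans ?_
      · by_cases h : T ∈ phase (N := N) ⁻¹' B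
        · have := hL (labels T) (labels_mem T) 0 (L + 1) (by omega)
          simpa [hg, h, orbitSum] using this
        · simp only [hg, indicator_of_notMem h, zero_mul, Finset.sum_const_zero, mul_zero,
            sub_zero, norm_zero]
          positivity
      · simp
    rw [h1, abs_mul, abs_of_pos hn, mul_comm] at h2
    exact le_of_mul_le_mul_right h2 hn
  have := le_of_forall_pos_le_add (a := |I - ρ * ν.real (phase ⁻¹' B)|) (b := 0)
    fun ε hε => by simpa using key ε hε
  exact sub_eq_zero.1 (abs_nonpos_iff.1 this)

/-- The phase intertwines the flow with rotations by all t, so its law is rotation invariant, hence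
Haar. -/
theorem map_phase {ν : Measure (tilingSpace N 1 1)}
    (hν : IsInvariantProbability (flow N 1 1) ν) : Measure.map phase ν = volume := by
  obtain ⟨hp, hinv⟩ := hν
  have h1 : IsProbabilityMeasure (Measure.map (phase (N := N)) ν) :=
    Measure.isProbabilityMeasure_map measurable_phase.aemeasurable
  have h2 : (Measure.map (phase (N := N)) ν).IsAddLeftInvariant := by
    refine ⟨fun θ => ?_⟩
    obtain ⟨t, rfl⟩ := QuotientAddGroup.mk_surjective θ
    conv_rhs => rw [← (hinv t).map_eq]
    rw [Measure.map_map (measurable_const_add _) measurable_phase,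
      Measure.map_map measurable_phase (measurable_flow t)]
    congr 1
    funext T
    simp only [Function.comp_apply]
    rw [phase_flow, add_comm]
  have h3 : (Measure.map (phase (N := N)) ν).IsAddHaarMeasure :=
    Measure.isAddHaarMeasure_of_isCompact_nonempty_interior _ univ isCompact_univ (by simp)
      (by simp) (by simp)
  exact Measure.isAddHaarMeasure_eq_of_isProbabilityMeasure _ _

/-- A cylinder set has a local indicator function. -/
theorem exists_isLocal_cylinder {I : Finset ℤ} (S : Set (∀ _ : I, Letter)) :
    ∃ r, IsLocal r ((cylinder I S).indicator (1 : (ℤ → Letter) → ℝ)) := by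
  refine ⟨I.sup Int.natAbs, fun ξ η h => ?_⟩
  have h1 : I.restrict ξ = I.restrict η := by
    funext j
    refine h j ?_
    rw [Int.abs_eq_natAbs]
    exact_mod_cast Finset.le_sup (f := Int.natAbs) j.2
  have h2 : ξ ∈ cylinder I S ↔ η ∈ cylinder I S := by
    rw [mem_cylinder, mem_cylinder, h1]
  by_cases h3 : η ∈ cylinder I S
  · rw [indicator_of_mem (h2.2 h3), indicator_of_mem h3]; rfl
  · rw [indicator_of_notMem (mt h2.1 h3), indicator_of_notMem h3]

/-- The flow on the tiling space is uniquely ergodic. -/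
theorem invariantProbability_unique (hN₀ : N 0 = 0) (hN : StrictMono N) (ξ₀ : sequenceSpace N)
    {μ ν : Measure (tilingSpace N 1 1)} (hμ : IsInvariantProbability (flow N 1 1) μ)
    (hν : IsInvariantProbability (flow N 1 1) ν) : μ = ν := by
  have hΓ : Measurable fun T : tilingSpace N 1 1 => (phase T, labels T) :=
    measurable_phase.prodMk measurable_labels
  have := hμ.1
  have := hν.1
  have h1 : Measure.map (fun T : tilingSpace N 1 1 => (phase T, labels T)) μ =
      Measure.map (fun T : tilingSpace N 1 1 => (phase T, labels T)) ν := by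
    refine Measure.ext_prod fun {B C} hB hC => ?_
    have hr : ∀ (κ : Measure (tilingSpace N 1 1)) (D : Set (ℤ → Letter)), MeasurableSet D →
        Measure.map (fun T => (phase T, labels T)) κ (B ×ˢ D) =
        Measure.map labels (κ.restrict (phase ⁻¹' B)) D := by
      intro κ D hD
      rw [Measure.map_apply hΓ (hB.prod hD), Measure.map_apply measurable_labels hD,
        Measure.restrict_apply (measurable_labels hD), inter_comm]
      rfl
    rw [hr μ C hC, hr ν C hC]
    have hB' : ∀ κ : Measure (tilingSpace N 1 1), IsInvariantProbability (flow N 1 1) κ →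
        κ (phase ⁻¹' B) = volume B := fun κ hκ => by
      rw [← map_phase hκ, Measure.map_apply measurable_phase hB]
    suffices Measure.map labels (μ.restrict (phase ⁻¹' B)) =
        Measure.map labels (ν.restrict (phase ⁻¹' B)) by rw [this]
    -- Cylinders generate and have local indicators, so their frequencies are the same for every
    -- invariant probability.
    refine ext_of_generate_finite _ generateFrom_measurableCylinders.symm
      isPiSystem_measurableCylinders (fun D hD => ?_) ?_
    · obtain ⟨I, S, hS, rfl⟩ := (mem_measurableCylinders _).1 hD
      obtain ⟨r, hloc⟩ := exists_isLocal_cylinder S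
      obtain ⟨ρ, hρ⟩ := exists_frequency hN₀ hN ⟨_, ξ₀.2⟩ hloc
        (fun ξ => indicator_nonneg (fun _ _ => zero_le_one) ξ)
        (fun ξ => indicator_le' (fun _ _ => le_rfl) (fun _ _ => zero_le_one) ξ)
      have hm : MeasurableSet (cylinder (α := fun _ : ℤ => Letter) I S) := MeasurableSet.of_mem_measurableCylinders hD
      have e1 := measure_real_phase_labels hμ hm hρ hB
      have e2 := measure_real_phase_labels hν hm hρ hB
      rw [Measure.map_apply measurable_labels hm, Measure.map_apply measurable_labels hm,
        Measure.restrict_apply (measurable_labels hm), Measure.restrict_apply (measurable_labels hm),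
        inter_comm]
      rw [← measureReal_eq_measureReal_iff, e1, e2, measureReal_def, measureReal_def, hB' μ hμ,
        hB' ν hν]
    · rw [Measure.map_apply measurable_labels MeasurableSet.univ,
        Measure.map_apply measurable_labels MeasurableSet.univ, preimage_univ,
        Measure.restrict_apply_univ, Measure.restrict_apply_univ, hB' μ hμ, hB' ν hν]
  have h2 : ∀ κ : Measure (tilingSpace N 1 1),
      Measure.map (assemble ξ₀) (Measure.map (fun T => (phase T, labels T)) κ) = κ := by
    intro κ
    rw [Measure.map_map (measurable_assemble ξ₀) hΓ]
    have : assemble ξ₀ ∘ (fun T : tilingSpace N 1 1 => (phase T, labels T)) = id := by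
      funext T
      exact assemble_phase_labels ξ₀ T
    rw [this, Measure.map_id]
  rw [← h2 μ, h1, h2 ν]

end Uniqueness

/-! ### Dynamical spectrum -/

section Spectrum

theorem EigenEquation.congr {Ω : Type} {Φ : ℝ → Ω → Ω} [MeasurableSpace Ω] {μ : Measure Ω}
    (hΦ : ∀ t, MeasurePreserving (Φ t) μ μ) {β : ℝ} {f g : Ω → ℂ} (hfg : f =ᵐ[μ] g)
    (h : EigenEquation Φ μ β f) : EigenEquation Φ μ β g := by
  intro t
  filter_upwards [h t, hfg, (hΦ t).quasiMeasurePreserving.ae hfg] with ω h1 h2 h3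
  rw [← h3, ← h2, h1]

theorem exists_exp_ne_one {β : ℝ} (h : β ≠ 0) :
    ∃ t : ℝ, Complex.exp (2 * Real.pi * Complex.I * β * t) ≠ 1 := by
  refine ⟨1 / (2 * β), ?_⟩
  have h1 : (2 * Real.pi * Complex.I * β * (1 / (2 * β) : ℝ) : ℂ) = Real.pi * Complex.I := by
    have : (β : ℂ) ≠ 0 := by exact_mod_cast h
    push_cast
    field_simp
  rw [h1, Complex.exp_pi_mul_I]
  norm_num

/-- Eigenfunctions for different eigenvalues are orthogonal. -/
theorem EigenEquation.inner_eq_zero {Ω : Type} {Φ : ℝ → Ω → Ω} [MeasurableSpace Ω] {μ : Measure Ω}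
    (hΦ : ∀ t, MeasurePreserving (Φ t) μ μ) {β γ : ℝ} {f g : Lp ℂ 2 μ}
    (hf : EigenEquation Φ μ β f) (hg : EigenEquation Φ μ γ g) (hne : γ ≠ β) :
    inner ℂ f g = 0 := by
  obtain ⟨t, ht⟩ := exists_exp_ne_one (sub_ne_zero.2 hne)
  rw [L2.inner_def]
  set c := ∫ ω, inner ℂ (f ω) (g ω) ∂μ with hc
  have hm : AEStronglyMeasurable (fun ω => inner ℂ (f ω) (g ω)) μ :=
    (Lp.aestronglyMeasurable f).inner (Lp.aestronglyMeasurable g)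
  have h1 : c = Complex.exp (2 * Real.pi * Complex.I * (γ - β : ℝ) * t) * c := by
    have hgen : ∀ G : Ω → ℂ, AEStronglyMeasurable G μ → ∫ ω, G ω ∂μ = ∫ ω, G (Φ t ω) ∂μ := by
      intro G hG
      conv_lhs => rw [← (hΦ t).map_eq]
      rw [integral_map (hΦ t).measurable.aemeasurable (by rw [(hΦ t).map_eq]; exact hG)]
    refine (hgen _ hm).trans ?_
    rw [hc, ← integral_const_mul]
    refine integral_congr_ae ?_
    filter_upwards [hf t, hg t] with ω h1 h2
    rw [h1, h2]
    simp only [RCLike.inner_apply, map_mul, ← Complex.exp_conj]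
    simp only [Complex.conj_ofReal, Complex.conj_I, map_ofNat]
    rw [show (2 * Real.pi * Complex.I * (γ - β : ℝ) * t : ℂ) =
      2 * Real.pi * Complex.I * γ * t + 2 * Real.pi * -Complex.I * β * t by push_cast; ring,
      Complex.exp_add]
    ring
  have h2 : (Complex.exp (2 * Real.pi * Complex.I * (γ - β : ℝ) * t) - 1) * c = 0 := by
    rw [sub_mul, one_mul, ← h1, sub_self]
  exact (mul_eq_zero.1 h2).resolve_left (sub_ne_zero.2 ht)

/-- The characters of the two-dimensional torus. -/
def torusChar (n : ℤ × ℤ) : C(UnitAddCircle × UnitAddCircle, ℂ) where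
  toFun p := fourier n.1 p.1 * fourier n.2 p.2
  continuous_toFun := by fun_prop

/-- Density of trigonometric polynomials in the continuous functions on the torus indexed by `Fin
2`, transported to the product and then to L². -/
theorem dense_span_torusChar : Dense (Submodule.span ℂ (range fun n : ℤ × ℤ =>
    ContinuousMap.toLp (E := ℂ) 2 (volume : Measure (UnitAddCircle × UnitAddCircle)) ℂ
      (torusChar n)) : Set (Lp ℂ 2 (volume : Measure (UnitAddCircle × UnitAddCircle)))) := by
  set e : C(UnitAddCircle × UnitAddCircle, UnitAddTorus (Fin 2)) := ⟨fun p => ![p.1, p.2], by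
    refine continuous_pi fun i => ?_
    fin_cases i
    · exact continuous_fst
    · exact continuous_snd⟩ with he
  set g : C(UnitAddTorus (Fin 2), ℂ) →L[ℂ] Lp ℂ 2 (volume : Measure (UnitAddCircle × UnitAddCircle)) :=
    (ContinuousMap.toLp (E := ℂ) 2 (volume : Measure (UnitAddCircle × UnitAddCircle)) ℂ).comp
      (ContinuousMap.compCLM ℂ ℂ e) with hg
  have hgd : DenseRange g := by
    refine (ContinuousMap.toLp_denseRange (p := 2) ℂ
      (volume : Measure (UnitAddCircle × UnitAddCircle)) ℂ (by simp)).mono ?_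
    rintro _ ⟨f, rfl⟩
    refine ⟨⟨fun w => f (w 0, w 1), by fun_prop⟩, ?_⟩
    rw [hg, ContinuousLinearMap.comp_apply]
    congr 1
  have hD : Dense ((Submodule.span ℂ (range (UnitAddTorus.mFourier (d := Fin 2))) :
      Submodule ℂ C(UnitAddTorus (Fin 2), ℂ)) : Set C(UnitAddTorus (Fin 2), ℂ)) := by
    rw [dense_iff_closure_eq, ← Submodule.topologicalClosure_coe,
      UnitAddTorus.span_mFourier_closure_eq_top]
    rfl
  refine (hgd.dense_image g.continuous hD).mono ?_
  rintro _ ⟨f, hf, rfl⟩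
  have h1 : Submodule.map (g : C(UnitAddTorus (Fin 2), ℂ) →ₗ[ℂ] _)
      (Submodule.span ℂ (range (UnitAddTorus.mFourier (d := Fin 2)))) ≤
      Submodule.span ℂ (range fun n : ℤ × ℤ =>
        ContinuousMap.toLp (E := ℂ) 2 (volume : Measure (UnitAddCircle × UnitAddCircle)) ℂ
          (torusChar n)) := by
    rw [Submodule.map_span]
    refine Submodule.span_mono ?_
    rintro _ ⟨_, ⟨n, rfl⟩, rfl⟩
    refine ⟨(n 0, n 1), ?_⟩
    simp only [ContinuousLinearMap.coe_coe, hg, ContinuousLinearMap.comp_apply]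
    congr 1
    ext p
    simp [torusChar, UnitAddTorus.mFourier, he]
  exact h1 ⟨f, hf, rfl⟩

variable {N : ℕ → ℕ}

/-- The labels yield e(y - θφ) by `exists_descent`, and the phase yields θ; the factor e((n₁ +
n₂φ)θ) undoes the shear. -/
theorem exists_eigenfunction (hN₀ : N 0 = 0) (hN : StrictMono N)
    (hsum : Summable fun κ : {κ : ℕ // Odd κ} => (φ ^ gap N ((κ : ℕ) + 1))⁻¹)
    (ξ₀ : sequenceSpace N) (n : ℤ × ℤ) : ∃ F : tilingSpace N 1 1 → ℂ, Measurable F ∧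
      ∀ᵐ p : UnitAddCircle × UnitAddCircle, F (param ξ₀ p) = torusChar n p := by
  obtain ⟨χ, hχm, hχ⟩ := exists_descent hN₀ hN hsum
  refine ⟨fun T => χ (labels T) ^ n.2 *
    Complex.exp (2 * Real.pi * Complex.I * ((n.1 + n.2 * φ) * rep0 (phase T) : ℝ)), ?_, ?_⟩
  · refine Measurable.mul ?_ ?_
    · exact (hχm.comp measurable_labels).pow_const _
    · exact Complex.measurable_exp.comp (measurable_const.mul
        (Complex.measurable_ofReal.comp ((measurable_rep0.comp measurable_phase).const_mul _)))
  · have h1 : ∀ᵐ p : UnitAddCircle × UnitAddCircle, χ (seq N p.2) = fourier 1 p.2 :=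
      Measure.quasiMeasurePreserving_snd.ae hχ
    filter_upwards [ae_torusGood hN hsum, measurePreserving_skew.quasiMeasurePreserving.ae h1]
      with p hp hχp
    rw [labels_param hN₀ hN ξ₀ hp, phase_param hN₀ hN ξ₀ hp, hχp]
    obtain ⟨y, hy⟩ := QuotientAddGroup.mk_surjective p.2
    have hy : p.2 = (y : UnitAddCircle) := hy.symm
    have h2 : torusChar n p = fourier n.1 (rep0 p.1 : UnitAddCircle) * fourier n.2 p.2 := by
      rw [coe_rep0]; rfl
    rw [h2, hy, ← AddCircle.coe_add, fourier_coe_apply, fourier_coe_apply, fourier_coe_apply,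
      ← Complex.exp_int_mul, ← Complex.exp_add, ← Complex.exp_add]
    congr 1
    push_cast
    ring

/-- The eigenfunctions of the flow, as elements of `L²`. -/
theorem exists_eigenbasis (hN₀ : N 0 = 0) (hN : StrictMono N)
    (hsum : Summable fun κ : {κ : ℕ // Odd κ} => (φ ^ gap N ((κ : ℕ) + 1))⁻¹)
    (ξ₀ : sequenceSpace N) : ∃ F : ℤ × ℤ → Lp ℂ 2 (tilingMeasure ξ₀),
      (∀ n, EigenEquation (flow N 1 1) (tilingMeasure ξ₀) (n.1 + n.2 * φ) (F n)) ∧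
      (∀ n, F n ≠ 0) ∧
      Dense (Submodule.span ℂ (range F) : Set (Lp ℂ 2 (tilingMeasure ξ₀))) := by
  choose F hFm hF using exists_eigenfunction hN₀ hN hsum ξ₀
  have hinv := (isInvariantProbability_tilingMeasure hN₀ hN hsum ξ₀).2
  have hp := measurePreserving_param ξ₀
  have hn1 : ∀ n p, ‖torusChar n p‖ = 1 := by
    intro n p
    simp only [torusChar, ContinuousMap.coe_mk, norm_mul, fourier_apply]
    rw [Circle.norm_coe, Circle.norm_coe, mul_one]
  have hmem : ∀ n, MemLp (F n) 2 (tilingMeasure ξ₀) := by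
    intro n
    refine MemLp.of_bound (hFm n).aestronglyMeasurable 1 ?_
    rw [tilingMeasure, ae_map_iff (measurable_param ξ₀).aemeasurable
      (measurableSet_le (hFm n).norm measurable_const)]
    filter_upwards [hF n] with p h
    rw [h, hn1]
  -- Pull-back to the torus is an isometry whose image contains all characters. So density of the
  -- span can be checked on the torus, without an inverse of `param`.
  set ι := Lp.compMeasurePreservingₗᵢ (E := ℂ) (p := 2) ℂ (param ξ₀) hp with hι
  have hιF : ∀ n, ι ((hmem n).toLp (F n)) =
      ContinuousMap.toLp (E := ℂ) 2 (volume : Measure (UnitAddCircle × UnitAddCircle)) ℂ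
        (torusChar n) := by
    intro n
    apply Lp.ext
    have h1 : ι ((hmem n).toLp (F n)) =ᵐ[volume] (hmem n).toLp (F n) ∘ param ξ₀ :=
      Lp.coeFn_compMeasurePreserving _ hp
    filter_upwards [h1, hp.quasiMeasurePreserving.ae (hmem n).coeFn_toLp, hF n,
      ContinuousMap.coeFn_toLp (E := ℂ) (p := 2) (𝕜 := ℂ)
        (volume : Measure (UnitAddCircle × UnitAddCircle)) (torusChar n)] with p e1 e2 e3 e4
    rw [e1, Function.comp_apply, e2, e3, e4]
  refine ⟨fun n => (hmem n).toLp (F n), fun n => ?_, fun n h => ?_, ?_⟩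
  · refine EigenEquation.congr hinv (hmem n).coeFn_toLp.symm fun t => ?_
    have hms : MeasurableSet {T : tilingSpace N 1 1 | F n (flow N 1 1 t T) =
        Complex.exp (2 * Real.pi * Complex.I * (n.1 + n.2 * φ : ℝ) * t) * F n T} :=
      measurableSet_eq_fun ((hFm n).comp (measurable_flow t)) ((hFm n).const_mul _)
    rw [tilingMeasure, ae_map_iff (measurable_param ξ₀).aemeasurable hms]
    filter_upwards [hF n, (measurePreserving_torus
      ((t : UnitAddCircle), ((t * φ : ℝ) : UnitAddCircle))).quasiMeasurePreserving.ae (hF n),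
      ae_torusGood hN hsum] with p h1 h2 h3
    rw [flow_param hN₀ hN ξ₀ h3, h1, h2]
    simp only [torusChar, ContinuousMap.coe_mk, Prod.fst_add, Prod.snd_add, fourier_apply,
      smul_add, AddCircle.toCircle_add, Circle.coe_mul]
    simp only [← fourier_apply]
    rw [fourier_coe_apply, fourier_coe_apply]
    rw [show (2 * Real.pi * Complex.I * (n.1 + n.2 * φ : ℝ) * t : ℂ) =
      2 * Real.pi * Complex.I * n.1 * t / (1 : ℝ) +
        2 * Real.pi * Complex.I * n.2 * (t * φ : ℝ) / (1 : ℝ) by push_cast; ring, Complex.exp_add]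
    ring
  · have h1 := hιF n
    change (hmem n).toLp (F n) = 0 at h
    rw [h, map_zero] at h1
    have h2 := ContinuousMap.coeFn_toLp (E := ℂ) (p := 2) (𝕜 := ℂ)
        (volume : Measure (UnitAddCircle × UnitAddCircle)) (torusChar n)
    rw [← h1] at h2
    have h3 := h2.symm.trans (Lp.coeFn_zero _ _ _)
    obtain ⟨p, hp⟩ := h3.exists
    have := hn1 n p
    rw [hp] at this
    simp at this
  · intro f
    rw [ι.isometry.isEmbedding.isInducing.closure_eq_preimage_closure_image, mem_preimage]
    refine closure_mono ?_ (dense_span_torusChar (ι f))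
    intro g hg
    have h1 : Submodule.span ℂ (range fun n : ℤ × ℤ =>
        ContinuousMap.toLp (E := ℂ) 2 (volume : Measure (UnitAddCircle × UnitAddCircle)) ℂ
          (torusChar n)) ≤ Submodule.map ι.toLinearMap
        (Submodule.span ℂ (range fun n => (hmem n).toLp (F n))) := by
      rw [Submodule.map_span]
      refine Submodule.span_mono ?_
      rintro _ ⟨n, rfl⟩
      exact ⟨_, ⟨n, rfl⟩, hιF n⟩
    obtain ⟨f, hf, rfl⟩ := h1 hg
    exact ⟨f, hf, rfl⟩

theorem hasPurePointSpectrum_tilingMeasure (hN₀ : N 0 = 0) (hN : StrictMono N)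
    (hsum : Summable fun κ : {κ : ℕ // Odd κ} => (φ ^ gap N ((κ : ℕ) + 1))⁻¹)
    (ξ₀ : sequenceSpace N) : HasPurePointSpectrum (flow N 1 1) (tilingMeasure ξ₀) := by
  obtain ⟨F, h1, -, h3⟩ := exists_eigenbasis hN₀ hN hsum ξ₀
  rw [HasPurePointSpectrum, ← Submodule.dense_iff_topologicalClosure_eq_top]
  refine h3.mono (Submodule.span_mono ?_)
  rintro _ ⟨n, rfl⟩
  exact ⟨_, h1 n⟩

/-- An eigenfunction for any other eigenvalue would be orthogonal to the dense span of the known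
ones. -/
theorem isEigenvalue_iff (hN₀ : N 0 = 0) (hN : StrictMono N)
    (hsum : Summable fun κ : {κ : ℕ // Odd κ} => (φ ^ gap N ((κ : ℕ) + 1))⁻¹)
    (ξ₀ : sequenceSpace N) (β : ℝ) : IsEigenvalue (flow N 1 1) (tilingMeasure ξ₀) β ↔
      ∃ n : ℤ × ℤ, n.1 + n.2 * φ = β := by
  obtain ⟨F, h1, h2, h3⟩ := exists_eigenbasis hN₀ hN hsum ξ₀
  have hinv := (isInvariantProbability_tilingMeasure hN₀ hN hsum ξ₀).2
  constructor
  · rintro ⟨f, hf, hne, heq⟩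
    by_contra! hβ
    have hfe : EigenEquation (flow N 1 1) (tilingMeasure ξ₀) β (hf.toLp f) :=
      EigenEquation.congr hinv hf.coeFn_toLp.symm heq
    have h0 : hf.toLp f = 0 := by
      refine h3.eq_zero_of_inner_right ℂ (fun v hv => ?_)
      have h4 : Submodule.span ℂ (range F) ≤ (ℂ ∙ hf.toLp f)ᗮ := by
        rw [Submodule.span_le]
        rintro _ ⟨n, rfl⟩
        exact Submodule.mem_orthogonal_singleton_iff_inner_left.2
          ((h1 n).inner_eq_zero hinv hfe (hβ n).symm)
      exact Submodule.mem_orthogonal_singleton_iff_inner_left.1 (h4 hv)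
    exact hne ((MemLp.toLp_eq_toLp_iff hf (MemLp.zero)).1 (h0.trans (MemLp.toLp_zero _).symm))
  · rintro ⟨n, rfl⟩
    refine ⟨F n, Lp.memLp _, fun h => h2 n ?_, h1 n⟩
    exact (Lp.eq_zero_iff_ae_eq_zero).2 h

end Spectrum

/-! ### Topological eigenvalues -/

section Topological

/-- |e(θ) - 1| = 2 |sin πθ|, and sin x ≥ 2x/π on [0, π/2]. -/
theorem four_mul_abs_sub_round_le (θ : ℝ) :
    4 * |θ - round θ| ≤ ‖Complex.exp (2 * Real.pi * Complex.I * θ) - 1‖ := by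
  have h1 : Complex.exp (2 * Real.pi * Complex.I * θ) =
      Complex.exp (Complex.I * (2 * Real.pi * (θ - round θ) : ℝ)) := by
    rw [← Complex.exp_periodic.sub_int_mul_eq (round θ)]
    congr 1
    push_cast
    ring
  have hy := abs_sub_round θ
  set y := θ - round θ
  rw [h1, Complex.norm_exp_I_mul_ofReal_sub_one, norm_mul, Real.norm_eq_abs, Real.norm_eq_abs,
    abs_two, show 2 * Real.pi * y / 2 = Real.pi * y by ring]
  have hpi := Real.pi_pos
  have h2 : Real.sin (Real.pi * |y|) ≤ |Real.sin (Real.pi * y)| := by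
    rcases abs_cases y with ⟨h, -⟩ | ⟨h, -⟩
    · rw [h]; exact le_abs_self _
    · rw [h, mul_neg, Real.sin_neg]; exact neg_le_abs _
  have h3 := Real.mul_le_sin (x := Real.pi * |y|) (by positivity) (by nlinarith)
  have h4 : 2 / Real.pi * (Real.pi * |y|) = 2 * |y| := by field_simp
  linarith

/-- If all multiples `j θ`, `j ≤ n`, are close to integers, then `θ` is very close to an integer. -/
theorem mul_abs_sub_round_le {θ δ : ℝ} (hδ : δ < 1 / 4) {n : ℕ}
    (h : ∀ j : ℕ, j ≤ n → |j * θ - round (j * θ)| ≤ δ) : n * |θ - round θ| ≤ δ := by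
  have hδ0 : 0 ≤ δ := (abs_nonneg _).trans (h 0 (Nat.zero_le _))
  rcases Nat.eq_zero_or_pos n with rfl | hn
  · simpa using hδ0
  have h1 : |θ - round θ| ≤ δ := by simpa using h 1 hn
  have key : ∀ j : ℕ, j ≤ n → j * |θ - round θ| ≤ δ := by
    intro j
    induction j with
    | zero => intro _; simpa using hδ0
    | succ j ih =>
      intro hj
      have h2 := ih (by omega)
      -- Both summands are below 1/4, so the integer nearest to (j + 1)θ is still j + 1 times the
      -- one nearest to θ.
      have h3 : (j + 1 : ℕ) * |θ - round θ| < 1 / 2 := by push_cast; linarith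
      have h4 := h (j + 1) hj
      have h5 : round (((j + 1 : ℕ) : ℝ) * θ) = (j + 1 : ℕ) * round θ := by
        have e1 : ((j + 1 : ℕ) : ℝ) * θ = ((j + 1 : ℕ) * round θ : ℤ) +
            (j + 1 : ℕ) * (θ - round θ) := by push_cast; ring
        have e2 : |((j + 1 : ℕ) : ℝ) * (θ - round θ)| < 1 / 2 := by
          rw [abs_mul, Nat.abs_cast]; exact h3
        rw [abs_lt] at e2
        have e3 : round (((j + 1 : ℕ) : ℝ) * (θ - round θ)) = 0 :=
          round_eq_zero_iff.2 ⟨by linarith [e2.1], e2.2⟩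
        rw [e1, round_intCast_add, e3, add_zero]
      have e4 : ((j + 1 : ℕ) : ℝ) * θ - (((j + 1 : ℕ) * round θ : ℤ) : ℝ) =
          (j + 1 : ℕ) * (θ - round θ) := by push_cast; ring
      rw [h5, e4, abs_mul, Nat.abs_cast] at h4
      exact h4
  exact key n le_rfl

variable {N : ℕ → ℕ}

/-- An eigenfunction forces the return times of some word to be almost periods. -/
theorem IsTopologicalEigenvalue.exists_word {β : ℝ}
    (h : IsTopologicalEigenvalue (flow N 1 1) β) : ∃ ξ ∈ sequenceSpace N, ∀ η > 0,
      ∃ (i : ℤ) (k : ℕ), ∀ q q' : ℤ, word ξ q k = word ξ i k → word ξ q' k = word ξ i k →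
        ‖Complex.exp (2 * Real.pi * Complex.I * (β * (q' - q) : ℝ)) - 1‖ ≤ η := by
  obtain ⟨f, hf, hne, heq⟩ := h
  obtain ⟨T, hT⟩ : ∃ T, f T ≠ 0 := by
    by_contra! h; exact hne (funext h)
  refine ⟨labels T, labels_mem T, fun η hη => ?_⟩
  set ξ := labels T with hξ
  have hc := norm_pos_iff.2 hT
  have h1 : ∀ᶠ T' in 𝓝 T, ‖f T' - f T‖ < η / 2 * ‖f T‖ := by
    have := Metric.continuousAt_iff'.1 (hf.continuousAt (x := T)) (η / 2 * ‖f T‖) (by positivity)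
    simpa [dist_eq_norm] using this
  rw [nhds_subtype_eq_comap, ((Pattern.nhds_hasBasis T.1).comap _).eventually_iff] at h1
  obtain ⟨ε, hε, h1⟩ := h1
  -- The extra 1 covers the offset of T in [0, 1).
  obtain ⟨K, hK⟩ := exists_nat_ge (1 / ε + 1)
  refine ⟨-K, 2 * K + 1, ?_⟩
  have key : ∀ q : ℤ, word ξ q (2 * K + 1) = word ξ (-K) (2 * K + 1) →
      ‖Complex.exp (2 * Real.pi * Complex.I * (β * (q + K) : ℝ)) - 1‖ ≤ η / 2 := by
    intro q hq
    have h2 : Pattern.Close ε (T : Pattern Letter) (flow N 1 1 ((q + K : ℤ) : ℝ) T) := by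
      refine Pattern.close_iff.2 ⟨0, by simpa using hε.le, fun x o hx => ?_⟩
      have hT' : (T : Pattern Letter) = tl ξ (offset T) := eq_tl T
      rw [coe_flow, hT', translate_tl, add_comm (offset T), add_comm _ (offset T), ← tl_shift,
        mem_tl, mem_tl, add_zero]
      refine exists_congr fun n => and_congr_right fun hn => ?_
      have h3 : |(n : ℝ)| ≤ K := by
        rw [hn]
        have := abs_of_nonneg (offset_mem T).1
        exact (abs_add_le _ _).trans (by linarith [(offset_mem T).2])
      rw [abs_le] at h3
      have h4 : -(K : ℤ) ≤ n := by exact_mod_cast h3.1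
      have h5 : n ≤ K := by exact_mod_cast h3.2
      have h6 := congrFun (List.ofFn_injective hq) ⟨(n + K).toNat, by omega⟩
      simp only [Int.toNat_of_nonneg (show 0 ≤ n + K by omega)] at h6
      rw [shift_apply, show n + (q + K) = q + (n + K) by ring, h6, show -(K : ℤ) + (n + K) = n by ring]
    have h3 := h1 h2
    rw [heq] at h3
    have h4 : ‖Complex.exp (2 * Real.pi * Complex.I * (β * (q + K) : ℝ)) - 1‖ * ‖f T‖ <
        η / 2 * ‖f T‖ := by
      rw [← norm_mul, sub_mul, one_mul]
      convert h3 using 5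
      push_cast
      ring
    exact (lt_of_mul_lt_mul_right h4 hc.le).le
  intro q q' hq hq'
  have e1 := key q hq
  have e2 := key q' hq'
  set u := Complex.exp (2 * Real.pi * Complex.I * (β * (q + K) : ℝ)) with hu
  have hu1 : ‖u‖ = 1 := by
    rw [hu, show (2 * Real.pi * Complex.I * (β * (q + K) : ℝ) : ℂ) =
      (2 * Real.pi * (β * (q + K)) : ℝ) * Complex.I by push_cast; ring]
    exact Complex.norm_exp_ofReal_mul_I _
  set v := Complex.exp (2 * Real.pi * Complex.I * (β * (q' + K) : ℝ)) with hv
  have h5 : Complex.exp (2 * Real.pi * Complex.I * (β * (q' - q) : ℝ)) * u = v := by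
    rw [hu, hv, ← Complex.exp_add]
    congr 1
    push_cast
    ring
  calc _ = ‖(Complex.exp (2 * Real.pi * Complex.I * (β * (q' - q) : ℝ)) - 1) * u‖ := by
        rw [norm_mul, hu1, mul_one]
    _ = ‖(v - 1) - (u - 1)‖ := by rw [sub_mul, h5]; congr 1; ring
    _ ≤ ‖v - 1‖ + ‖u - 1‖ := norm_sub_le _ _
    _ ≤ η := by linarith

theorem word_of_append {ξ : ℤ → Letter} {p : ℤ} {l : ℕ} {s w t : List Letter}
    (h : s ++ w ++ t = word ξ p l) : word ξ (p + s.length) w.length = w := by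
  have hl : s.length + w.length + t.length = l := by
    simpa [add_assoc] using congrArg List.length h
  subst hl
  rw [word_add, word_add] at h
  have h1 := (List.append_inj h (by simp)).1
  exact (List.append_inj h1 (by simp)).2.symm

/-- Occurrences of a word in a power. -/
theorem word_of_replicate {ξ : ℤ → Letter} {p : ℤ} {l A : ℕ} {s t u w v : List Letter}
    (h : s ++ (List.replicate A (u ++ w ++ v)).flatten ++ t = word ξ p l) {j : ℕ} (hj : j < A) :
    word ξ (p + s.length + u.length + j * ((u ++ w ++ v).length : ℕ)) w.length = w := by
  obtain ⟨m, rfl⟩ : ∃ m, A = j + (1 + m) := ⟨A - j - 1, by omega⟩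
  have h1 : (s ++ (List.replicate j (u ++ w ++ v)).flatten ++ u) ++ w ++
      (v ++ (List.replicate m (u ++ w ++ v)).flatten ++ t) = word ξ p l := by
    rw [← h, List.replicate_add, List.replicate_add]
    simp
  convert word_of_append h1 using 2
  simp
  ring

theorem flatMap_replicate {α β : Type*} (f : α → List β) (n : ℕ) (x : α) :
    (List.replicate n x).flatMap f = (List.replicate n (f x)).flatten := by
  rw [List.flatMap_def, List.map_replicate]

theorem superletter_e (n : ℕ) : superletter N (n + 1) e =
    (List.replicate (Nat.fib (gap N (n + 1))) (superletter N n a)).flatten ++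
    (List.replicate (Nat.fib (gap N (n + 1) - 1)) (superletter N n b)).flatten := by
  simp only [superletter, rule, sortedWord, List.flatMap_append, flatMap_replicate]

/-- A determinant ±1: it recovers β modulo 1 from F_(n+1) β and F_(n+2) β. -/
theorem fib_combination (n : ℕ) :
    (Nat.fib (n + 1) : ℤ) * Nat.fib (n + 1) - Nat.fib n * Nat.fib (n + 2) = (-1) ^ n := by
  induction n with
  | zero => simp
  | succ n ih =>
    have h1 : (Nat.fib (n + 2) : ℤ) = Nat.fib n + Nat.fib (n + 1) := by
      exact_mod_cast Nat.fib_add_two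
    have h2 : (Nat.fib (n + 1 + 2) : ℤ) = Nat.fib (n + 1) + Nat.fib (n + 2) := by
      exact_mod_cast Nat.fib_add_two
    rw [pow_succ, ← ih, h2, show n + 1 + 1 = n + 2 from rfl, h1]
    ring

theorem isTopologicalEigenvalue_int (hne : (sequenceSpace N).Nonempty) (n : ℤ) :
    IsTopologicalEigenvalue (flow N 1 1) n := by
  refine ⟨fun T => fourier n (phase T), (fourier n).continuous.comp continuous_phase, ?_, ?_⟩
  · obtain ⟨ξ, hξ⟩ := hne
    intro h
    have h1 : (fourier n (phase (⟨tl ξ 0, tl_mem hξ 0⟩ : tilingSpace N 1 1)) : ℂ) = 0 :=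
      congrFun h ⟨tl ξ 0, tl_mem hξ 0⟩
    rw [fourier_apply] at h1
    exact Circle.coe_ne_zero _ h1
  · intro t T
    change (fourier n (phase (flow N 1 1 t T)) : ℂ) = _ * fourier n (phase T)
    rw [phase_flow, fourier_apply, smul_add, AddCircle.toCircle_add, Circle.coe_mul, mul_comm,
      ← fourier_apply, ← fourier_apply, fourier_coe_apply]
    congr 2
    push_cast
    ring

/-- Periodic runs of length about F_Δ bring F_(N+2) β and F_(N+1) β within O(δ / F_N) of integers,
with N = N(n) ≤ Δ. The coefficients of `fib_combination` are of order F_N, so β is O(δ)-close to an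
integer; δ is arbitrary. -/
theorem IsTopologicalEigenvalue.exists_int (hN₀ : N 0 = 0) (hN : StrictMono N)
    (hodd : ∀ κ : ℕ, Odd κ → N (κ - 1) ≤ gap N κ)
    {n₀ : ℕ} (h₀ : ∀ n ≥ n₀, Even n → 3 ≤ gap N n) {β : ℝ}
    (h : IsTopologicalEigenvalue (flow N 1 1) β) : ∃ n : ℤ, (n : ℝ) = β := by
  obtain ⟨ξ, hξ, h⟩ := h.exists_word
  refine ⟨round β, ?_⟩
  have key : ∀ δ : ℝ, 0 < δ → δ < 1 / 4 → |β - round β| ≤ 8 * δ := by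
    intro δ hδ hδ4
    obtain ⟨i, k, hik⟩ := h (4 * δ) (by positivity)
    have hper : ∀ (q q' : ℤ) (θ : ℝ), word ξ q k = word ξ i k → word ξ q' k = word ξ i k →
        β * (q' - q) = θ → |θ - round θ| ≤ δ := by
      rintro q q' _ hq hq' rfl
      have := (four_mul_abs_sub_round_le (β * (q' - q))).trans (hik q q' hq hq')
      linarith
    obtain ⟨m, hm⟩ := word_infix_superletter_a hN₀ hN h₀ hξ i k
    -- Evenness puts the sorted words at the odd level n + 1, where the growth assumption gives
    -- Δ(n+1) ≥ N(n), and lets `e` be created at the even level n + 2. The summand 4 leaves room for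
    -- the Fibonacci inequalities below.
    set n := 2 * (m + 4) with hn
    have hwa : word ξ i k <:+: superletter N n a := hm.trans (superletter_a_infix hN (by omega))
    have hwb : word ξ i k <:+: superletter N n b := by
      obtain ⟨n', hn'⟩ : ∃ n', n = n' + 1 := ⟨n - 1, by omega⟩
      rw [hn']
      exact (hm.trans (superletter_a_infix hN (by omega))).trans
        (superletter_infix_of_mem (a_mem_rule hN (by omega) b))
    have he : superletter N (n + 1) e <:+: word ξ 0 (2 * Nat.fib (N (n + 2 + 1) + 2) + 1) :=
      (superletter_infix_of_mem (e_mem_rule hN ⟨m + 5, by omega⟩ (by omega))).trans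
        (superletter_a_infix_word hN₀ hN hξ (n + 2) 0)
    obtain ⟨s, t, hst⟩ := he
    obtain ⟨u, v, huv⟩ := hwa
    obtain ⟨u', v', huv'⟩ := hwb
    rw [superletter_e] at hst
    have hΔ : N n ≤ gap N (n + 1) := hodd (n + 1) ⟨m + 4, by omega⟩
    have hNn : 8 ≤ N n := by have := hN.id_le n; simp at this; omega
    set Δ := gap N (n + 1)
    -- In a run of F_Δ copies of S_n(a) the word returns at j times the period for all j ≤ F_Δ - 1.
    have hA : ((Nat.fib Δ - 1 : ℕ) : ℝ) * |Nat.fib (N n + 2) * β -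
        round (Nat.fib (N n + 2) * β : ℝ)| ≤ δ := by
      refine mul_abs_sub_round_le hδ4 fun j hj => ?_
      have hpos : 0 < Nat.fib Δ := Nat.fib_pos.2 (by omega)
      have e1 : s ++ (List.replicate (Nat.fib Δ) (u ++ word ξ i k ++ v)).flatten ++
          ((List.replicate (Nat.fib (Δ - 1)) (superletter N n b)).flatten ++ t) =
          word ξ 0 (2 * Nat.fib (N (n + 2 + 1) + 2) + 1) := by
        rw [← hst, huv]; simp
      have e2 := word_of_replicate e1 (j := 0) hpos
      have e3 := word_of_replicate e1 (j := j) (by omega)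
      rw [length_word, huv, length_superletter_a hN₀ hN] at e2 e3
      exact hper _ _ _ e2 e3 (by push_cast; ring)
    have hB : ((Nat.fib (Δ - 1) - 1 : ℕ) : ℝ) * |Nat.fib (N n + 1) * β -
        round (Nat.fib (N n + 1) * β : ℝ)| ≤ δ := by
      refine mul_abs_sub_round_le hδ4 fun j hj => ?_
      have hpos : 0 < Nat.fib (Δ - 1) := Nat.fib_pos.2 (by omega)
      have e1 : (s ++ (List.replicate (Nat.fib Δ) (superletter N n a)).flatten) ++
          (List.replicate (Nat.fib (Δ - 1)) (u' ++ word ξ i k ++ v')).flatten ++ t =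
          word ξ 0 (2 * Nat.fib (N (n + 2 + 1) + 2) + 1) := by
        rw [← hst, huv']; simp
      have e2 := word_of_replicate e1 (j := 0) hpos
      have e3 := word_of_replicate e1 (j := j) (by omega)
      rw [length_word, huv', length_superletter_b hN₀ hN] at e2 e3
      exact hper _ _ _ e2 e3 (by push_cast; ring)
    obtain ⟨M, hM⟩ : ∃ M, N n = M + 5 := ⟨N n - 5, by omega⟩
    have hFA : Nat.fib (M + 5) ≤ Nat.fib Δ := Nat.fib_mono (by omega)
    have hFB : Nat.fib (M + 4) ≤ Nat.fib (Δ - 1) := Nat.fib_mono (by omega)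
    have h3 : 3 ≤ Nat.fib (M + 4) := by
      exact Nat.fib_mono (show 4 ≤ M + 4 by omega)
    rw [hM] at hA hB
    have f1 : Nat.fib (M + 5 + 1) = Nat.fib (M + 4) + Nat.fib (M + 5) := Nat.fib_add_two
    have f2 : Nat.fib (M + 5) = Nat.fib (M + 3) + Nat.fib (M + 4) := Nat.fib_add_two
    have f3 : Nat.fib (M + 3) ≤ Nat.fib (M + 4) := Nat.fib_mono (by omega)
    set x := Nat.fib (M + 5 + 2) * β - round (Nat.fib (M + 5 + 2) * β : ℝ) with hx
    set x' := Nat.fib (M + 5 + 1) * β - round (Nat.fib (M + 5 + 1) * β : ℝ) with hx'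
    have g1 : Nat.fib (M + 5) * |x| ≤ 2 * δ := by
      have : ((Nat.fib (M + 5) : ℕ) : ℝ) ≤ 2 * ((Nat.fib Δ - 1 : ℕ) : ℝ) := by
        have : Nat.fib (M + 5) ≤ 2 * (Nat.fib Δ - 1) := by omega
        exact_mod_cast this
      nlinarith [abs_nonneg x]
    have g2 : Nat.fib (M + 5 + 1) * |x'| ≤ 6 * δ := by
      have : ((Nat.fib (M + 5 + 1) : ℕ) : ℝ) ≤ 6 * ((Nat.fib (Δ - 1) - 1 : ℕ) : ℝ) := by
        have : Nat.fib (M + 5 + 1) ≤ 6 * (Nat.fib (Δ - 1) - 1) := by omega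
        exact_mod_cast this
      nlinarith [abs_nonneg x']
    have hfib := fib_combination (M + 5)
    have hfibR : (Nat.fib (M + 5 + 1) : ℝ) * Nat.fib (M + 5 + 1) - Nat.fib (M + 5) * Nat.fib (M + 5 + 2) =
        (-1) ^ (M + 5) := by exact_mod_cast hfib
    -- The same integral combination is applied to the nearest integers; the sign (-1)^(M+5) is its
    -- own inverse.
    obtain ⟨z, hz⟩ : ∃ z : ℤ, |β - z| = |Nat.fib (M + 5 + 1) * x' - Nat.fib (M + 5) * x| := by
      refine ⟨(-1) ^ (M + 5) * (Nat.fib (M + 5 + 1) * round (Nat.fib (M + 5 + 1) * β : ℝ) -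
        Nat.fib (M + 5) * round (Nat.fib (M + 5 + 2) * β : ℝ)), ?_⟩
      have hs : ((-1 : ℝ) ^ (M + 5)) * (-1) ^ (M + 5) = 1 := by
        rw [← mul_pow]; simp
      have ha : |(-1 : ℝ) ^ (M + 5)| = 1 := by simp
      have e1 : Nat.fib (M + 5 + 1) * x' - Nat.fib (M + 5) * x = (-1) ^ (M + 5) * (β -
          ((-1) ^ (M + 5) * (Nat.fib (M + 5 + 1) * round (Nat.fib (M + 5 + 1) * β : ℝ) -
        Nat.fib (M + 5) * round (Nat.fib (M + 5 + 2) * β : ℝ)))) := by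
        rw [hx, hx']
        linear_combination β * hfibR + (Nat.fib (M + 5 + 1) * round (Nat.fib (M + 5 + 1) * β : ℝ) -
          Nat.fib (M + 5) * round (Nat.fib (M + 5 + 2) * β : ℝ)) * hs
      rw [e1, abs_mul, ha, one_mul]
      push_cast
      rfl
    calc |β - round β| ≤ |β - z| := round_le β z
      _ = |Nat.fib (M + 5 + 1) * x' - Nat.fib (M + 5) * x| := hz
      _ ≤ |Nat.fib (M + 5 + 1) * x'| + |Nat.fib (M + 5) * x| := abs_sub _ _
      _ = Nat.fib (M + 5 + 1) * |x'| + Nat.fib (M + 5) * |x| := by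
        rw [abs_mul, abs_mul, Nat.abs_cast, Nat.abs_cast]
      _ ≤ 8 * δ := by linarith
  by_contra hne
  have hpos : 0 < |β - round β| := abs_pos.2 (sub_ne_zero.2 (Ne.symm hne))
  have h1 := abs_sub_round β
  -- With δ a sixteenth of the distance d from β to the nearest integer, `key` would give d ≤ d/2.
  have := key (|β - round β| / 16) (by positivity) (by linarith)
  linarith

end Topological

/-! ### Repetitivity and the Meyer property -/

section Meyer

variable {N : ℕ → ℕ}

theorem isRepetitive (hN₀ : N 0 = 0) (hN : StrictMono N)
    {n₀ : ℕ} (h₀ : ∀ n ≥ n₀, Even n → 3 ≤ gap N n) {ξ : ℤ → Letter}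
    (hξ : ξ ∈ sequenceSpace N) (s : ℝ) : (tl ξ s).IsRepetitive := by
  intro R hR
  -- A window of length 2R meets tiles with at most this many consecutive indices, counted from a
  -- rounded-down start.
  set k : ℕ := ⌈2 * R⌉₊ + 2 with hk
  obtain ⟨L, hL⟩ := exists_recurrence hN₀ hN h₀ k
  refine ⟨L + 1, by positivity, fun x y => ?_⟩
  set i : ℤ := ⌊s + x - R⌋ with hi
  obtain ⟨j, hj, hw⟩ := hL ξ hξ i (i + ⌊y - x⌋)
  refine ⟨x + (⌊y - x⌋ + j : ℤ), ?_, ?_⟩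
  · have h1 := Int.floor_le (y - x)
    have h2 := Int.lt_floor_add_one (y - x)
    have h3 : (j : ℝ) ≤ L := by exact_mod_cast hj
    have h4 : (0 : ℝ) ≤ j := Nat.cast_nonneg j
    rw [abs_le]
    push_cast
    constructor <;> linarith
  · rw [Pattern.patch_eq_iff]
    intro p o hp
    rw [translate_tl, translate_tl, ← add_assoc, ← tl_shift, mem_tl, mem_tl]
    refine exists_congr fun n => and_congr_right fun hn => ?_
    rw [abs_le] at hp
    have h1 : i ≤ n := by
      have : (i : ℝ) ≤ n := (Int.floor_le _).trans (by rw [hn]; linarith)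
      exact_mod_cast this
    have h2 : n < i + k := by
      have h3 := Int.lt_floor_add_one (s + x - R)
      have h4 := Nat.le_ceil (2 * R)
      have : (n : ℝ) < (i + k : ℤ) := by
        rw [hn, hk]
        push_cast
        linarith
      exact_mod_cast this
    have h6 := congrFun (List.ofFn_injective hw) ⟨(n - i).toNat, by omega⟩
    simp only [Int.toNat_of_nonneg (show 0 ≤ n - i by omega)] at h6
    rw [shift_apply, show n + (⌊y - x⌋ + j) = i + ⌊y - x⌋ + j + (n - i) by ring, h6,
      show i + (n - i) = n by ring]

/-- A Delone set that encodes a tiling: the left endpoints of all tiles, and an additional point in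
each tile with label `a` or `b`, its position depending on the label. -/
def code (T : Pattern Letter) : Set ℝ :=
  {x | (∃ o, (x, o) ∈ T.pts) ∨ (x - 1 / 5, a) ∈ T.pts ∨ (x - 2 / 5, b) ∈ T.pts}

theorem mem_code {ξ : ℤ → Letter} {s x : ℝ} : x ∈ code (tl ξ s) ↔
    ∃ n : ℤ, (n : ℝ) = x + s ∨ ((n : ℝ) = x + s - 1 / 5 ∧ ξ n = a) ∨
      ((n : ℝ) = x + s - 2 / 5 ∧ ξ n = b) := by
  simp only [code, mem_ofPred_eq, mem_tl, exists_or]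
  refine or_congr ⟨fun ⟨o, n, h, _⟩ => ⟨n, h⟩, fun ⟨n, h⟩ => ⟨_, n, h, rfl⟩⟩ (or_congr ?_ ?_) <;>
  · refine exists_congr fun n => and_congr_left fun _ => ?_
    constructor <;> intro h <;> linarith

/-- Left endpoints are recognized by the empty slots 3/5 and 4/5 further on: a label point at 1/5 or
2/5 would see the next left endpoint there. -/
theorem mem_pts_iff_code {ξ : ℤ → Letter} {s x : ℝ} {o : Letter} : (x, o) ∈ (tl ξ s).pts ↔
    x ∈ code (tl ξ s) ∧ x + 3 / 5 ∉ code (tl ξ s) ∧ x + 4 / 5 ∉ code (tl ξ s) ∧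
      (x + 1 / 5 ∈ code (tl ξ s) ↔ o = a) ∧ (x + 2 / 5 ∈ code (tl ξ s) ↔ o = b) := by
  have hcast : ∀ {n m : ℤ} {j : ℤ}, (5 * n : ℝ) = 5 * m + j → 5 * n = 5 * m + j := by
    intro n m j h; exact_mod_cast h
  have key : ∀ n : ℤ, (n : ℝ) = x + s → x + 3 / 5 ∉ code (tl ξ s) ∧ x + 4 / 5 ∉ code (tl ξ s) ∧
      (x + 1 / 5 ∈ code (tl ξ s) ↔ ξ n = a) ∧ (x + 2 / 5 ∈ code (tl ξ s) ↔ ξ n = b) := by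
    intro n hn
    simp only [mem_code]
    refine ⟨?_, ?_, ⟨?_, fun h => ⟨n, Or.inr (Or.inl ⟨by linarith, h⟩)⟩⟩,
      ⟨?_, fun h => ⟨n, Or.inr (Or.inr ⟨by linarith, h⟩)⟩⟩⟩
    · rintro ⟨m, h | ⟨h, -⟩ | ⟨h, -⟩⟩
      · have := hcast (n := m) (m := n) (j := 3) (by push_cast; linarith); omega
      · have := hcast (n := m) (m := n) (j := 2) (by push_cast; linarith); omega
      · have := hcast (n := m) (m := n) (j := 1) (by push_cast; linarith); omega
    · rintro ⟨m, h | ⟨h, -⟩ | ⟨h, -⟩⟩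
      · have := hcast (n := m) (m := n) (j := 4) (by push_cast; linarith); omega
      · have := hcast (n := m) (m := n) (j := 3) (by push_cast; linarith); omega
      · have := hcast (n := m) (m := n) (j := 2) (by push_cast; linarith); omega
    · rintro ⟨m, h | ⟨h, h'⟩ | ⟨h, -⟩⟩
      · have := hcast (n := m) (m := n) (j := 1) (by push_cast; linarith); omega
      · have := hcast (n := m) (m := n) (j := 0) (by push_cast; linarith)
        rwa [show m = n by omega] at h'
      · have := hcast (n := m) (m := n) (j := -1) (by push_cast; linarith); omega
    · rintro ⟨m, h | ⟨h, -⟩ | ⟨h, h'⟩⟩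
      · have := hcast (n := m) (m := n) (j := 2) (by push_cast; linarith); omega
      · have := hcast (n := m) (m := n) (j := 1) (by push_cast; linarith); omega
      · have := hcast (n := m) (m := n) (j := 0) (by push_cast; linarith)
        rwa [show m = n by omega] at h'
  rw [mem_tl]
  constructor
  · rintro ⟨n, hn, rfl⟩
    exact ⟨mem_code.2 ⟨n, Or.inl hn⟩, key n hn⟩
  · rintro ⟨h, h3, h4, ha, hb⟩
    obtain ⟨n, hn | ⟨hn, h'⟩ | ⟨hn, h'⟩⟩ := mem_code.1 h
    · refine ⟨n, hn, ?_⟩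
      obtain ⟨-, -, ha', hb'⟩ := key n hn
      rw [ha'] at ha
      rw [hb'] at hb
      revert ha hb
      cases ξ n <;> cases o <;> simp
    · exact absurd (mem_code.2 ⟨n + 1, Or.inl (by push_cast; linarith)⟩) h4
    · exact absurd (mem_code.2 ⟨n + 1, Or.inl (by push_cast; linarith)⟩) h3

theorem patch_translate_eq_iff {A : Type} {T : Pattern A} {x y R : ℝ} :
    (T.translate x).patch R = (T.translate y).patch R ↔
      ∀ d o, |d| ≤ R → ((d + x, o) ∈ T.pts ↔ (d + y, o) ∈ T.pts) := Pattern.patch_eq_iff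

theorem isMLD_code (ξ : ℤ → Letter) (s : ℝ) : (tl ξ s).IsMLD (Pattern.ofSet (code (tl ξ s))) := by
  constructor
  · refine ⟨1, one_pos, fun x y h _ => ?_⟩
    rw [patch_translate_eq_iff] at h
    change x ∈ code _ ↔ y ∈ code _
    have h0 := fun o => h 0 o (by simp)
    have h1 := h (-(1 / 5)) a (by norm_num [abs_le])
    have h2 := h (-(2 / 5)) b (by norm_num [abs_le])
    simp only [zero_add] at h0
    rw [neg_add_eq_sub, neg_add_eq_sub] at h1 h2
    simp only [code, mem_ofPred_eq, h0, h1, h2]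
  · refine ⟨1, one_pos, fun x y h o => ?_⟩
    rw [patch_translate_eq_iff] at h
    have h' : ∀ d : ℝ, |d| ≤ 1 → (x + d ∈ code (tl ξ s) ↔ y + d ∈ code (tl ξ s)) := by
      intro d hd
      rw [add_comm x, add_comm y]
      exact h d () hd
    have h0 := h' 0 (by simp)
    rw [add_zero, add_zero] at h0
    rw [mem_pts_iff_code, mem_pts_iff_code, h0, h' (3 / 5) (by norm_num [abs_le]),
      h' (4 / 5) (by norm_num [abs_le]), h' (1 / 5) (by norm_num [abs_le]),
      h' (2 / 5) (by norm_num [abs_le])]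

theorem exists_circle_eq (z : Circle) : ∃ θ : ℝ, (z : ℂ) = Complex.exp (2 * Real.pi * Complex.I * θ) := by
  refine ⟨Complex.arg z / (2 * Real.pi), ?_⟩
  have h := congrArg (fun w : Circle => (w : ℂ)) (Circle.exp_arg z)
  simp only [Circle.coe_exp] at h
  refine h.symm.trans ?_
  congr 1
  have : (Real.pi : ℂ) ≠ 0 := by exact_mod_cast Real.pi_ne_zero
  push_cast
  field_simp

/-- Subsets of a coset of `c ℤ` that generate a group containing `c` are harmonious. -/
theorem isHarmonious_of_subset {Λ : Set ℝ} {u c : ℝ} (hc0 : c ≠ 0)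
    (hu : u ∈ AddSubgroup.closure Λ) (hc : c ∈ AddSubgroup.closure Λ)
    (h : ∀ x ∈ Λ, ∃ k : ℤ, x = u + k * c) : IsHarmonious Λ := by
  intro χ ε hε
  have hχ : ∀ (g : AddSubgroup.closure Λ) (k : ℤ), (χ (k • g) : ℂ) = (χ g : ℂ) ^ k := by
    intro g k
    rw [AddChar.map_zsmul_eq_zpow, Circle.coe_zpow]
  have hexp : ∀ (z : ℂ) (k : ℤ), Complex.exp z ^ k = Complex.exp (k * z) := fun z k =>
    (Complex.exp_int_mul z k).symm
  -- If u and c are incommensurable, the values of χ at them are independent and u must be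
  -- approximated; otherwise the generated group is cyclic and χ is the restriction of a continuous
  -- character.
  by_cases hirr : Irrational (u / c)
  · obtain ⟨θ, hθ⟩ := exists_circle_eq (χ ⟨c, hc⟩)
    obtain ⟨θ', hθ'⟩ := exists_circle_eq (χ ⟨u, hu⟩)
    have hd : DenseRange (· • ((u / c : ℝ) : UnitAddCircle) : ℤ → UnitAddCircle) :=
      AddCircle.denseRange_zsmul_coe_iff.2 (by simpa using hirr)
    set F : UnitAddCircle → ℂ := fun y =>
      Complex.exp (2 * Real.pi * Complex.I * θ') -
        Complex.exp (2 * Real.pi * Complex.I * (θ * (u / c) : ℝ)) * fourier 1 y with hF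
    have hFc : Continuous F := by fun_prop
    -- All frequencies (θ + m)/c have the right value at c. By density of the multiples of u/c
    -- modulo 1, some m is also right at u up to ε, and the error is the same on the whole coset.
    obtain ⟨m, hm⟩ := hd.exists_mem_open (isOpen_lt (hFc.norm) (continuous_const (y := ε)))
      ⟨((θ' - θ * (u / c) : ℝ) : UnitAddCircle), by
        simp only [mem_ofPred_eq, hF, fourier_coe_apply, ← Complex.exp_add]
        refine lt_of_eq_of_lt ?_ hε
        rw [norm_eq_zero, sub_eq_zero]
        congr 1
        push_cast
        ring⟩
    have hcC : (c : ℂ) ≠ 0 := by exact_mod_cast hc0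
    refine ⟨(θ + m) / c, fun x hx => ?_⟩
    obtain ⟨k, rfl⟩ := h x hx
    have e1 : (⟨u + k * c, AddSubgroup.subset_closure hx⟩ : AddSubgroup.closure Λ) =
        ⟨u, hu⟩ + k • ⟨c, hc⟩ := by
      apply Subtype.ext
      simp
    have e2 : Complex.exp (2 * Real.pi * Complex.I * ((θ + m) / c : ℝ) * (u + k * c : ℝ)) =
        Complex.exp (2 * Real.pi * Complex.I * (θ * (u / c) : ℝ)) *
          fourier 1 (m • ((u / c : ℝ) : UnitAddCircle)) *
          Complex.exp (2 * Real.pi * Complex.I * θ) ^ k := by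
      rw [← AddCircle.coe_zsmul, fourier_coe_apply, hexp, ← Complex.exp_add, ← Complex.exp_add,
        ← Complex.exp_periodic.int_mul (-(k * m))]
      congr 1
      push_cast
      field_simp
      ring_nf
      simp [hcC]
    have e3 : ‖Complex.exp (2 * Real.pi * Complex.I * θ) ^ k‖ = 1 := by
      rw [← hθ, norm_zpow, Circle.norm_coe, one_zpow]
    rw [e1, AddChar.map_add_eq_mul, Circle.coe_mul, hχ, hθ, hθ', e2, ← sub_mul, norm_mul, e3,
      mul_one]
    exact hm
  · have hcyc : IsAddCyclic (AddSubgroup.closure Λ) := by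
      obtain ⟨q, hq⟩ : ∃ q : ℚ, (q : ℝ) = u / c := by
        by_contra h'
        exact hirr fun ⟨q, hq⟩ => h' ⟨q, hq⟩
      have hle : AddSubgroup.closure Λ ≤ AddSubgroup.zmultiples (c / q.den) := by
        rw [AddSubgroup.closure_le]
        intro x hx
        obtain ⟨k, rfl⟩ := h x hx
        have hden : (q.den : ℝ) ≠ 0 := by exact_mod_cast q.den_nz
        have hu : u = q.num / q.den * c := by
          rw [Rat.cast_def] at hq
          rw [hq]
          field_simp
        refine ⟨q.num + k * q.den, ?_⟩
        simp only [zsmul_eq_mul]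
        rw [hu]
        push_cast
        field_simp
      exact isAddCyclic_of_injective (AddSubgroup.inclusion hle) (AddSubgroup.inclusion_injective hle)
    obtain ⟨d, hd⟩ := hcyc.exists_generator
    obtain ⟨θ, hθ⟩ := exists_circle_eq (χ d)
    have hd0 : (d : ℝ) ≠ 0 := by
      intro h0
      obtain ⟨k, hk⟩ := hd ⟨c, hc⟩
      have := congrArg (fun g : AddSubgroup.closure Λ => (g : ℝ)) hk
      simp [h0] at this
      exact hc0 this.symm
    refine ⟨θ / d, fun x hx => ?_⟩
    obtain ⟨k, hk⟩ := hd ⟨x, AddSubgroup.subset_closure hx⟩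
    have hx' : x = k * (d : ℝ) := by
      have := congrArg (fun g : AddSubgroup.closure Λ => (g : ℝ)) hk
      simpa using this.symm
    have hk : k • d = ⟨x, AddSubgroup.subset_closure hx⟩ := hk
    rw [← hk, hχ, hθ, hexp]
    have hdC : ((d : ℝ) : ℂ) ≠ 0 := by exact_mod_cast hd0
    have : (k : ℂ) * (2 * Real.pi * Complex.I * θ) =
        2 * Real.pi * Complex.I * (θ / d : ℝ) * x := by
      rw [hx']
      push_cast
      field_simp
    rw [this, sub_self, norm_zero]
    exact hε

theorem exists_eq_a (hN₀ : N 0 = 0) (hN : StrictMono N) {ξ : ℤ → Letter}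
    (hξ : ξ ∈ sequenceSpace N) : ∃ j, ξ j = a := by
  obtain ⟨j, -, h⟩ := exists_word_of_infix (superletter_a_infix_word hN₀ hN hξ 0 0)
  refine ⟨0 + j, ?_⟩
  simpa [superletter, word] using h.symm

theorem isMeyerSet_code (hN₀ : N 0 = 0) (hN : StrictMono N) {ξ : ℤ → Letter}
    (hξ : ξ ∈ sequenceSpace N) (s : ℝ) : IsMeyerSet (code (tl ξ s)) := by
  have hmem : ∀ n : ℤ, (n : ℝ) - s ∈ code (tl ξ s) := fun n => mem_code.2 ⟨n, Or.inl (by ring)⟩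
  refine ⟨⟨1, one_pos, fun x => ⟨⌊x + s⌋ - s, hmem _, ?_⟩⟩, ?_⟩
  · have h1 := Int.floor_le (x + s)
    have h2 := Int.lt_floor_add_one (x + s)
    rw [abs_le]
    constructor <;> linarith
  · obtain ⟨j, hj⟩ := exists_eq_a hN₀ hN hξ
    refine isHarmonious_of_subset (u := -s) (c := 1 / 5) (by norm_num) ?_ ?_ ?_
    · exact AddSubgroup.subset_closure (by simpa using hmem 0)
    · have h1 : (j : ℝ) - s + 1 / 5 ∈ code (tl ξ s) :=
        mem_code.2 ⟨j, Or.inr (Or.inl ⟨by ring, hj⟩)⟩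
      have := AddSubgroup.sub_mem _ (AddSubgroup.subset_closure h1)
        (AddSubgroup.subset_closure (hmem j))
      simpa using this
    · intro x hx
      obtain ⟨n, hn | ⟨hn, -⟩ | ⟨hn, -⟩⟩ := mem_code.1 hx
      · exact ⟨5 * n, by push_cast; linarith⟩
      · exact ⟨5 * n + 1, by push_cast; linarith⟩
      · exact ⟨5 * n + 2, by push_cast; linarith⟩

theorem isMeyer (hN₀ : N 0 = 0) (hN : StrictMono N) {ξ : ℤ → Letter}
    (hξ : ξ ∈ sequenceSpace N) (s : ℝ) : (tl ξ s).IsMeyer :=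
  ⟨_, isMeyerSet_code hN₀ hN hξ s, isMLD_code ξ s⟩

end Meyer

/-! ### Poisson summation and Parseval -/

section Fourier

theorem exists_schwartz_le (g : 𝓢(ℝ, ℂ)) : ∃ C : ℝ, 0 ≤ C ∧ ∀ y, (1 + y ^ 2) * ‖g y‖ ≤ C := by
  obtain ⟨C, hC, h1⟩ := g.decay 0 0
  obtain ⟨D, hD, h2⟩ := g.decay 2 0
  refine ⟨C + D, by positivity, fun y => ?_⟩
  have e1 := h1 y
  have e2 := h2 y
  simp only [norm_iteratedFDeriv_zero, pow_zero, one_mul, Real.norm_eq_abs, sq_abs] at e1 e2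
  linarith

/-- Sums of a Schwartz function over translates of the integers are uniformly bounded. -/
theorem exists_tsum_norm_le (g : 𝓢(ℝ, ℂ)) : ∃ B : ℝ, 0 ≤ B ∧ ∀ α : ℝ,
    Summable (fun k : ℤ => ‖g (α + k)‖) ∧ ∑' k : ℤ, ‖g (α + k)‖ ≤ B := by
  obtain ⟨C, hC, h⟩ := exists_schwartz_le g
  have hs : Summable fun k : ℤ => 2 * C * (1 / |(k : ℝ) + 1 / 2| ^ (2 : ℝ)) :=
    ((Real.summable_one_div_int_add_rpow (1 / 2) 2).2 one_lt_two).mul_left _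
  have hle : ∀ α : ℝ, α ∈ Ico (0 : ℝ) 1 → ∀ k : ℤ,
      ‖g (α + k)‖ ≤ 2 * C * (1 / |(k : ℝ) + 1 / 2| ^ (2 : ℝ)) := by
    intro α hα k
    have h0 : (0 : ℝ) < ((k : ℝ) + 1 / 2) ^ 2 := by
      refine sq_pos_of_ne_zero fun h0 => ?_
      have : (2 * k + 1 : ℤ) = 0 := by
        have : (2 * k + 1 : ℝ) = 0 := by linarith
        exact_mod_cast this
      omega
    rw [Real.rpow_two, sq_abs, mul_one_div, le_div_iff₀ h0]
    have h1 := h (α + k)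
    -- Comparison with the centre of [0, 1) is uniform in α, and k + 1/2 never vanishes.
    have h2 : ((k : ℝ) + 1 / 2) ^ 2 ≤ 2 * (1 + (α + k) ^ 2) := by
      nlinarith [sq_nonneg ((k : ℝ) + 2 * α - 1 / 2), hα.1, hα.2, mul_nonneg hα.1 (sub_nonneg.2 hα.2.le)]
    nlinarith [norm_nonneg (g (α + k))]
  refine ⟨∑' k : ℤ, 2 * C * (1 / |(k : ℝ) + 1 / 2| ^ (2 : ℝ)), tsum_nonneg fun k => by positivity,
    fun α => ?_⟩
  have e : (fun k : ℤ => ‖g (α + k)‖) =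
      (fun k : ℤ => ‖g (Int.fract α + k)‖) ∘ Equiv.addRight ⌊α⌋ := by
    funext k
    simp only [Function.comp_apply, Equiv.coe_addRight]
    congr 2
    push_cast
    rw [← Int.self_sub_floor]
    ring
  have hα : Int.fract α ∈ Ico (0 : ℝ) 1 := ⟨Int.fract_nonneg _, Int.fract_lt_one _⟩
  have h1 : Summable fun k : ℤ => ‖g (Int.fract α + k)‖ :=
    Summable.of_nonneg_of_le (fun _ => norm_nonneg _) (hle _ hα) hs
  rw [e]
  refine ⟨(Equiv.summable_iff _).2 h1, ?_⟩
  refine (Equiv.tsum_eq (Equiv.addRight ⌊α⌋) fun k : ℤ => ‖g (Int.fract α + k)‖).trans_le ?_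
  exact h1.tsum_le_tsum (hle _ hα) hs

/-- `e^{2 π i x}`. -/
def ee (x : ℝ) : ℂ := Complex.exp (2 * Real.pi * Complex.I * x)

theorem ee_add (x y : ℝ) : ee (x + y) = ee x * ee y := by
  rw [ee, ee, ee, ← Complex.exp_add]
  congr 1
  push_cast
  ring

theorem norm_ee (x : ℝ) : ‖ee x‖ = 1 := by
  rw [ee, show (2 * Real.pi * Complex.I * x : ℂ) = (2 * Real.pi * x : ℝ) * Complex.I by
    push_cast; ring]
  exact Complex.norm_exp_ofReal_mul_I _

theorem conj_ee (x : ℝ) : (starRingEnd ℂ) (ee x) = ee (-x) := by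
  rw [ee, ee, ← Complex.exp_conj]
  congr 1
  simp only [map_mul, Complex.conj_ofReal, Complex.conj_I, map_ofNat]
  push_cast
  ring

theorem fourier_coe_eq_ee (n : ℤ) (x : ℝ) : fourier n (x : UnitAddCircle) = ee (n * x) := by
  rw [fourier_coe_apply, ee]
  congr 1
  push_cast
  ring

theorem continuous_ee : Continuous ee := by unfold ee; fun_prop

/-- Poisson summation for a twisted Schwartz function. -/
theorem tsum_twisted (g : 𝓢(ℝ, ℂ)) (α δ : ℝ) :
    ∑' k : ℤ, ee (-((α + k) * δ)) * g (α + k) = ∑' m : ℤ, ee (m * α) * (𝓕 g) (m + δ) := by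
  -- Modulation by e(-yδ) translates the Fourier transform by δ; ordinary Poisson summation for G is
  -- then the claim.
  set G : ℝ → ℂ := fun y => ee (-(y * δ)) * g y with hG
  have hGc : Continuous G := (continuous_ee.comp (by fun_prop)).mul g.continuous
  have hF : 𝓕 G = fun y => (𝓕 g) (y + δ) := by
    funext y
    rw [SchwartzMap.fourier_coe, Real.fourier_real_eq_integral_exp_smul,
      Real.fourier_real_eq_integral_exp_smul]
    congr 1
    funext v
    simp only [hG, smul_eq_mul, ← mul_assoc, ee, ← Complex.exp_add]
    congr 2
    push_cast
    ring
  have hO : ∀ (f : 𝓢(ℝ, ℂ)) (δ : ℝ),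
      (fun y => f (y + δ)) =O[cocompact ℝ] fun y : ℝ => |y| ^ (-(2 : ℝ)) := by
    intro f δ
    obtain ⟨C, hC, h⟩ := exists_schwartz_le f
    refine Asymptotics.IsBigO.of_bound ((2 + 2 * δ ^ 2) * C) ?_
    have : ∀ᶠ y : ℝ in cocompact ℝ, y ≠ 0 :=
      (isCompact_singleton (x := (0 : ℝ))).compl_mem_cocompact
    filter_upwards [this] with y hy
    have hy2 : 0 < y ^ 2 := by positivity
    rw [Real.norm_of_nonneg (by positivity), Real.rpow_neg (abs_nonneg _), Real.rpow_two, sq_abs,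
      ← div_eq_mul_inv, le_div_iff₀ hy2]
    have h1 := h (y + δ)
    have h2 : y ^ 2 ≤ (2 + 2 * δ ^ 2) * (1 + (y + δ) ^ 2) := by
      nlinarith [sq_nonneg (y + 2 * δ), sq_nonneg (δ * (y + δ))]
    calc ‖f (y + δ)‖ * y ^ 2 ≤ ‖f (y + δ)‖ * ((2 + 2 * δ ^ 2) * (1 + (y + δ) ^ 2)) := by gcongr
      _ = (2 + 2 * δ ^ 2) * ((1 + (y + δ) ^ 2) * ‖f (y + δ)‖) := by ring
      _ ≤ _ := by gcongr
  have hGO : G =O[cocompact ℝ] fun y : ℝ => |y| ^ (-(2 : ℝ)) := by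
    refine (Asymptotics.IsBigO.of_norm_left ?_)
    have : (fun y => ‖G y‖) = fun y => ‖g (y + 0)‖ := by
      funext y
      rw [add_zero, hG, norm_mul, norm_ee, one_mul]
    rw [this]
    exact (hO g 0).norm_left
  have h := Real.tsum_eq_tsum_fourier_of_rpow_decay hGc one_lt_two hGO
    (by rw [hF]; exact hO (𝓕 g) δ) α
  rw [hF] at h
  rw [h]
  refine tsum_congr fun m => ?_
  rw [fourier_coe_eq_ee, mul_comm]

/-- The Fourier transform of a twisted comb, whose weights are given by a Fourier series. -/
theorem tsum_comb {u : ℤ → ℂ} (hu : Summable fun n => ‖u n‖) {c : ℤ → ℂ} {α δ : ℝ}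
    (hc : ∀ m : ℤ, HasSum (fun n => u n * ee (m * (n * α))) (c m)) (g : 𝓢(ℝ, ℂ)) :
    Summable (fun m : ℤ => ‖c m * (𝓕 g) (m + δ)‖) ∧
    Summable (fun p : ℤ × ℤ => ‖u p.1 * (ee (-((p.1 * α + p.2) * δ)) * g (p.1 * α + p.2))‖) ∧
    ∑' m : ℤ, c m * (𝓕 g) (m + δ) =
      ∑' p : ℤ × ℤ, u p.1 * (ee (-((p.1 * α + p.2) * δ)) * g (p.1 * α + p.2)) := by
  obtain ⟨B, hB, hgB⟩ := exists_tsum_norm_le g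
  obtain ⟨B', hB', hgB'⟩ := exists_tsum_norm_le (𝓕 g)
  have hFs : Summable fun m : ℤ => ‖(𝓕 g) (m + δ)‖ := by
    simpa [add_comm] using (hgB' δ).1
  -- Absolute summability of the double series, needed to exchange the sums before applying Poisson
  -- summation for each n.
  have hD : Summable fun p : ℤ × ℤ => ‖u p.1 * (ee (p.2 * (p.1 * α)) * (𝓕 g) (p.2 + δ))‖ := by
    have := Summable.mul_norm hu hFs
    refine this.congr fun p => ?_
    rw [norm_mul, norm_mul, norm_mul, norm_ee, one_mul]
  have hP : Summable (fun p : ℤ × ℤ =>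
      ‖u p.1 * (ee (-((p.1 * α + p.2) * δ)) * g (p.1 * α + p.2))‖) := by
    rw [summable_prod_of_nonneg fun _ => norm_nonneg _]
    have e : ∀ n k : ℤ, ‖u n * (ee (-((n * α + k) * δ)) * g (n * α + k))‖ =
        ‖u n‖ * ‖g (n * α + k)‖ := by
      intro n k
      rw [norm_mul, norm_mul, norm_ee, one_mul]
    simp only [e]
    refine ⟨fun n => (hgB (n * α)).1.mul_left _, ?_⟩
    simp only [tsum_mul_left]
    exact Summable.of_nonneg_of_le (fun n => mul_nonneg (norm_nonneg _)
      (tsum_nonneg fun _ => norm_nonneg _))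
      (fun n => mul_le_mul_of_nonneg_left (hgB (n * α)).2 (norm_nonneg _)) (hu.mul_right B)
  have hcb : ∀ m, ‖c m‖ ≤ ∑' n, ‖u n‖ := by
    intro m
    rw [← (hc m).tsum_eq]
    have h1 : ∀ n : ℤ, ‖u n * ee (m * (n * α))‖ = ‖u n‖ := fun n => by
      rw [norm_mul, norm_ee, mul_one]
    refine (norm_tsum_le_tsum_norm (by simpa only [h1] using hu)).trans ?_
    simp only [h1, le_refl]
  refine ⟨?_, hP, ?_⟩
  · refine Summable.of_nonneg_of_le (fun _ => norm_nonneg _) (fun m => ?_)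
      (hFs.mul_left (∑' n, ‖u n‖))
    rw [norm_mul]
    exact mul_le_mul_of_nonneg_right (hcb m) (norm_nonneg _)
  · calc ∑' m : ℤ, c m * (𝓕 g) (m + δ)
        = ∑' m : ℤ, ∑' n : ℤ, u n * (ee (m * (n * α)) * (𝓕 g) (m + δ)) := by
          refine tsum_congr fun m => ?_
          rw [← (hc m).tsum_eq, ← tsum_mul_right]
          exact tsum_congr fun n => by ring
      _ = ∑' n : ℤ, ∑' m : ℤ, u n * (ee (m * (n * α)) * (𝓕 g) (m + δ)) := by
          refine Summable.tsum_comm ?_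
          exact hD.of_norm
      _ = ∑' n : ℤ, ∑' k : ℤ, u n * (ee (-((n * α + k) * δ)) * g (n * α + k)) := by
          refine tsum_congr fun n => ?_
          rw [tsum_mul_left, tsum_mul_left, tsum_twisted]
      _ = _ := (hP.of_norm.tsum_prod).symm

/-- Parseval's identity for bounded functions, one of them rotated. -/
theorem hasSum_fourierCoeff_mul {U V : UnitAddCircle → ℂ} (hU : Measurable U) (hV : Measurable V)
    {C : ℝ} (hUC : ∀ x, ‖U x‖ ≤ C) (hVC : ∀ x, ‖V x‖ ≤ C) (t : ℝ) :
    HasSum (fun n : ℤ => fourierCoeff U n * (starRingEnd ℂ) (fourierCoeff V n) * ee (n * t))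
      (∫ x, U (x + (t : UnitAddCircle)) * (starRingEnd ℂ) (V x)) := by
  have hvol : (volume : Measure UnitAddCircle) = AddCircle.haarAddCircle := by
    rw [AddCircle.volume_eq_smul_haarAddCircle]
    simp
  set U' : UnitAddCircle → ℂ := fun x => U (x + (t : UnitAddCircle)) with hU'
  have hU'm : Measurable U' := hU.comp (measurable_add_const _)
  have hmem : ∀ W : UnitAddCircle → ℂ, Measurable W → (∀ x, ‖W x‖ ≤ C) →
      MemLp W 2 (AddCircle.haarAddCircle (T := 1)) := fun W hW hWC =>
    MemLp.of_bound hW.aestronglyMeasurable C (Eventually.of_forall hWC)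
  have mU := hmem U' hU'm fun x => hUC _
  have mV := hmem V hV hVC
  have h := (fourierBasis (T := 1)).hasSum_inner_mul_inner (mV.toLp V) (mU.toLp U')
  have e1 : inner ℂ (mV.toLp V) (mU.toLp U') =
      ∫ x, U (x + (t : UnitAddCircle)) * (starRingEnd ℂ) (V x) := by
    rw [L2.inner_def, hvol]
    refine integral_congr_ae ?_
    filter_upwards [mV.coeFn_toLp, mU.coeFn_toLp] with x h1 h2
    rw [h1, h2, RCLike.inner_apply]
  have hcoeff : ∀ (W : UnitAddCircle → ℂ) (m : MemLp W 2 (AddCircle.haarAddCircle (T := 1))) (n : ℤ),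
      inner ℂ (fourierBasis n) (m.toLp W) = fourierCoeff W n := by
    intro W m n
    rw [← (fourierBasis (T := 1)).repr_apply_apply, fourierBasis_repr]
    exact congrFun (fourierCoeff_congr_ae m.coeFn_toLp) n
  -- Rotating a function by t multiplies its n-th Fourier coefficient by e(nt), by invariance of the
  -- measure.
  have hrot : ∀ n : ℤ, fourierCoeff U' n = fourierCoeff U n * ee (n * t) := by
    intro n
    simp only [fourierCoeff, smul_eq_mul, hU']
    rw [← integral_mul_const]
    rw [← integral_add_right_eq_self (fun x => fourier (-n) x * U x * ee (n * t))
      (t : UnitAddCircle)]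
    congr 1
    funext x
    have : (fourier (-n) (x + (t : UnitAddCircle)) : ℂ) = fourier (-n) x * ee (-(n * t)) := by
      rw [fourier_apply, smul_add, AddCircle.toCircle_add, Circle.coe_mul, ← fourier_apply,
        ← fourier_apply, fourier_coe_eq_ee]
      push_cast
      rw [neg_mul]
    rw [this]
    have h1 : ee (-(n * t)) * ee (n * t) = 1 := by
      rw [← ee_add]
      simp [ee]
    linear_combination (-(fourier (-n) x : ℂ) * U (x + t)) * h1
  rw [e1] at h
  refine h.congr_fun fun n => ?_
  rw [hcoeff, ← inner_conj_symm, hcoeff, hrot]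
  ring

end Fourier

/-! ### Point sets that are locally derivable from a tiling -/

section LocalSets

variable {N : ℕ → ℕ}

theorem IsUniformlyDiscrete.finite_inter {Λ : Set ℝ} (h : IsUniformlyDiscrete Λ) (A B : ℝ) :
    (Λ ∩ Icc A B).Finite := by
  obtain ⟨r, hr, h⟩ := h
  refine Set.Finite.of_injOn (f := fun x => ⌊x / r⌋) (t := Icc ⌊A / r⌋ ⌊B / r⌋) ?_ ?_
    (Set.finite_Icc _ _)
  · rintro x ⟨-, h1, h2⟩
    exact ⟨Int.floor_le_floor (by gcongr), Int.floor_le_floor (by gcongr)⟩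
  · rintro x ⟨hx, -⟩ y ⟨hy, -⟩ hxy
    by_contra hne
    have h1 := h x hx y hy hne
    have h2 := Int.abs_sub_lt_one_of_floor_eq_floor hxy
    rw [← sub_div, abs_div, abs_of_pos hr, div_lt_one hr] at h2
    linarith

-- Each point of Λ is determined by its tile, its fractional position θ in the tile, and the labels
-- nearby. So Λ splits into finitely many combs, one for each θ, with 0–1 weights that are local
-- functions of the sequence.
open Classical in
theorem exists_local_description (hN₀ : N 0 = 0) (hN : StrictMono N)
    {n₀ : ℕ} (h₀ : ∀ n ≥ n₀, Even n → 3 ≤ gap N n) {ξ : ℤ → Letter} (hξ : ξ ∈ sequenceSpace N)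
    {s : ℝ} {Λ : Set ℝ} (hud : IsUniformlyDiscrete Λ)
    (hld : (Pattern.ofSet Λ).IsLocallyDerivable (tl ξ s)) :
    ∃ (Θ : Finset ℝ) (r : ℕ) (w : ℝ → (ℤ → Letter) → ℝ), (∀ θ ∈ Θ, θ ∈ Ico (0 : ℝ) 1) ∧
      (∀ θ, IsLocal r (w θ)) ∧ (∀ θ η, w θ η = 0 ∨ w θ η = 1) ∧
      ∀ x, x ∈ Λ ↔ Int.fract (x + s) ∈ Θ ∧ w (Int.fract (x + s)) (shift ⌊x + s⌋ ξ) = 1 := by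
  obtain ⟨R, hR, hld⟩ := hld
  set r : ℕ := ⌈R⌉₊ + 1 with hr
  have hrR : R + 1 ≤ r := by
    rw [hr]; push_cast; linarith [Nat.le_ceil R]
  have hagree : ∀ (n n' : ℤ) (θ : ℝ), θ ∈ Ico (0 : ℝ) 1 →
      (∀ j : ℤ, |j| ≤ r → shift n ξ j = shift n' ξ j) → n - s + θ ∈ Λ → n' - s + θ ∈ Λ := by
    intro n n' θ hθ h hn
    refine (hld _ _ (patch_translate_eq_iff.2 fun d o hd => ?_) ()).1 hn
    rw [mem_tl, mem_tl]
    have key : ∀ j : ℤ, (j : ℝ) = d + θ → ξ (j + n) = ξ (j + n') := by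
      intro j hj
      refine h j ?_
      have : |(j : ℝ)| ≤ r := by
        rw [hj]
        exact (abs_add_le _ _).trans (by rw [abs_of_nonneg hθ.1]; linarith [hθ.2])
      exact_mod_cast this
    constructor
    · rintro ⟨m, hm, h'⟩
      refine ⟨m - n + n', by push_cast; linarith, ?_⟩
      rw [← key (m - n) (by push_cast; linarith), sub_add_cancel, h']
    · rintro ⟨m, hm, h'⟩
      refine ⟨m - n' + n, by push_cast; linarith, ?_⟩
      rw [key (m - n') (by push_cast; linarith), sub_add_cancel, h']
  have hdec : ∀ x : ℝ, (⌊x + s⌋ : ℝ) - s + Int.fract (x + s) = x := fun x => by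
    have := Int.floor_add_fract (x + s); linarith
  have hfr : ∀ x : ℝ, Int.fract (x + s) ∈ Ico (0 : ℝ) 1 := fun x =>
    ⟨Int.fract_nonneg _, Int.fract_lt_one _⟩
  obtain ⟨L, hL⟩ := exists_recurrence hN₀ hN h₀ (2 * r + 1)
  -- By recurrence each fractional position already occurs in a fixed bounded window, where Λ has
  -- finitely many points.
  have hfin : {θ : ℝ | ∃ x ∈ Λ, Int.fract (x + s) = θ}.Finite := by
    refine ((hud.finite_inter (-s) (L + r + 1 - s)).image fun x => Int.fract (x + s)).subset ?_
    rintro _ ⟨x, hx, rfl⟩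
    obtain ⟨j, hj, hw⟩ := hL ξ hξ (⌊x + s⌋ - r) 0
    have h1 : ((0 + j + r : ℤ) : ℝ) - s + Int.fract (x + s) ∈ Λ := by
      refine hagree ⌊x + s⌋ _ _ (hfr x) (fun i hi => ?_) (by rwa [hdec])
      rw [abs_le] at hi
      have h6 := congrFun (List.ofFn_injective hw) ⟨(i + r).toNat, by omega⟩
      simp only [Int.toNat_of_nonneg (show 0 ≤ i + r by omega)] at h6
      rw [shift_apply, shift_apply, show i + (0 + j + r) = 0 + j + (i + r) by ring, h6]
      congr 1
      ring
    have hjL : (j : ℝ) ≤ L := by exact_mod_cast hj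
    refine ⟨_, ⟨h1, ?_, ?_⟩, ?_⟩
    · push_cast
      have h2 : (0 : ℝ) ≤ j := Nat.cast_nonneg j
      have h3 : (0 : ℝ) ≤ r := Nat.cast_nonneg r
      linarith [(hfr x).1]
    · push_cast
      linarith [(hfr x).2]
    · have : ((0 + j + r : ℤ) : ℝ) - s + Int.fract (x + s) + s =
          Int.fract (x + s) + (0 + j + r : ℤ) := by ring
      simp only [this, Int.fract_add_intCast, Int.fract_fract]
  -- The weight is 1 if η agrees near the origin with some place of ξ that carries a point; by
  -- `hagree` the choice of place is immaterial.
  refine ⟨hfin.toFinset, r, fun θ η =>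
    if ∃ n : ℤ, (∀ j : ℤ, |j| ≤ r → shift n ξ j = η j) ∧ (n : ℝ) - s + θ ∈ Λ then 1 else 0,
    ?_, ?_, ?_, ?_⟩
  · intro θ hθ
    obtain ⟨x, -, rfl⟩ := hfin.mem_toFinset.1 hθ
    exact hfr x
  · intro θ η η' h
    have : (∃ n : ℤ, (∀ j : ℤ, |j| ≤ r → shift n ξ j = η j) ∧ (n : ℝ) - s + θ ∈ Λ) ↔
        ∃ n : ℤ, (∀ j : ℤ, |j| ≤ r → shift n ξ j = η' j) ∧ (n : ℝ) - s + θ ∈ Λ :=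
      exists_congr fun n => and_congr_left fun _ =>
        forall_congr' fun j => forall_congr' fun hj => by rw [h j hj]
    simp only [this]
  · intro θ η
    dsimp only
    split_ifs <;> simp
  · intro x
    rw [hfin.mem_toFinset]
    dsimp only
    constructor
    · intro hx
      exact ⟨⟨x, hx, rfl⟩, if_pos ⟨⌊x + s⌋, fun _ _ => rfl, by rwa [hdec]⟩⟩
    · rintro ⟨-, h⟩
      by_contra hx
      rw [if_neg] at h
      · norm_num at h
      · rintro ⟨n, hn, hnΛ⟩
        refine hx ?_
        have := hagree n ⌊x + s⌋ _ (hfr x) hn hnΛ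
        rwa [hdec] at this

/-! ### Frequencies as integrals -/

open Classical in
theorem IsLocal.measurable {r : ℕ} {f : (ℤ → Letter) → ℝ} (hf : IsLocal r f) : Measurable f := by
  set I : Finset ℤ := Finset.Icc (-r : ℤ) r
  have h : f = (fun v : I → Letter => f fun j => if hj : j ∈ I then v ⟨j, hj⟩ else e) ∘ I.restrict := by
    funext ξ
    refine hf _ _ fun j hj => ?_
    have : j ∈ I := Finset.mem_Icc.2 (abs_le.1 hj)
    simp [this]
  rw [h]
  exact Measurable.of_discrete.comp (Finset.measurable_restrict I)

/-- Integrating the uniform estimate for orbit sums over the circle, where rotation invariance makes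
all terms equal, identifies the frequency. -/
theorem abs_orbitSum_sub_le (hN₀ : N 0 = 0) (hN : StrictMono N)
    (hsum : Summable fun κ : {κ : ℕ // Odd κ} => (φ ^ gap N ((κ : ℕ) + 1))⁻¹)
    {r : ℕ} {f : (ℤ → Letter) → ℝ} (hf : IsLocal r f) (h0 : ∀ ξ, 0 ≤ f ξ) (h1 : ∀ ξ, f ξ ≤ 1) :
    ∀ ε > 0, ∃ L : ℕ, ∀ ξ ∈ sequenceSpace N, ∀ (p : ℤ) (n : ℕ), L ≤ n →
      |orbitSum f ξ p n - (∫ x, f (seq N x)) * n| ≤ ε * n := by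
  obtain ⟨ρ, hρ⟩ := exists_frequency hN₀ hN (sequenceSpace_nonempty hN₀ hN hsum) hf h0 h1
  suffices h : ∫ x, f (seq N x) = ρ by rwa [h]
  have hfm : Measurable fun x => f (seq N x) := hf.measurable.comp measurable_seq
  have hfi : Integrable fun x => f (seq N x) :=
    Integrable.of_bound hfm.aestronglyMeasurable 1 (Eventually.of_forall fun x => by
      rw [Real.norm_of_nonneg (h0 _)]; exact h1 _)
  have hi : ∀ i : ℕ, (fun x => f (shift (0 + i) (seq N x))) =
      fun x => f (seq N (x + (((i : ℤ) * φ : ℝ) : UnitAddCircle))) := by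
    intro i
    funext x
    rw [seq_add, zero_add]
  have hint : ∀ n : ℕ, ∫ x, orbitSum f (seq N x) 0 n = n * ∫ x, f (seq N x) := by
    intro n
    unfold orbitSum
    rw [integral_finsetSum]
    · rw [Finset.sum_congr rfl fun i _ => (congrArg (fun F => ∫ x, F x) (hi i)).trans
        (integral_add_right_eq_self (fun x => f (seq N x)) _)]
      simp
    · intro i _
      rw [hi i]
      exact hfi.comp_add_right _
  have key : ∀ ε > 0, |(∫ x, f (seq N x)) - ρ| ≤ ε := by
    intro ε hε
    obtain ⟨L, hL⟩ := hρ ε hε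
    have hn : (0 : ℝ) < (L + 1 : ℕ) := by positivity
    have hoi : Integrable fun x => orbitSum f (seq N x) 0 (L + 1) := by
      unfold orbitSum
      refine integrable_finsetSum _ fun i _ => ?_
      rw [hi i]
      exact hfi.comp_add_right _
    have h2 : ‖∫ x, (orbitSum f (seq N x) 0 (L + 1) - ρ * (L + 1 : ℕ))‖ ≤ ε * (L + 1 : ℕ) := by
      refine (norm_integral_le_of_norm_le_const (C := ε * (L + 1 : ℕ)) ?_).trans (by simp)
      filter_upwards [ae_allGood hN hsum] with x hx
      exact hL _ (seq_mem hN₀ hN hx) 0 (L + 1) (Nat.le_succ L)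
    rw [integral_sub hoi (integrable_const _), hint, integral_const, probReal_univ, one_smul,
      Real.norm_eq_abs, mul_comm ρ, ← mul_sub, abs_mul, abs_of_pos hn, mul_comm] at h2
    exact le_of_mul_le_mul_right h2 hn
  have := le_of_forall_pos_le_add (a := |(∫ x, f (seq N x)) - ρ|) (b := 0)
    fun ε hε => by simpa using key ε hε
  exact sub_eq_zero.1 (abs_nonpos_iff.1 this)

/-- Uniform averages allow moving windows whose length is 2R up to a bounded error, and hold for
every sequence of the space, not just almost every one. -/
theorem tendsto_sum_Icc (hN₀ : N 0 = 0) (hN : StrictMono N)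
    (hsum : Summable fun κ : {κ : ℕ // Odd κ} => (φ ^ gap N ((κ : ℕ) + 1))⁻¹)
    {r : ℕ} {f : (ℤ → Letter) → ℝ} (hf : IsLocal r f) (h0 : ∀ ξ, 0 ≤ f ξ) (h1 : ∀ ξ, f ξ ≤ 1)
    {ξ : ℤ → Letter} (hξ : ξ ∈ sequenceSpace N) {p q : ℝ → ℤ} {K : ℝ}
    (hpq : ∀ R, |(q R : ℝ) - p R - 2 * R| ≤ K) :
    Tendsto (fun R : ℝ => (2 * R)⁻¹ * ∑ n ∈ Finset.Icc (p R) (q R), f (shift n ξ)) atTop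
      (𝓝 (∫ x, f (seq N x))) := by
  have hfr := abs_orbitSum_sub_le hN₀ hN hsum hf h0 h1
  set ρ := ∫ x, f (seq N x)
  rw [Metric.tendsto_atTop]
  intro ε hε
  obtain ⟨L, hL⟩ := hfr (ε / 4) (by positivity)
  have hK : 0 ≤ K := (abs_nonneg _).trans (hpq 0)
  refine ⟨L + K + 1 + 4 * |ρ| * (K + 1) / ε, fun R hR => ?_⟩
  have hLn : (0 : ℝ) ≤ L := Nat.cast_nonneg L
  have hq : 0 ≤ 4 * |ρ| * (K + 1) / ε := by positivity
  have hR0 : 0 < R := by linarith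
  have h2 := abs_le.1 (hpq R)
  have hpos : 0 ≤ q R + 1 - p R := by
    have : (0 : ℝ) ≤ (q R + 1 - p R : ℤ) := by push_cast; linarith
    exact_mod_cast this
  set n := (q R + 1 - p R).toNat with hn
  have hnR : (n : ℝ) = q R + 1 - p R := by
    have : (n : ℤ) = q R + 1 - p R := Int.toNat_of_nonneg hpos
    exact_mod_cast this
  have hsumeq : ∑ n ∈ Finset.Icc (p R) (q R), f (shift n ξ) = orbitSum f ξ (p R) n := by
    rw [Int.Icc_eq_finset_map, Finset.sum_map]
    rfl
  have hLe : L ≤ n := by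
    have : (L : ℝ) ≤ n := by rw [hnR]; linarith
    exact_mod_cast this
  have h3 := hL ξ hξ (p R) n hLe
  rw [hsumeq, Real.dist_eq]
  have h4 : (2 * R)⁻¹ * orbitSum f ξ (p R) n - ρ =
      (2 * R)⁻¹ * ((orbitSum f ξ (p R) n - ρ * n) + ρ * (n - 2 * R)) := by
    field_simp
    ring
  rw [h4, abs_mul, abs_of_pos (by positivity : 0 < (2 * R)⁻¹), inv_mul_lt_iff₀ (by positivity)]
  have h5 : |(n : ℝ) - 2 * R| ≤ K + 1 := by rw [abs_le, hnR]; constructor <;> linarith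
  have h6 : |ρ| * (K + 1) * 4 ≤ ε * R := by
    have : 4 * |ρ| * (K + 1) / ε ≤ R := by linarith
    rw [div_le_iff₀ hε] at this
    linarith
  have h7 : (n : ℝ) ≤ 3 * R := by rw [hnR]; linarith
  calc |(orbitSum f ξ (p R) n - ρ * n) + ρ * (n - 2 * R)|
      ≤ |orbitSum f ξ (p R) n - ρ * n| + |ρ * (n - 2 * R)| := abs_add_le _ _
    _ ≤ ε / 4 * n + |ρ| * (K + 1) := by
        rw [abs_mul]
        gcongr
    _ ≤ ε / 4 * (3 * R) + ε * R / 4 := by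
        gcongr
        linarith
    _ < 2 * R * ε := by nlinarith

end LocalSets

/-! ### Diffraction -/

section Diffraction

variable {N : ℕ → ℕ} {Θ : Finset ℝ} {r : ℕ} {w : ℝ → (ℤ → Letter) → ℝ}

/-- The product of two local functions, one of them shifted. -/
def pairFun (w : ℝ → (ℤ → Letter) → ℝ) (θ θ' : ℝ) (m : ℤ) (η : ℤ → Letter) : ℝ :=
  w θ (shift m η) * w θ' η

theorem isLocal_pairFun (hw : ∀ θ, IsLocal r (w θ)) (θ θ' : ℝ) (m : ℤ) :
    IsLocal (r + m.natAbs) (pairFun w θ θ' m) := by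
  intro ξ η h
  have h1 : w θ (shift m ξ) = w θ (shift m η) := hw θ _ _ fun j hj => by
    rw [shift_apply, shift_apply]
    refine h _ ((abs_add_le _ _).trans ?_)
    push_cast
    linarith
  have h2 : w θ' ξ = w θ' η := hw θ' _ _ fun j hj => h j (hj.trans (by push_cast; linarith [abs_nonneg m]))
  rw [pairFun, pairFun, h1, h2]

theorem pairFun_nonneg (h01 : ∀ θ η, w θ η = 0 ∨ w θ η = 1) (θ θ' : ℝ) (m : ℤ) (η : ℤ → Letter) :
    0 ≤ pairFun w θ θ' m η := by
  rw [pairFun]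
  rcases h01 θ (shift m η) with h | h <;> rcases h01 θ' η with h' | h' <;> simp [h, h']

theorem pairFun_le_one (h01 : ∀ θ η, w θ η = 0 ∨ w θ η = 1) (θ θ' : ℝ) (m : ℤ) (η : ℤ → Letter) :
    pairFun w θ θ' m η ≤ 1 := by
  rw [pairFun]
  rcases h01 θ (shift m η) with h | h <;> rcases h01 θ' η with h' | h' <;> simp [h, h']

/-- The autocorrelation coefficients. -/
def correlation (N : ℕ → ℕ) (w : ℝ → (ℤ → Letter) → ℝ) (θ θ' : ℝ) (m : ℤ) : ℝ :=
  ∫ x, pairFun w θ θ' m (seq N x)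

theorem correlation_nonneg (h01 : ∀ θ η, w θ η = 0 ∨ w θ η = 1) (θ θ' : ℝ) (m : ℤ) :
    0 ≤ correlation N w θ θ' m := integral_nonneg fun _ => pairFun_nonneg h01 _ _ _ _

open Classical in
/-- The number of pairs of points of `Λ ∩ [-R, R]` with given difference, as a sum over the tiles. -/
theorem sum_pairs_eq {ξ : ℤ → Letter} {s : ℝ} {Λ : Set ℝ}
    (h01 : ∀ θ η, w θ η = 0 ∨ w θ η = 1)
    (hΛ : ∀ x, x ∈ Λ ↔ Int.fract (x + s) ∈ Θ ∧ w (Int.fract (x + s)) (shift ⌊x + s⌋ ξ) = 1)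
    {θ θ' : ℝ} (hθ : θ ∈ Θ) (hθ' : θ' ∈ Θ) (hθI : θ ∈ Ico (0 : ℝ) 1) (hθI' : θ' ∈ Ico (0 : ℝ) 1)
    (m : ℤ) {R : ℝ} {F : Finset ℝ} (hF : ∀ x, x ∈ F ↔ x ∈ Λ ∧ x ∈ Icc (-R) R) :
    (((F ×ˢ F).filter fun p : ℝ × ℝ => Int.fract (p.1 + s) = θ ∧ Int.fract (p.2 + s) = θ' ∧
      ⌊p.1 + s⌋ - ⌊p.2 + s⌋ = m).card : ℝ) =
    ∑ n ∈ Finset.Icc (max ⌈-R - (θ' - s)⌉ ⌈-R - (θ + m - s)⌉)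
      (min ⌊R - (θ' - s)⌋ ⌊R - (θ + m - s)⌋), pairFun w θ θ' m (shift n ξ) := by
  have h1 : ∀ n : ℤ, pairFun w θ θ' m (shift n ξ) =
      if w θ (shift (n + m) ξ) = 1 ∧ w θ' (shift n ξ) = 1 then 1 else 0 := by
    intro n
    rw [pairFun, shift_shift, add_comm m n]
    rcases h01 θ (shift (n + m) ξ) with h | h <;> rcases h01 θ' (shift n ξ) with h' | h' <;>
      simp [h, h']
  simp only [h1]
  rw [Finset.sum_boole, Nat.cast_inj]
  have hfloor : ∀ (n : ℤ) (ϑ : ℝ), ϑ ∈ Ico (0 : ℝ) 1 → ⌊(n : ℝ) - s + ϑ + s⌋ = n ∧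
      Int.fract ((n : ℝ) - s + ϑ + s) = ϑ := by
    intro n ϑ h
    have e : (n : ℝ) - s + ϑ + s = n + ϑ := by ring
    rw [e]
    exact ⟨by rw [Int.floor_intCast_add, Int.floor_eq_zero_iff.2 h, add_zero],
      by rw [Int.fract_intCast_add, Int.fract_eq_self.2 h]⟩
  have hdec : ∀ x : ℝ, x = (⌊x + s⌋ : ℝ) - s + Int.fract (x + s) := fun x => by
    have := Int.floor_add_fract (x + s); linarith
  -- A pair in the class is determined by the tile index of its second point; the window becomes an
  -- interval of indices.
  refine Finset.card_nbij' (fun p => ⌊p.2 + s⌋)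
    (fun n => (((n + m : ℤ) : ℝ) - s + θ, (n : ℝ) - s + θ')) ?_ ?_ ?_ ?_
  · rintro ⟨x, y⟩ hp
    simp only [Finset.coe_filter, Finset.mem_product, mem_ofPred_eq, hF] at hp
    obtain ⟨⟨⟨hx, hxR⟩, hy, hyR⟩, e1, e2, e3⟩ := hp
    have dx := hdec x
    have dy := hdec y
    have e4 : ⌊x + s⌋ = ⌊y + s⌋ + m := by omega
    rw [e1, e4] at dx
    rw [e2] at dy
    push_cast at dx
    simp only [Finset.coe_filter, mem_ofPred_eq, Finset.mem_Icc, max_le_iff, le_min_iff,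
      Int.ceil_le, Int.le_floor]
    refine ⟨⟨⟨?_, ?_⟩, ?_, ?_⟩, ?_, ?_⟩
    · linarith [hyR.1]
    · linarith [hxR.1]
    · linarith [hyR.2]
    · linarith [hxR.2]
    · have := ((hΛ x).1 hx).2
      rwa [e1, e4] at this
    · have := ((hΛ y).1 hy).2
      rwa [e2] at this
  · intro n hn
    simp only [Finset.coe_filter, mem_ofPred_eq, Finset.mem_Icc, max_le_iff, le_min_iff,
      Int.ceil_le, Int.le_floor] at hn
    obtain ⟨⟨⟨a1, a2⟩, a3, a4⟩, a5, a6⟩ := hn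
    obtain ⟨f1, f2⟩ := hfloor (n + m) θ hθI
    obtain ⟨f3, f4⟩ := hfloor n θ' hθI'
    simp only [Finset.coe_filter, Finset.mem_product, mem_ofPred_eq, hF, hΛ, f1, f2, f3, f4]
    refine ⟨⟨⟨⟨hθ, a5⟩, ?_, ?_⟩, ⟨hθ', a6⟩, ?_, ?_⟩, trivial, trivial, by ring⟩
    · push_cast; linarith
    · push_cast; linarith
    · linarith
    · linarith
  · rintro ⟨x, y⟩ hp
    simp only [Finset.coe_filter, Finset.mem_product, mem_ofPred_eq] at hp
    obtain ⟨-, e1, e2, e3⟩ := hp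
    have e4 : ⌊y + s⌋ + m = ⌊x + s⌋ := by omega
    refine Prod.ext ?_ ?_
    · simp only [e4]
      rw [← e1]
      exact (hdec x).symm
    · simp only
      rw [← e2]
      exact (hdec y).symm
  · intro n _
    exact (hfloor n θ' hθI').1

open Classical in
theorem tendsto_autocorrelation (hN₀ : N 0 = 0) (hN : StrictMono N)
    (hsum : Summable fun κ : {κ : ℕ // Odd κ} => (φ ^ gap N ((κ : ℕ) + 1))⁻¹)
    {ξ : ℤ → Letter} (hξ : ξ ∈ sequenceSpace N) {s : ℝ} {Λ : Set ℝ} (hud : IsUniformlyDiscrete Λ)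
    (hΘ : ∀ θ ∈ Θ, θ ∈ Ico (0 : ℝ) 1) (hw : ∀ θ, IsLocal r (w θ))
    (h01 : ∀ θ η, w θ η = 0 ∨ w θ η = 1)
    (hΛ : ∀ x, x ∈ Λ ↔ Int.fract (x + s) ∈ Θ ∧ w (Int.fract (x + s)) (shift ⌊x + s⌋ ξ) = 1)
    {f : ℝ → ℂ} {M : ℤ} (hM : ∀ x : ℝ, (M : ℝ) ≤ |x| + 1 → f x = 0) :
    Tendsto (fun R : ℝ => (2 * R : ℂ)⁻¹ *
        ∑ᶠ x ∈ Λ ∩ Icc (-R) R, ∑ᶠ y ∈ Λ ∩ Icc (-R) R, f (x - y))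
      atTop (𝓝 (∑ θ ∈ Θ, ∑ θ' ∈ Θ, ∑ m ∈ Finset.Icc (-M) M,
        (correlation N w θ θ' m : ℂ) * f (m + θ - θ'))) := by
  have hR : ∀ R : ℝ, ∑ᶠ x ∈ Λ ∩ Icc (-R) R, ∑ᶠ y ∈ Λ ∩ Icc (-R) R, f (x - y) =
      ∑ θ ∈ Θ, ∑ θ' ∈ Θ, ∑ m ∈ Finset.Icc (-M) M,
        ((∑ n ∈ Finset.Icc (max ⌈-R - (θ' - s)⌉ ⌈-R - (θ + m - s)⌉)
          (min ⌊R - (θ' - s)⌋ ⌊R - (θ + m - s)⌋), pairFun w θ θ' m (shift n ξ) : ℝ) : ℂ) *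
          f (m + θ - θ') := by
    intro R
    set F := (hud.finite_inter (-R) R).toFinset with hFdef
    have hF : ∀ x, x ∈ F ↔ x ∈ Λ ∧ x ∈ Icc (-R) R := fun x => by
      rw [hFdef, Set.Finite.mem_toFinset]; rfl
    simp only [finsum_mem_eq_finite_toFinset_sum _ (hud.finite_inter (-R) R)]
    rw [← hFdef, ← Finset.sum_product']
    -- The difference of two points depends only on their fractional positions and the difference of
    -- their tile indices, and only finitely many such classes meet the support of f.
    set κ : ℝ × ℝ → ℝ × ℝ × ℤ := fun p =>
      (Int.fract (p.1 + s), Int.fract (p.2 + s), ⌊p.1 + s⌋ - ⌊p.2 + s⌋) with hκ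
    have hd : ∀ p : ℝ × ℝ, p.1 - p.2 = ((κ p).2.2 : ℝ) + (κ p).1 - (κ p).2.1 := by
      intro p
      have h1 := Int.floor_add_fract (p.1 + s)
      have h2 := Int.floor_add_fract (p.2 + s)
      simp only [hκ]
      push_cast
      linarith
    have hvan : ∀ p ∈ F ×ˢ F, κ p ∉ Θ ×ˢ Θ ×ˢ Finset.Icc (-M) M → f (p.1 - p.2) = 0 := by
      intro p hp hκp
      rw [Finset.mem_product, hF, hF] at hp
      refine hM _ ?_
      by_contra! hlt
      refine hκp ?_
      simp only [Finset.mem_product, Finset.mem_Icc]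
      refine ⟨((hΛ _).1 hp.1.1).1, ((hΛ _).1 hp.2.1).1, ?_⟩
      have h1 := hd p
      have b1 : Int.fract (p.1 + s) ∈ Ico (0 : ℝ) 1 := ⟨Int.fract_nonneg _, Int.fract_lt_one _⟩
      have b2 : Int.fract (p.2 + s) ∈ Ico (0 : ℝ) 1 := ⟨Int.fract_nonneg _, Int.fract_lt_one _⟩
      have h2 := abs_le.1 (le_refl |p.1 - p.2|)
      have c1 : ((-M : ℤ) : ℝ) ≤ ((κ p).2.2 : ℝ) := by
        push_cast
        have : (κ p).1 < 1 := b1.2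
        have : 0 ≤ (κ p).2.1 := b2.1
        linarith
      have c2 : ((κ p).2.2 : ℝ) ≤ (M : ℝ) := by
        have : 0 ≤ (κ p).1 := b1.1
        have : (κ p).2.1 < 1 := b2.2
        linarith
      exact ⟨by exact_mod_cast c1, by exact_mod_cast c2⟩
    have hcard : ∀ t ∈ Θ ×ˢ Θ ×ˢ Finset.Icc (-M) M,
        ∑ p ∈ F ×ˢ F, (if κ p = t then f (p.1 - p.2) else 0) =
        ((∑ n ∈ Finset.Icc (max ⌈-R - (t.2.1 - s)⌉ ⌈-R - (t.1 + t.2.2 - s)⌉)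
          (min ⌊R - (t.2.1 - s)⌋ ⌊R - (t.1 + t.2.2 - s)⌋),
            pairFun w t.1 t.2.1 t.2.2 (shift n ξ) : ℝ) : ℂ) * f (t.2.2 + t.1 - t.2.1) := by
      rintro ⟨θ, θ', m⟩ ht
      simp only [Finset.mem_product] at ht
      rw [← sum_pairs_eq h01 hΛ ht.1 ht.2.1 (hΘ _ ht.1) (hΘ _ ht.2.1) m hF, ← Finset.sum_filter]
      have e : ∀ p ∈ (F ×ˢ F).filter (fun p => κ p = (θ, θ', m)),
          f (p.1 - p.2) = f (m + θ - θ') := by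
        intro p hp
        rw [hd p, (Finset.mem_filter.1 hp).2]
      rw [Finset.sum_congr rfl e, Finset.sum_const, nsmul_eq_mul]
      congr 1
      push_cast
      congr 2
      refine Finset.filter_congr fun p _ => ?_
      simp only [hκ, Prod.mk.injEq]
    have htot : ∑ p ∈ F ×ˢ F, f (p.1 - p.2) = ∑ t ∈ Θ ×ˢ Θ ×ˢ Finset.Icc (-M) M,
        ∑ p ∈ F ×ˢ F, (if κ p = t then f (p.1 - p.2) else 0) := by
      rw [Finset.sum_comm]
      refine Finset.sum_congr rfl fun p hp => ?_
      rw [Finset.sum_ite_eq]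
      split_ifs with h
      · rfl
      · exact hvan p hp h
    rw [htot, Finset.sum_congr rfl hcard, Finset.sum_product]
    refine Finset.sum_congr rfl fun θ _ => ?_
    rw [Finset.sum_product]
  simp only [hR, Finset.mul_sum]
  refine tendsto_finsetSum _ fun θ _ => tendsto_finsetSum _ fun θ' _ =>
    tendsto_finsetSum _ fun m _ => ?_
  have h1 := tendsto_sum_Icc hN₀ hN hsum (isLocal_pairFun hw θ θ' m) (pairFun_nonneg h01 θ θ' m)
    (pairFun_le_one h01 θ θ' m) hξ (K := |(θ' - s) - (θ + m - s)| + 2)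
    (p := fun R => max ⌈-R - (θ' - s)⌉ ⌈-R - (θ + m - s)⌉)
    (q := fun R => min ⌊R - (θ' - s)⌋ ⌊R - (θ + m - s)⌋) (fun R => by
      have a1 := Int.le_ceil (-R - (θ' - s))
      have a2 := Int.ceil_lt_add_one (-R - (θ' - s))
      have a3 := Int.le_ceil (-R - (θ + m - s))
      have a4 := Int.ceil_lt_add_one (-R - (θ + m - s))
      have b1 := Int.floor_le (R - (θ' - s))
      have b2 := Int.lt_floor_add_one (R - (θ' - s))
      have b3 := Int.floor_le (R - (θ + m - s))
      have b4 := Int.lt_floor_add_one (R - (θ + m - s))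
      have c1 := le_abs_self ((θ' - s) - (θ + m - s))
      have c2 := neg_abs_le ((θ' - s) - (θ + m - s))
      rw [Int.cast_max, Int.cast_min, abs_le]
      rcases max_cases (⌈-R - (θ' - s)⌉ : ℝ) ⌈-R - (θ + m - s)⌉ with ⟨e1, _⟩ | ⟨e1, _⟩ <;>
      rcases min_cases (⌊R - (θ' - s)⌋ : ℝ) ⌊R - (θ + m - s)⌋ with ⟨e2, _⟩ | ⟨e2, _⟩ <;>
      rw [e1, e2] <;> constructor <;> linarith)
  have h2 := ((Complex.continuous_ofReal.tendsto _).comp h1).mul_const (f (m + θ - θ'))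
  refine h2.congr fun R => ?_
  simp only [Function.comp_apply]
  push_cast
  ring

/-- The autocorrelation measure. -/
def autocorrelation (N : ℕ → ℕ) (Θ : Finset ℝ) (w : ℝ → (ℤ → Letter) → ℝ) : Measure ℝ :=
  Measure.sum fun i : ({θ // θ ∈ Θ} × {θ // θ ∈ Θ}) × ℤ =>
    ENNReal.ofReal (correlation N w i.1.1 i.1.2 i.2) •
      Measure.dirac ((i.2 : ℝ) + ((i.1.1 : ℝ) - i.1.2))

/-- As |θ - θ'| < 1, a function vanishing where |x| ≥ M - 1 meets only the indices |m| ≤ M. -/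
theorem summable_of_bounded {E : Type*} [NormedAddCommGroup E] (hΘ : ∀ θ ∈ Θ, θ ∈ Ico (0 : ℝ) 1)
    {f : ℝ → E} {M : ℤ} (hM : ∀ x : ℝ, (M : ℝ) ≤ |x| + 1 → f x = 0)
    (c : ({θ // θ ∈ Θ} × {θ // θ ∈ Θ}) × ℤ → ℝ) :
    (∀ i : ({θ // θ ∈ Θ} × {θ // θ ∈ Θ}) × ℤ, i ∉ Finset.univ ×ˢ Finset.Icc (-M) M →
      f ((i.2 : ℝ) + ((i.1.1 : ℝ) - i.1.2)) = 0) ∧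
    Summable fun i : ({θ // θ ∈ Θ} × {θ // θ ∈ Θ}) × ℤ => c i * ‖f ((i.2 : ℝ) + ((i.1.1 : ℝ) - i.1.2))‖ := by
  have h : ∀ i : ({θ // θ ∈ Θ} × {θ // θ ∈ Θ}) × ℤ, i ∉ Finset.univ ×ˢ Finset.Icc (-M) M →
      f ((i.2 : ℝ) + ((i.1.1 : ℝ) - i.1.2)) = 0 := by
    rintro ⟨⟨⟨θ, hθ⟩, ⟨θ', hθ'⟩⟩, m⟩ hi
    refine hM _ ?_
    have b1 := hΘ θ hθ
    have b2 := hΘ θ' hθ'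
    by_contra! hlt
    refine hi ?_
    simp only [Finset.mem_product, Finset.mem_univ, Finset.mem_Icc, true_and]
    have h2 := abs_le.1 (le_refl |(m : ℝ) + (θ - θ')|)
    have c1 : ((-M : ℤ) : ℝ) ≤ (m : ℝ) := by
      push_cast
      linarith [b1.1, b1.2, b2.1, b2.2]
    have c2 : (m : ℝ) ≤ (M : ℝ) := by linarith [b1.1, b1.2, b2.1, b2.2]
    exact ⟨by exact_mod_cast c1, by exact_mod_cast c2⟩
  refine ⟨h, summable_of_ne_finset_zero (s := Finset.univ ×ˢ Finset.Icc (-M) M) fun i hi => ?_⟩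
  rw [h i hi, norm_zero, mul_zero]

theorem isLocallyFinite_autocorrelation (hΘ : ∀ θ ∈ Θ, θ ∈ Ico (0 : ℝ) 1) :
    IsLocallyFiniteMeasure (autocorrelation N Θ w) := by
  refine ⟨fun x => ⟨Metric.ball x 1, Metric.ball_mem_nhds x one_pos, ?_⟩⟩
  have hM : ∀ y : ℝ, ((⌈|x| + 2⌉ : ℤ) : ℝ) ≤ |y| + 1 →
      (Metric.ball x 1).indicator (fun _ => (1 : ℝ)) y = 0 := by
    intro y hy
    refine indicator_of_notMem (fun h => ?_) _
    rw [Metric.mem_ball, Real.dist_eq] at h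
    have h1 := Int.le_ceil (|x| + 2)
    have h2 := abs_sub_abs_le_abs_sub y x
    linarith
  have h := integrable_sum_dirac (fun i => ENNReal.ofReal_ne_top)
    (summable_of_bounded hΘ hM fun i => (ENNReal.ofReal (correlation N w i.1.1 i.1.2 i.2)).toReal).2
  have h1 : IntegrableOn (fun _ => (1 : ℝ)) (Metric.ball x 1) (autocorrelation N Θ w) :=
    (integrable_indicator_iff measurableSet_ball).1 h
  simpa [integrableOn_const_iff] using h1

theorem isAutocorrelation (hN₀ : N 0 = 0) (hN : StrictMono N)
    (hsum : Summable fun κ : {κ : ℕ // Odd κ} => (φ ^ gap N ((κ : ℕ) + 1))⁻¹)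
    {ξ : ℤ → Letter} (hξ : ξ ∈ sequenceSpace N) {s : ℝ} {Λ : Set ℝ} (hud : IsUniformlyDiscrete Λ)
    (hΘ : ∀ θ ∈ Θ, θ ∈ Ico (0 : ℝ) 1) (hw : ∀ θ, IsLocal r (w θ))
    (h01 : ∀ θ η, w θ η = 0 ∨ w θ η = 1)
    (hΛ : ∀ x, x ∈ Λ ↔ Int.fract (x + s) ∈ Θ ∧ w (Int.fract (x + s)) (shift ⌊x + s⌋ ξ) = 1) :
    IsAutocorrelation Λ (autocorrelation N Θ w) := by
  refine ⟨isLocallyFinite_autocorrelation hΘ, fun f hf hfs => ?_⟩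
  obtain ⟨C, hC⟩ := hfs.isCompact.isBounded.exists_norm_le
  have hM : ∀ x : ℝ, ((⌈C⌉ + 2 : ℤ) : ℝ) ≤ |x| + 1 → f x = 0 := by
    intro x hx
    by_contra h
    have h1 := hC x (subset_tsupport f h)
    have h2 := Int.le_ceil C
    rw [Real.norm_eq_abs] at h1
    push_cast at hx
    linarith
  have h := tendsto_autocorrelation hN₀ hN hsum hξ hud hΘ hw h01 hΛ hM
  obtain ⟨hz, hs⟩ := summable_of_bounded hΘ hM
    fun i => (ENNReal.ofReal (correlation N w i.1.1 i.1.2 i.2)).toReal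
  have e : ∫ x, f x ∂autocorrelation N Θ w = ∑ θ ∈ Θ, ∑ θ' ∈ Θ,
      ∑ m ∈ Finset.Icc (-(⌈C⌉ + 2)) (⌈C⌉ + 2), (correlation N w θ θ' m : ℂ) * f (m + θ - θ') := by
    rw [autocorrelation, integral_sum_dirac_eq_tsum (fun i => ENNReal.ofReal_ne_top) hs,
      tsum_eq_sum (s := Finset.univ ×ˢ Finset.Icc (-(⌈C⌉ + 2)) (⌈C⌉ + 2))
        (fun i hi => by rw [hz i hi, smul_zero]), Finset.sum_product, Fintype.sum_prod_type]
    rw [← Finset.sum_coe_sort Θ]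
    refine Finset.sum_congr rfl fun θ _ => ?_
    rw [← Finset.sum_coe_sort Θ]
    refine Finset.sum_congr rfl fun θ' _ => Finset.sum_congr rfl fun m _ => ?_
    rw [ENNReal.toReal_ofReal (correlation_nonneg h01 _ _ _), Complex.real_smul, add_sub_assoc]
  rw [e]
  exact h

/-- The Fourier coefficients of the weight functions. -/
def weightCoeff (N : ℕ → ℕ) (w : ℝ → (ℤ → Letter) → ℝ) (θ : ℝ) (n : ℤ) : ℂ :=
  fourierCoeff (fun x : UnitAddCircle => (w θ (seq N x) : ℂ)) n

/-- A shift of the sequence by m is a rotation by mφ, so the correlation is an inner product of two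
functions on the circle, one of them rotated: Parseval. -/
theorem hasSum_correlation (hw : ∀ θ, IsLocal r (w θ)) (h01 : ∀ θ η, w θ η = 0 ∨ w θ η = 1)
    (θ θ' : ℝ) (m : ℤ) :
    HasSum (fun n : ℤ => weightCoeff N w θ n * (starRingEnd ℂ) (weightCoeff N w θ' n) *
      ee (m * (n * φ))) (correlation N w θ θ' m) := by
  have hm : ∀ θ, Measurable fun x : UnitAddCircle => (w θ (seq N x) : ℂ) := fun θ =>
    Complex.measurable_ofReal.comp ((hw θ).measurable.comp measurable_seq)
  have hb : ∀ θ (x : UnitAddCircle), ‖(w θ (seq N x) : ℂ)‖ ≤ 1 := by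
    intro θ x
    rcases h01 θ (seq N x) with h | h <;> simp [h]
  have h := hasSum_fourierCoeff_mul (hm θ) (hm θ') (hb θ) (hb θ') (m * φ)
  have e : ∫ x : UnitAddCircle, (w θ (seq N (x + ((m * φ : ℝ) : UnitAddCircle))) : ℂ) *
      (starRingEnd ℂ) (w θ' (seq N x) : ℂ) = (correlation N w θ θ' m : ℂ) := by
    rw [correlation]
    refine Eq.trans ?_ integral_complex_ofReal
    refine integral_congr_ae (Eventually.of_forall fun x => ?_)
    simp only [seq_add, Complex.conj_ofReal, pairFun]
    push_cast
    rfl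
  rw [e] at h
  refine h.congr_fun fun n => ?_
  rw [weightCoeff, weightCoeff]
  congr 2
  ring

/-- The diffraction amplitudes. -/
def amplitude (N : ℕ → ℕ) (Θ : Finset ℝ) (w : ℝ → (ℤ → Letter) → ℝ) (p : ℤ × ℤ) : ℂ :=
  ∑ θ : {θ // θ ∈ Θ}, weightCoeff N w θ p.1 * ee (-((p.1 * φ + p.2) * θ))

/-- The diffraction measure. -/
def diffraction (N : ℕ → ℕ) (Θ : Finset ℝ) (w : ℝ → (ℤ → Letter) → ℝ) : Measure ℝ :=
  Measure.sum fun p : ℤ × ℤ =>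
    ENNReal.ofReal (Complex.normSq (amplitude N Θ w p)) • Measure.dirac (p.1 * φ + p.2)

theorem isPurePoint_diffraction : IsPurePoint (diffraction N Θ w) := by
  refine ⟨range fun p : ℤ × ℤ => (p.1 * φ + p.2 : ℝ), countable_range _, ?_⟩
  have hm : MeasurableSet (range fun p : ℤ × ℤ => (p.1 * φ + p.2 : ℝ)) :=
    (countable_range _).measurableSet
  rw [diffraction, Measure.sum_apply _ hm.compl, ENNReal.tsum_eq_zero]
  intro p
  have hp : (p.1 * φ + p.2 : ℝ) ∉ (range fun p : ℤ × ℤ => (p.1 * φ + p.2 : ℝ))ᶜ :=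
    fun h => h ⟨p, rfl⟩
  rw [Measure.smul_apply, Measure.dirac_apply' _ hm.compl, indicator_of_notMem hp, smul_zero]

theorem normSq_amplitude (p : ℤ × ℤ) (z : ℂ) :
    (Complex.normSq (amplitude N Θ w p) : ℂ) * z =
      ∑ i : {θ // θ ∈ Θ} × {θ // θ ∈ Θ}, weightCoeff N w i.1 p.1 *
        (starRingEnd ℂ) (weightCoeff N w i.2 p.1) *
        (ee (-((p.1 * φ + p.2) * ((i.1 : ℝ) - i.2))) * z) := by
  rw [← Complex.mul_conj, amplitude, map_sum, Finset.sum_mul_sum, Finset.sum_mul,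
    Fintype.sum_prod_type]
  refine Finset.sum_congr rfl fun θ _ => ?_
  rw [Finset.sum_mul]
  refine Finset.sum_congr rfl fun θ' _ => ?_
  rw [map_mul, conj_ee, show -((p.1 * φ + p.2) * ((θ : ℝ) - θ')) =
    -((p.1 * φ + p.2) * (θ : ℝ)) + - -((p.1 * φ + p.2) * (θ' : ℝ)) by ring, ee_add]
  ring

/-- Each pair (θ, θ') contributes a comb shifted by θ - θ' with weights given by an absolutely
convergent Fourier series, to which `tsum_comb` applies. Summing the pairs collects the products of
amplitudes into a square modulus. -/
theorem isFourierTransform (hw : ∀ θ, IsLocal r (w θ)) (h01 : ∀ θ η, w θ η = 0 ∨ w θ η = 1) :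
    IsFourierTransform (autocorrelation N Θ w) (diffraction N Θ w) := by
  intro g
  have hu : ∀ i : {θ // θ ∈ Θ} × {θ // θ ∈ Θ}, Summable fun n : ℤ =>
      ‖weightCoeff N w i.1 n * (starRingEnd ℂ) (weightCoeff N w i.2 n)‖ := by
    intro i
    -- Summable families of complex numbers are absolutely summable, and the phase factors have
    -- modulus 1.
    have := (hasSum_correlation (N := N) hw h01 i.1 i.2 0).summable.norm
    refine this.congr fun n => ?_
    rw [norm_mul _ (ee _), norm_ee, mul_one]
  have hcomb := fun i : {θ // θ ∈ Θ} × {θ // θ ∈ Θ} => tsum_comb (hu i)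
    (δ := (i.1 : ℝ) - i.2) (fun m => hasSum_correlation hw h01 i.1 i.2 m) g
  have hs1 : Summable fun i : ({θ // θ ∈ Θ} × {θ // θ ∈ Θ}) × ℤ =>
      (ENNReal.ofReal (correlation N w i.1.1 i.1.2 i.2)).toReal *
        ‖(𝓕 g) ((i.2 : ℝ) + ((i.1.1 : ℝ) - i.1.2))‖ := by
    have e : ∀ i : ({θ // θ ∈ Θ} × {θ // θ ∈ Θ}) × ℤ,
        (ENNReal.ofReal (correlation N w i.1.1 i.1.2 i.2)).toReal *
        ‖(𝓕 g) ((i.2 : ℝ) + ((i.1.1 : ℝ) - i.1.2))‖ =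
        ‖(correlation N w i.1.1 i.1.2 i.2 : ℂ) *
          (𝓕 g) ((i.2 : ℝ) + ((i.1.1 : ℝ) - i.1.2))‖ := fun i => by
      rw [ENNReal.toReal_ofReal (correlation_nonneg h01 _ _ _), norm_mul, Complex.norm_real,
        Real.norm_of_nonneg (correlation_nonneg h01 _ _ _)]
    simp only [e]
    rw [summable_prod_of_nonneg fun _ => norm_nonneg _]
    exact ⟨fun i => (hcomb i).1, (hasSum_fintype _).summable⟩
  have hs2 : Summable fun p : ℤ × ℤ =>
      (ENNReal.ofReal (Complex.normSq (amplitude N Θ w p))).toReal * ‖g (p.1 * φ + p.2)‖ := by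
    have h := (summable_sum (s := Finset.univ) fun i _ => (hcomb i).2.1.of_norm).norm
    refine h.congr fun p => ?_
    rw [← normSq_amplitude, norm_mul, Complex.norm_real, Real.norm_of_nonneg (Complex.normSq_nonneg _),
      ENNReal.toReal_ofReal (Complex.normSq_nonneg _)]
  refine ⟨integrable_sum_dirac (fun i => ENNReal.ofReal_ne_top) hs1,
    integrable_sum_dirac (fun i => ENNReal.ofReal_ne_top) hs2, ?_⟩
  rw [autocorrelation, diffraction, integral_sum_dirac_eq_tsum (fun i => ENNReal.ofReal_ne_top) hs1,
    integral_sum_dirac_eq_tsum (fun i => ENNReal.ofReal_ne_top) hs2]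
  have hs1' : Summable fun i : ({θ // θ ∈ Θ} × {θ // θ ∈ Θ}) × ℤ =>
      (ENNReal.ofReal (correlation N w i.1.1 i.1.2 i.2)).toReal •
        (𝓕 g) ((i.2 : ℝ) + ((i.1.1 : ℝ) - i.1.2)) := by
    refine Summable.of_norm (hs1.congr fun i => ?_)
    rw [norm_smul, Real.norm_of_nonneg ENNReal.toReal_nonneg]
  rw [hs1'.tsum_prod, tsum_fintype]
  have e1 : ∀ i : {θ // θ ∈ Θ} × {θ // θ ∈ Θ}, ∑' m : ℤ,
      (ENNReal.ofReal (correlation N w i.1 i.2 m)).toReal • (𝓕 g) ((m : ℝ) + ((i.1 : ℝ) - i.2)) =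
      ∑' p : ℤ × ℤ, weightCoeff N w i.1 p.1 * (starRingEnd ℂ) (weightCoeff N w i.2 p.1) *
        (ee (-((p.1 * φ + p.2) * ((i.1 : ℝ) - i.2))) * g (p.1 * φ + p.2)) := by
    intro i
    rw [← (hcomb i).2.2]
    refine tsum_congr fun m => ?_
    rw [ENNReal.toReal_ofReal (correlation_nonneg h01 _ _ _), Complex.real_smul]
  rw [Finset.sum_congr rfl fun i _ => e1 i,
    ← Summable.tsum_finsetSum fun i _ => (hcomb i).2.1.of_norm]
  refine tsum_congr fun p => ?_
  rw [← normSq_amplitude, ENNReal.toReal_ofReal (Complex.normSq_nonneg _), Complex.real_smul]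

theorem isPurePointDiffractive (hN₀ : N 0 = 0) (hN : StrictMono N)
    (hsum : Summable fun κ : {κ : ℕ // Odd κ} => (φ ^ gap N ((κ : ℕ) + 1))⁻¹)
    {n₀ : ℕ} (h₀ : ∀ n ≥ n₀, Even n → 3 ≤ gap N n) {ξ : ℤ → Letter}
    (hξ : ξ ∈ sequenceSpace N) (s : ℝ) : (tl ξ s).IsPurePointDiffractive := by
  intro Λ hΛ hmld
  obtain ⟨Θ, r, w, hΘ, hw, h01, h⟩ :=
    exists_local_description hN₀ hN h₀ hξ hΛ.1 hmld.1
  exact ⟨_, _, isAutocorrelation hN₀ hN hsum hξ hΛ.1 hΘ hw h01 h, isFourierTransform hw h01,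
    isPurePoint_diffraction⟩

end Diffraction

/-! ### The groups ℤ and ℤ + ℤφ -/

/-- The homomorphism `(k, n) ↦ k + n φ`. -/
def goldenHom : ℤ × ℤ →+ ℝ where
  toFun n := n.1 + n.2 * φ
  map_zero' := by simp
  map_add' x y := by simp only [Prod.fst_add, Prod.snd_add]; push_cast; ring

theorem eq_zero_of_intCast_add_mul {k n : ℤ} (h : (k : ℝ) + n * φ = 0) : k = 0 ∧ n = 0 := by
  have hn : n = 0 := by
    by_contra hn
    refine Real.goldenRatio_irrational ⟨-k / n, ?_⟩
    have : (n : ℝ) ≠ 0 := by exact_mod_cast hn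
    push_cast
    rw [div_eq_iff this]
    linarith
  subst hn
  simpa using h

theorem goldenHom_injective : Function.Injective goldenHom :=
  (injective_iff_map_eq_zero _).2 fun _ h =>
    Prod.ext (eq_zero_of_intCast_add_mul h).1 (eq_zero_of_intCast_add_mul h).2

theorem finrank_range_of_injective {G : Type*} [AddCommGroup G] (f : G →+ ℝ)
    (hf : Function.Injective f) : Module.finrank ℤ f.range = Module.finrank ℤ G :=
  (AddMonoidHom.ofInjective hf).toIntLinearEquiv.finrank_eq.symm

theorem intCast_range_inf_zmultiples : (Int.castAddHom ℝ).range ⊓ AddSubgroup.zmultiples φ = ⊥ := by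
  refine (AddSubgroup.eq_bot_iff_forall _).2 ?_
  rintro x ⟨⟨k, rfl⟩, hx⟩
  obtain ⟨n, hn⟩ := AddSubgroup.mem_zmultiples_iff.1 hx
  rw [zsmul_eq_mul] at hn
  have h : (k : ℝ) + (-n : ℤ) * φ = 0 := by
    push_cast
    rw [Int.coe_castAddHom] at hn
    linarith
  rw [(eq_zero_of_intCast_add_mul h).1, map_zero]

theorem intCast_range_sup_zmultiples :
    (Int.castAddHom ℝ).range ⊔ AddSubgroup.zmultiples φ = goldenHom.range := by
  ext x
  rw [AddSubgroup.mem_sup]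
  constructor
  · rintro ⟨_, ⟨k, rfl⟩, z, hz, rfl⟩
    obtain ⟨n, rfl⟩ := AddSubgroup.mem_zmultiples_iff.1 hz
    exact ⟨(k, n), by simp [goldenHom]⟩
  · rintro ⟨⟨k, n⟩, rfl⟩
    exact ⟨k, ⟨k, rfl⟩, n • φ, AddSubgroup.zsmul_mem_zmultiples _ _, by simp [goldenHom]⟩

end ScrambledFibonacci

end

theorem mainTheorem7 (N : ℕ → ℕ) (hN₀ : N 0 = 0) (hN : StrictMono N)
    (hodd : ∀ κ : ℕ, Odd κ → N (κ - 1) ≤ ScrambledFibonacci.gap N κ)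
    (hsum : Summable fun κ : {κ : ℕ // Odd κ} =>
      (Real.goldenRatio ^ ScrambledFibonacci.gap N ((κ : ℕ) + 1))⁻¹) :
    (ScrambledFibonacci.tilingSpace N 1 1).Nonempty ∧
    {β : ℝ | ScrambledFibonacci.IsTopologicalEigenvalue (ScrambledFibonacci.flow N 1 1) β} =
      Set.range (fun n : ℤ => (n : ℝ)) ∧
    (∀ T ∈ ScrambledFibonacci.tilingSpace N 1 1,
      T.IsRepetitive ∧ T.IsMeyer ∧ T.IsPurePointDiffractive) ∧
    ∃ μ : MeasureTheory.Measure (ScrambledFibonacci.tilingSpace N 1 1),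
      ScrambledFibonacci.IsInvariantProbability (ScrambledFibonacci.flow N 1 1) μ ∧
      (∀ ν : MeasureTheory.Measure (ScrambledFibonacci.tilingSpace N 1 1),
        ScrambledFibonacci.IsInvariantProbability (ScrambledFibonacci.flow N 1 1) ν → ν = μ) ∧
      ScrambledFibonacci.HasPurePointSpectrum (ScrambledFibonacci.flow N 1 1) μ ∧
      (∃ β : ℝ, ScrambledFibonacci.IsEigenvalue (ScrambledFibonacci.flow N 1 1) μ β ∧
        ¬ ScrambledFibonacci.IsTopologicalEigenvalue (ScrambledFibonacci.flow N 1 1) β) ∧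
      ∃ E E_top C : AddSubgroup ℝ,
        (E : Set ℝ) =
          {β : ℝ | ScrambledFibonacci.IsEigenvalue (ScrambledFibonacci.flow N 1 1) μ β} ∧
        (E_top : Set ℝ) =
          {β : ℝ | ScrambledFibonacci.IsTopologicalEigenvalue (ScrambledFibonacci.flow N 1 1) β} ∧
        E_top ⊓ C = ⊥ ∧ E_top ⊔ C = E ∧
        Module.finrank ℤ E_top = 1 ∧ Module.finrank ℤ E = 2 := by
  obtain ⟨n₀, h₀⟩ := ScrambledFibonacci.exists_three_le_gap hsum
  obtain ⟨ξ₀, hξ₀⟩ := ScrambledFibonacci.sequenceSpace_nonempty hN₀ hN hsum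
  have htop : {β : ℝ | ScrambledFibonacci.IsTopologicalEigenvalue (ScrambledFibonacci.flow N 1 1) β} =
      Set.range (fun n : ℤ => (n : ℝ)) := by
    ext β
    constructor
    · intro h
      exact ScrambledFibonacci.IsTopologicalEigenvalue.exists_int hN₀ hN hodd h₀ h
    · rintro ⟨n, rfl⟩
      exact ScrambledFibonacci.isTopologicalEigenvalue_int ⟨ξ₀, hξ₀⟩ n
  have hμ := ScrambledFibonacci.isInvariantProbability_tilingMeasure hN₀ hN hsum ⟨ξ₀, hξ₀⟩
  have hev := ScrambledFibonacci.isEigenvalue_iff hN₀ hN hsum ⟨ξ₀, hξ₀⟩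
  refine ⟨⟨_, ScrambledFibonacci.tl_mem hξ₀ 0⟩, htop, ?_, ScrambledFibonacci.tilingMeasure ⟨ξ₀, hξ₀⟩, hμ,
    fun ν hν => ScrambledFibonacci.invariantProbability_unique hN₀ hN ⟨ξ₀, hξ₀⟩ hν hμ,
    ScrambledFibonacci.hasPurePointSpectrum_tilingMeasure hN₀ hN hsum ⟨ξ₀, hξ₀⟩,
    -- The eigenvalue φ = 0 + 1·φ is not an integer, hence not topological.
    ⟨Real.goldenRatio, (hev _).2 ⟨(0, 1), by simp⟩, fun h => ?_⟩,
    ScrambledFibonacci.goldenHom.range, (Int.castAddHom ℝ).range, AddSubgroup.zmultiples Real.goldenRatio,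
    ?_, ?_, ScrambledFibonacci.intCast_range_inf_zmultiples, ScrambledFibonacci.intCast_range_sup_zmultiples, ?_, ?_⟩
  · intro T hT
    obtain ⟨ξ, hξ, s, -, rfl⟩ := ScrambledFibonacci.exists_eq_tl hT
    exact ⟨ScrambledFibonacci.isRepetitive hN₀ hN h₀ hξ s, ScrambledFibonacci.isMeyer hN₀ hN hξ s,
      ScrambledFibonacci.isPurePointDiffractive hN₀ hN hsum h₀ hξ s⟩
  · obtain ⟨n, hn⟩ := ScrambledFibonacci.IsTopologicalEigenvalue.exists_int hN₀ hN hodd h₀ h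
    exact Real.goldenRatio_irrational ⟨n, by exact_mod_cast hn⟩
  · ext β
    exact (hev β).symm
  · rw [htop]
    rfl
  · rw [ScrambledFibonacci.finrank_range_of_injective _ Int.cast_injective, Module.finrank_self]
  · rw [ScrambledFibonacci.finrank_range_of_injective _ ScrambledFibonacci.goldenHom_injective, Module.finrank_prod, Module.finrank_self]
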